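/- Let $G$ be a (real) semisimple Lie group with Lie algebra $\mathfrak g$ and Killing form $B$, and let $P\subset G$ be a parabolic subgroup, i.e. a closed subgroup whose Lie algebra $\mathfrak p$ is a parabolic subalgebra: $\mathfrak p_{\mathbb C}$ contains a Cartan subalgebra $\mathfrak h$ of $\mathfrak g_{\mathbb C}$ and all root spaces of a system of positive roots ($\mathfrak p_{\mathbb C}$ is then called standard for these choices). Consider parabolic geometries $(p:\mathcal G\to M,\omega)$ of type $(G,P)$, i.e. smooth principal $P$-bundles with a Cartan connection $\omega$ with values in $\mathfrak g$. For a finite dimensional representation $W$ of $P$, the natural bundle $WM=\mathcal G\times_P W$ has sections $\Gamma(WM)\cong C^\infty(\mathcal G,W)^P$. The fundamental derivative $D:\Gamma(WM)\to\Gamma(\mathcal A^*M\otimes WM)$, with $\mathcal AM=\mathcal G\times_P\mathfrak g$, is given by $(Df)(u)(X)=(\omega_u^{-1}(X)\cdot f)(u)$, and the curved Casimir operator is $$\mathcal C(f)(u)=\sum_\ell (D^2 f)(u)(\xi_\ell,\xi^\ell),$$ where $\{\xi_\ell\}$ and $\{\xi^\ell\}$ are bases of $\mathfrak g$ which are dual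 with respect to $B$. (1) For every finite dimensional representation $W$ of $P$ and every parabolic geometry of type $(G,P)$, $\mathcal C$ maps $\Gamma(WM)$ to itself and is a linear differential operator of order at most one. (2) Let $W$ be a finite dimensional irreducible representation of $P$, which is either a complex representation (irreducible over $\mathbb C$) or a real representation without $P$-invariant complex structure; put $\mathbb K=\mathbb C$, respectively $\mathbb K=\mathbb R$. Then there is a scalar $c\in\mathbb K$, depending only on $W$, such that $\mathcal C(\sigma)=c\,\sigma$ for every parabolic geometry $(p:\mathcal G\to M,\omega)$ of type $(G,P)$ and every $\sigma\in\Gamma(WM)$. Moreover, for every Cartan subalgebra $\mathfrak h\subset\mathfrak g_{\mathbb C}$ and every choice of positive roots for which $\mathfrak p_{\mathbb C}$ is standard, if $-\nu\in\mathfrak h^*$ is a lowest weight of $W$ (respectively of $W\otimes_{\mathbb R}\mathbb C$ in the real case), i.e. the weight of a nonzero vector annihilated by all elements of $\mathfrak p_{\mathbb C}$ lying in negative root spaces, then $$c=\|\nu+\rho\|^2-\|\rho\|^2=\langle\nu,\nu\rangle+2\langle\nu,\rho\rangle ,$$ where $\rho$ is half the sum of the positive roots, $\langle\ ,\ \rangle$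 is the complex bilinear form on $\mathfrak h^*$ induced by the Killing form, and $\|\chi\|^2=\langle\chi,\chi\rangle$. -/

import Mathlib

open scoped Manifold ContDiff TensorProduct

noncomputable section

namespace CurvedCasimir

open LieAlgebra LieAlgebra.IsKilling

/-! ### Complex semisimple Lie algebras: positive systems, weights, standard parabolics -/

section Complex

variable {L : Type*} [LieRing L] [LieAlgebra ℂ L] [FiniteDimensional ℂ L] [IsKilling ℂ L]
  (H : LieSubalgebra ℂ L) [H.IsCartanSubalgebra]

/-- The complex bilinear form on `𝔥*` induced by the Killing form: `⟨χ, μ⟩ = B(H_χ, H_μ)`, where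
`H_χ ∈ 𝔥` is the element with `B(H_χ, h) = χ h` for all `h ∈ 𝔥`. In particular
`‖χ‖² = ⟨χ, χ⟩` for this (bilinear, not Hermitian) form. -/
def weightInner (χ μ : Module.Dual ℂ H) : ℂ :=
  killingForm ℂ L ((cartanEquivDual H).symm χ : H) ((cartanEquivDual H).symm μ : H)

variable {H}

/-- `ρ`, half the sum of the positive roots, the positive system being given by a base. -/
def halfSumPosRoots (b : (rootSystem H).Base) : Module.Dual ℂ H :=
  open scoped Classical in
  (1 / 2 : ℂ) • ∑ α : H.root with b.IsPos α, (rootSystem H).root α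

/-- `𝔭` is a standard parabolic for the Cartan subalgebra `𝔥` and the positive system given by the
base `b`: it contains `𝔥` and all positive root spaces. -/
def IsStandardParabolic (b : (rootSystem H).Base) (p : Submodule ℂ L) : Prop :=
  H.toSubmodule ≤ p ∧
    ∀ α : H.root, b.IsPos α → (rootSpace H (α : LieModule.Weight ℂ H L)).toSubmodule ≤ p

end Complex

/-! ### Complexification -/

section Complexification

variable {𝔤 : Type*} [LieRing 𝔤] [LieAlgebra ℝ 𝔤] [FiniteDimensional ℝ 𝔤]

/-- The complexification of a real Lie algebra with non-degenerate Killing form has non-degenerate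
Killing form. -/
instance isKilling_complexification [IsKilling ℝ 𝔤] : IsKilling ℂ (ℂ ⊗[ℝ] 𝔤) := by
  classical
  refine ⟨?_⟩
  rw [eq_bot_iff]
  intro x hx
  have hx' : ∀ y, killingForm ℂ (ℂ ⊗[ℝ] 𝔤) x y = 0 := by
    intro y
    rw [LieIdeal.mem_killingCompl] at hx
    rw [LieModule.traceForm_comm]
    exact hx y trivial
  have hform : killingForm ℂ (ℂ ⊗[ℝ] 𝔤) = (killingForm ℝ 𝔤).baseChange ℂ :=
    LieModule.traceForm_baseChange ℝ 𝔤 𝔤 ℂ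
  have hB := IsKilling.killingForm_nondegenerate ℝ 𝔤
  let b := Module.finBasis ℝ 𝔤
  let b' := (killingForm ℝ 𝔤).dualBasis hB b
  let bC := b.baseChange ℂ
  rw [LieSubmodule.mem_bot]
  apply bC.ext_elem
  intro j
  have h1 := hx' (1 ⊗ₜ b' j)
  rw [← bC.sum_repr x, hform] at h1
  simp only [map_sum, LinearMap.sum_apply, map_smul, LinearMap.smul_apply] at h1
  rw [Finset.sum_eq_single j] at h1
  · have h2 : (killingForm ℝ 𝔤) (b j) (b' j) = 1 := by
      rw [LieModule.traceForm_comm]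
      simpa using LinearMap.BilinForm.apply_dualBasis_left hB b j j
    simpa [bC, h2] using h1
  · intro i _ hij
    have h2 : (killingForm ℝ 𝔤) (b i) (b' j) = 0 := by
      rw [LieModule.traceForm_comm]
      rw [LinearMap.BilinForm.apply_dualBasis_left hB b j i]
      simp [hij]
    simp [bC, h2]
  · simp

variable [IsKilling ℝ 𝔤] {𝔮 : Type*} [AddCommGroup 𝔮] [Module ℝ 𝔮]

/-- A (real) subspace `𝔭` of `𝔤`, given as the image of `j : 𝔮 → 𝔤`, is a parabolic subalgebra if
its complexification is a standard parabolic subalgebra of `𝔤_ℂ` for some choice of Cartan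
subalgebra of `𝔤_ℂ` and of positive roots. -/
def IsParabolicImage (j : 𝔮 →ₗ[ℝ] 𝔤) : Prop :=
  ∃ (H : LieSubalgebra ℂ (ℂ ⊗[ℝ] 𝔤)) (_ : H.IsCartanSubalgebra) (b : (rootSystem H).Base),
    IsStandardParabolic b (LinearMap.range (j.baseChange ℂ))

/-- Let `𝔭 ⊆ 𝔤` be the image of the injective map `j : 𝔮 → 𝔤`, and let `a` be the action of
`𝔮 ≅ 𝔭` on a complex vector space `V`, extended complex linearly to `𝔭_ℂ`. Then `χ ∈ 𝔥*` is a
lowest weight of `V` if there is a nonzero `v ∈ V` which is a weight vector of weight `χ` for `𝔥`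
and is annihilated by all those elements of `𝔭_ℂ` which lie in a negative root space. -/
def IsLowestWeight (j : 𝔮 →ₗ[ℝ] 𝔤) {V : Type*} [AddCommGroup V] [Module ℂ V] [Module ℝ V]
    [IsScalarTower ℝ ℂ V] [SMulCommClass ℂ ℝ V] (a : 𝔮 →ₗ[ℝ] Module.End ℂ V)
    {H : LieSubalgebra ℂ (ℂ ⊗[ℝ] 𝔤)} [H.IsCartanSubalgebra] (b : (rootSystem H).Base)
    (χ : Module.Dual ℂ H) : Prop :=
  ∃ v : V, v ≠ 0 ∧
    (∀ (z : ℂ ⊗[ℝ] 𝔮) (hz : j.baseChange ℂ z ∈ H),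
      a.liftBaseChange ℂ z v = χ ⟨j.baseChange ℂ z, hz⟩ • v) ∧
    ∀ α : H.root, b.IsPos α → ∀ z : ℂ ⊗[ℝ] 𝔮,
      j.baseChange ℂ z ∈ rootSpace H (-(α : LieModule.Weight ℂ H (ℂ ⊗[ℝ] 𝔤)) : H → ℂ) →
        a.liftBaseChange ℂ z v = 0

end Complexification

/-! ### Lie groups and parabolic subgroups -/

section Groups

variable {E : Type*} [NormedAddCommGroup E] [NormedSpace ℝ E]
  {G : Type*} [TopologicalSpace G] [ChartedSpace E G] [Group G]

instance lieGroup_minSmoothness [LieGroup 𝓘(ℝ, E) ∞ G] :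
    LieGroup 𝓘(ℝ, E) (minSmoothness ℝ 3) G := by
  rw [minSmoothness_of_isRCLikeNormedField]
  infer_instance

instance finiteDimensional_groupLieAlgebra [FiniteDimensional ℝ E] :
    FiniteDimensional ℝ (GroupLieAlgebra 𝓘(ℝ, E) G) :=
  inferInstanceAs (FiniteDimensional ℝ E)

variable (E G) in
/-- The Lie algebra `𝔤 = T_1 G` has the model space `E` as its underlying vector space; this
identification provides the norm on `𝔤` that is used to speak about smooth maps. -/
def modelEquiv : E ≃L[ℝ] GroupLieAlgebra 𝓘(ℝ, E) G :=
  ContinuousLinearEquiv.refl ℝ E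

/-- The adjoint action of `G` on `𝔤`, i.e. the derivative of `x ↦ g x g⁻¹` at `1`. -/
def Ad (g : G) : GroupLieAlgebra 𝓘(ℝ, E) G →L[ℝ] GroupLieAlgebra 𝓘(ℝ, E) G :=
  mfderiv 𝓘(ℝ, E) 𝓘(ℝ, E) (fun x : G => g * x * g⁻¹) 1

variable (P : Subgroup G) {EP : Type*} [NormedAddCommGroup EP] [NormedSpace ℝ EP]
  [ChartedSpace EP P]

/-- The derivative at `1` of the inclusion `P → G`, mapping the Lie algebra of `P` to `𝔤`. -/
def lieIncl : GroupLieAlgebra 𝓘(ℝ, EP) P →L[ℝ] GroupLieAlgebra 𝓘(ℝ, E) G :=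
  mfderiv 𝓘(ℝ, EP) 𝓘(ℝ, E) (Subtype.val : P → G) 1

/-- `P` is a parabolic subgroup of the semisimple Lie group `G`: a closed Lie subgroup (with
its given manifold structure) whose Lie algebra `𝔭 ⊆ 𝔤` is a parabolic subalgebra. -/
structure IsParabolicSubgroup [FiniteDimensional ℝ E] [LieGroup 𝓘(ℝ, E) ∞ G]
    [IsKilling ℝ (GroupLieAlgebra 𝓘(ℝ, E) G)] : Prop where
  isClosed : IsClosed (P : Set G)
  contMDiff_val : ContMDiff 𝓘(ℝ, EP) 𝓘(ℝ, E) ∞ (Subtype.val : P → G)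
  injective_lieIncl : Function.Injective (lieIncl (E := E) (EP := EP) P)
  parabolic : IsParabolicImage
    (lieIncl (E := E) (EP := EP) P).toLinearMap

end Groups

/-! ### Representations of a Lie group `P` -/

section Representations

variable {P : Type*} [Group P] {EP : Type*} [NormedAddCommGroup EP] [NormedSpace ℝ EP]
  [TopologicalSpace P] [ChartedSpace EP P]

/-- The underlying algebraic representation. -/
def toRepresentation {𝕜 : Type*} [RCLike 𝕜] {W : Type*} [NormedAddCommGroup W] [NormedSpace 𝕜 W]
    (π : P →* (W →L[𝕜] W)) : Representation 𝕜 P W :=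
  (ContinuousLinearMap.toLinearMapRingHom (R₁ := 𝕜) (M₁ := W)).toMonoidHom.comp π

/-- The real representation underlying a complex representation. -/
def realForm {W : Type*} [NormedAddCommGroup W] [NormedSpace ℂ W] (π : P →* (W →L[ℂ] W)) :
    P →* (W →L[ℝ] W) where
  toFun h := (π h).restrictScalars ℝ
  map_one' := by ext; simp
  map_mul' _ _ := by ext; simp

/-- The infinitesimal action of the Lie algebra of `P` on a complex representation. -/
def infAction {W : Type*} [NormedAddCommGroup W] [NormedSpace ℂ W] (π : P →* (W →L[ℂ] W)) :
    GroupLieAlgebra 𝓘(ℝ, EP) P →ₗ[ℝ] Module.End ℂ W where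
  toFun A := (NormedSpace.fromTangentSpace (𝕜 := ℝ) (π 1)
    (mfderiv 𝓘(ℝ, EP) 𝓘(ℝ, W →L[ℂ] W) π 1 A)).toLinearMap
  map_add' A B := by rw [map_add, map_add]; rfl
  map_smul' c A := by rw [map_smul, map_smul]; rfl

/-- The infinitesimal action of the Lie algebra of `P` on a real representation `W`, extended to
the complexification `ℂ ⊗ W`. -/
def infActionComplexified {W : Type*} [NormedAddCommGroup W] [NormedSpace ℝ W]
    (π : P →* (W →L[ℝ] W)) :
    GroupLieAlgebra 𝓘(ℝ, EP) P →ₗ[ℝ] Module.End ℂ (ℂ ⊗[ℝ] W) where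
  toFun A := ((NormedSpace.fromTangentSpace (𝕜 := ℝ) (π 1)
    (mfderiv 𝓘(ℝ, EP) 𝓘(ℝ, W →L[ℝ] W) π 1 A)).toLinearMap).baseChange ℂ
  map_add' A B := by rw [map_add, map_add]; exact LinearMap.baseChange_add _ _
  map_smul' c A := by rw [map_smul, map_smul]; exact LinearMap.baseChange_smul _ _

/-- The real representation `W` admits a `P`-invariant complex structure. -/
def HasInvariantComplexStructure {W : Type*} [NormedAddCommGroup W] [NormedSpace ℝ W]
    (π : P →* (W →L[ℝ] W)) : Prop :=
  ∃ J : W →ₗ[ℝ] W, (∀ w, J (J w) = -w) ∧ ∀ h w, J (π h w) = π h (J w)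

end Representations

/-! ### Parabolic geometries, fundamental derivative, curved Casimir operator -/

section Geometry

variable {E : Type*} [NormedAddCommGroup E] [NormedSpace ℝ E]
  {G : Type*} [TopologicalSpace G] [ChartedSpace E G] [Group G]
  (P : Subgroup G) {EP : Type*} [NormedAddCommGroup EP] [NormedSpace ℝ EP] [ChartedSpace EP P]
  {EM : Type*} [NormedAddCommGroup EM] [NormedSpace ℝ EM]
  (M : Type*) [TopologicalSpace M] [ChartedSpace EM M]
  {EB : Type*} [NormedAddCommGroup EB] [NormedSpace ℝ EB]
  (B : Type*) [TopologicalSpace B] [ChartedSpace EB B] [IsManifold 𝓘(ℝ, EB) ∞ B]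

/-- A Cartan geometry `(p : B → M, ω)` of type `(G, P)`: a smooth principal bundle `B → M` with
structure group `P` together with a Cartan connection `ω = conn`. -/
structure CartanGeometry where
  /-- the bundle projection -/
  proj : B → M
  /-- the principal right action of `P` -/
  act : B → P → B
  act_one : ∀ u, act u 1 = u
  act_mul : ∀ u h k, act u (h * k) = act (act u h) k
  contMDiff_act : ContMDiff (𝓘(ℝ, EB).prod 𝓘(ℝ, EP)) 𝓘(ℝ, EB) ∞ fun q : B × P => act q.1 q.2
  /-- Around each point of `M` there is a smooth `P`-equivariant local trivialization. -/
  locallyTrivial : ∀ x : M, ∃ e : Bundle.Trivialization P proj, x ∈ e.baseSet ∧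
    ContMDiffOn 𝓘(ℝ, EB) (𝓘(ℝ, EM).prod 𝓘(ℝ, EP)) ∞ e e.source ∧
    ContMDiffOn (𝓘(ℝ, EM).prod 𝓘(ℝ, EP)) 𝓘(ℝ, EB) ∞ e.toOpenPartialHomeomorph.symm e.target ∧
    ∀ u ∈ e.source, ∀ h : P, act u h ∈ e.source ∧ e (act u h) = ((e u).1, (e u).2 * h)
  /-- the Cartan connection `ω`, a linear isomorphism `T_u B ≅ 𝔤` at each point -/
  conn : ∀ u : B, TangentSpace 𝓘(ℝ, EB) u ≃L[ℝ] GroupLieAlgebra 𝓘(ℝ, E) G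
  contMDiff_conn : ContMDiff 𝓘(ℝ, EB).tangent 𝓘(ℝ, E) ∞
    fun v : TangentBundle 𝓘(ℝ, EB) B => (modelEquiv E G).symm (conn v.1 v.2)
  /-- `(r^h)^* ω = Ad(h⁻¹) ∘ ω` -/
  equivariant : ∀ (u : B) (h : P) (X : TangentSpace 𝓘(ℝ, EB) u),
    conn (act u h) (mfderiv 𝓘(ℝ, EB) 𝓘(ℝ, EB) (fun v => act v h) u X) = Ad (h : G)⁻¹ (conn u X)
  /-- `ω` reproduces the generators of fundamental vector fields, the value at `u` of the
  fundamental vector field of `A` being the derivative of `h ↦ u · h` at `1` applied to `A`. -/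
  reproduces : ∀ (u : B) (A : GroupLieAlgebra 𝓘(ℝ, EP) P),
    conn (act u 1) (mfderiv 𝓘(ℝ, EP) 𝓘(ℝ, EB) (fun h => act u h) 1 A) = lieIncl P A

namespace CartanGeometry

variable {P M B}
variable (𝒢 : CartanGeometry (E := E) (EP := EP) (EM := EM) (EB := EB) P M B)

/-- The space of smooth sections of the natural bundle `B ×_P W` induced by a representation `π`
of `P` on `W`, realized as the space `C^∞(B, W)^P` of smooth functions `f : B → W` such that
`f (u · h) = h⁻¹ · f u`. -/
def sections {W : Type*} [NormedAddCommGroup W] [NormedSpace ℝ W] (π : P →* (W →L[ℝ] W)) :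
    Submodule ℝ (B → W) where
  carrier := {f | ContMDiff 𝓘(ℝ, EB) 𝓘(ℝ, W) ∞ f ∧ ∀ u h, f (𝒢.act u h) = π h⁻¹ (f u)}
  zero_mem' := ⟨contMDiff_const, by simp⟩
  add_mem' hf hg := ⟨hf.1.add hg.1, by simp [hf.2, hg.2]⟩
  smul_mem' c _ hf := ⟨(contDiff_const_smul c).contMDiff.comp hf.1, by simp [hf.2]⟩

/-- The fundamental derivative `σ ↦ Dσ` from sections of the bundle induced by `V` to sections of
the bundle induced by `𝔤* ⊗ V = Hom(𝔤, V)`, in terms of equivariant functions: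
`(Df)(u)(X) = (ω_u⁻¹(X) · f)(u)`. -/
def fundamentalDerivative {V : Type*} [NormedAddCommGroup V] [NormedSpace ℝ V] (f : B → V) :
    B → (E →L[ℝ] V) := fun u =>
  ((NormedSpace.fromTangentSpace (𝕜 := ℝ) (f u) : TangentSpace 𝓘(ℝ, V) (f u) →L[ℝ] V).comp
    (mfderiv 𝓘(ℝ, EB) 𝓘(ℝ, V) f u)).comp
    (((𝒢.conn u).symm : GroupLieAlgebra 𝓘(ℝ, E) G →L[ℝ] TangentSpace 𝓘(ℝ, EB) u).comp
      (modelEquiv E G : E →L[ℝ] GroupLieAlgebra 𝓘(ℝ, E) G))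

/-- The curved Casimir operator `(B ⊗ id) ∘ D²`: the second fundamental derivative `D²f`, with
values in `𝔤* ⊗ 𝔤* ⊗ W`, is contracted with the Killing form, i.e. evaluated and summed over a
basis of `𝔤` and the basis dual to it with respect to the Killing form (the result does not depend
on the basis). -/
def curvedCasimir [FiniteDimensional ℝ E] [LieGroup 𝓘(ℝ, E) ∞ G]
    [IsKilling ℝ (GroupLieAlgebra 𝓘(ℝ, E) G)]
    {W : Type*} [NormedAddCommGroup W] [NormedSpace ℝ W] (f : B → W) : B → W := fun u =>
  let ξ := Module.finBasis ℝ (GroupLieAlgebra 𝓘(ℝ, E) G)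
  let ξ' := (killingForm ℝ (GroupLieAlgebra 𝓘(ℝ, E) G)).dualBasis
    (IsKilling.killingForm_nondegenerate ℝ (GroupLieAlgebra 𝓘(ℝ, E) G)) ξ
  ∑ l, 𝒢.fundamentalDerivative (𝒢.fundamentalDerivative f) u
    ((modelEquiv E G).symm (ξ l)) ((modelEquiv E G).symm (ξ' l))

/-- The product of a function on `M` and a section, in terms of equivariant functions. -/
def baseMul {W : Type*} [NormedAddCommGroup W] [NormedSpace ℝ W] (g : M → ℝ) (f : B → W) : B → W :=
  fun u => g (𝒢.proj u) • f u

/-- The operator `T` on sections has order at most `k`: it commutes with multiplication by smooth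
functions on `M` if `k = 0`, and for `k + 1`, all its commutators with multiplications by smooth
functions on `M` have order at most `k`. -/
def HasOrderLE {W : Type*} [NormedAddCommGroup W] [NormedSpace ℝ W] (π : P →* (W →L[ℝ] W)) :
    ℕ → ((B → W) → (B → W)) → Prop
  | 0, T => ∀ g : M → ℝ, ContMDiff 𝓘(ℝ, EM) 𝓘(ℝ, ℝ) ∞ g → ∀ f ∈ 𝒢.sections π,
      T (𝒢.baseMul g f) = 𝒢.baseMul g (T f)
  | k + 1, T => ∀ g : M → ℝ, ContMDiff 𝓘(ℝ, EM) 𝓘(ℝ, ℝ) ∞ g →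
      HasOrderLE π k fun f => T (𝒢.baseMul g f) - 𝒢.baseMul g (T f)

/-- `T` is a (linear) differential operator of order at most `k` from the smooth sections of the
bundle induced by `π` to themselves. -/
structure IsDifferentialOperator {W : Type*} [NormedAddCommGroup W] [NormedSpace ℝ W]
    (π : P →* (W →L[ℝ] W)) (k : ℕ) (T : (B → W) → (B → W)) : Prop where
  maps_sections : ∀ f ∈ 𝒢.sections π, T f ∈ 𝒢.sections π
  map_add : ∀ f ∈ 𝒢.sections π, ∀ g ∈ 𝒢.sections π, T (f + g) = T f + T g
  map_smul : ∀ c : ℝ, ∀ f ∈ 𝒢.sections π, T (c • f) = c • T f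
  order_le : 𝒢.HasOrderLE π k T

end CartanGeometry

end Geometry

end CurvedCasimir

end

noncomputable section

set_option linter.unusedSectionVars false

namespace CurvedCasimir

open LieAlgebra LieAlgebra.IsKilling VectorField

/-! ### Root vectors, dual bases and weights of a complex semisimple Lie algebra -/

section Complex

variable {L : Type*} [LieRing L] [LieAlgebra ℂ L] [FiniteDimensional ℂ L] [IsKilling ℂ L]
  {H : LieSubalgebra ℂ L} [H.IsCartanSubalgebra]

/-! Everything is pointwise algebra once the derivatives in directions of 𝔭 are known. Equivariance
of f and of ω, together with ω reproducing fundamental fields, gives for A in 𝔭 Df(A) = -A·f,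
D²f(A,Y) = -A·Df(Y) + Df([A,Y]), D²f(Y,A) = -A·Df(Y). These identities are isolated in `IsJet` and
proved in `CartanGeometry.isJet`; the bracket term is the derivative of Ad at the neutral element
(`mfderiv_Ad_one`).

The contraction with the Killing form may be computed over ℂ in any pair of dual families
(`killingContraction_eq_sum`). Take dual bases of 𝔥 and root vectors e_α, f_α in the root spaces of
α and -α with B(e_α,f_α) = 1. In every term at least one slot lies in 𝔭_ℂ. For functions g₁, g₂
pulled back from M, the iterated commutator of the Casimir operator with g₁ and g₂ is the
contraction of dg₁⊗dg₂ + dg₂⊗dg₁ times f; as both differentials kill 𝔭, it vanishes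
(`killingContraction_eq_zero_of_vanish`). This is order at most one.

For irreducible W the first order part drops out too. What remains is e·Df(f') with e a root vector
in 𝔭_ℂ and f' its dual partner. Since 𝔭_ℂ is a sum of weight spaces, either f' lies in 𝔭_ℂ and
Df(f') is algebraic, or e is orthogonal to 𝔭_ℂ (`mem_or_orthogonal`). In the latter case e acts by
zero: a highest weight vector of the complex representation (in the real case, of its
complexification) is killed by the orthogonal of 𝔭 in 𝔭, and the vectors killed by it form a
P-invariant subspace. Hence the contraction depends only on the value f(u)
(`IsJet.killingContraction_congr`). It is an endomorphism of W commuting with P, because the Killing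
form is Ad-invariant, so Schur's lemma makes it a scalar.

The scalar is read off at a lowest weight vector of weight -ν. The Cartan terms contribute ⟨ν,ν⟩,
each positive root α contributes ⟨ν,α⟩ through [e_α,f_α] = H_α, and the negative roots contribute
nothing; the sum is ⟨ν,ν⟩ + 2⟨ν,ρ⟩. -/

lemma exists_rootVectors (H : LieSubalgebra ℂ L) [H.IsCartanSubalgebra] :
    ∃ e f : H.root → L, ∀ α : H.root,
      e α ∈ rootSpace H (α : LieModule.Weight ℂ H L) ∧
      f α ∈ rootSpace H (-(α : LieModule.Weight ℂ H L) : H → ℂ) ∧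
      killingForm ℂ L (e α) (f α) = 1 := by
  have key : ∀ α : H.root, ∃ e f : L, e ∈ rootSpace H (α : LieModule.Weight ℂ H L) ∧
      f ∈ rootSpace H (-(α : LieModule.Weight ℂ H L) : H → ℂ) ∧
      killingForm ℂ L e f = 1 := by
    intro α
    obtain ⟨e, he, he0⟩ := (α : LieModule.Weight ℂ H L).exists_ne_zero
    -- Otherwise e would be orthogonal to the only root space it can pair with, hence in the kernel
    -- of the Killing form.
    obtain ⟨f, hf, hef⟩ : ∃ f ∈ rootSpace H (-(α : LieModule.Weight ℂ H L) : H → ℂ),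
        killingForm ℂ L e f ≠ 0 := by
      contrapose! he0
      simpa using mem_ker_killingForm_of_mem_rootSpace_of_forall_rootSpace_neg ℂ L H he he0
    exact ⟨e, (killingForm ℂ L e f)⁻¹ • f, he, Submodule.smul_mem _ _ hf, by simp [hef]⟩
  choose e f h using key
  exact ⟨e, f, h⟩

/-- Root spaces are lines, so x is a multiple of f, and pairing with e reads off the coefficient. -/
lemma eq_smul_of_mem_rootSpace {α : LieModule.Weight ℂ H L} (hα : α.IsNonZero) {e f x : L}
    (hf : f ∈ rootSpace H α) (hx : x ∈ rootSpace H α)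
    (hef : killingForm ℂ L e f = 1) : x = killingForm ℂ L e x • f := by
  have hf0 : (⟨f, hf⟩ : rootSpace H α) ≠ 0 := by
    intro h
    have : f = 0 := congrArg Subtype.val h
    simp [this] at hef
  obtain ⟨c, hc⟩ := (finrank_eq_one_iff_of_nonzero' _ hf0).1
    (finrank_rootSpace_eq_one α hα) ⟨x, hx⟩
  have hc' : x = c • f := (congrArg Subtype.val hc).symm
  rw [hc', map_smul, hef, smul_eq_mul, mul_one]

/-- The Killing form stays nondegenerate on a Cartan subalgebra. Duality is expressed by the
expansion formula because that is the only form in which it is used. -/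
lemma exists_cartan_dualBasis (H : LieSubalgebra ℂ L) [H.IsCartanSubalgebra] :
    ∃ (n : ℕ) (t t' : Fin n → H),
      ∀ x : H, ∑ i, killingForm ℂ L x (t i) • t' i = x := by
  classical
  have hnd := traceForm_cartan_nondegenerate ℂ L H
  let t := Module.finBasis ℂ H
  let t' := (LieModule.traceForm ℂ H L).dualBasis hnd t
  refine ⟨_, t, t', fun x => ?_⟩
  symm
  apply t'.ext_elem
  intro j
  simp only [map_sum, map_smul, Finsupp.coe_finsetSum, Finset.sum_apply, Finsupp.smul_apply,
    Module.Basis.repr_self, smul_eq_mul]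
  rw [Finset.sum_eq_single j]
  · rw [LinearMap.BilinForm.dualBasis_repr_apply]
    simp only [Finsupp.single_eq_same, mul_one]
    rfl
  · intro i _ hij
    simp [hij]
  · simp

lemma killingForm_cartan_eq (χ : Module.Dual ℂ H) (h : H) :
    killingForm ℂ L ((cartanEquivDual H).symm χ : H) h = χ h := by
  conv_rhs => rw [← (cartanEquivDual H).apply_symm_apply χ]
  rfl

lemma weightInner_eq_apply (χ μ : Module.Dual ℂ H) :
    weightInner H χ μ = χ ((cartanEquivDual H).symm μ) := by
  rw [weightInner, killingForm_cartan_eq]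

lemma weightInner_comm (χ μ : Module.Dual ℂ H) : weightInner H χ μ = weightInner H μ χ := by
  rw [weightInner, weightInner, LieModule.traceForm_comm]

/-- Expand H_χ in the dual bases and apply μ. This evaluates the Cartan part of the Casimir sum. -/
lemma sum_dualBasis_eq_weightInner {ι : Type*} [Fintype ι] {t t' : ι → H}
    (ht : ∀ x : H, ∑ i, killingForm ℂ L x (t i) • t' i = x) (χ μ : Module.Dual ℂ H) :
    ∑ i, χ (t i) * μ (t' i) = weightInner H χ μ := by
  rw [weightInner_comm, weightInner_eq_apply]
  conv_rhs => rw [← ht ((cartanEquivDual H).symm χ)]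
  simp [map_sum, killingForm_cartan_eq]

lemma mem_rootSpace_zero {h : L} (hh : h ∈ H) : h ∈ rootSpace H (0 : H → ℂ) :=
  toLieSubmodule_le_rootSpace_zero ℂ L H hh

lemma mem_of_mem_rootSpace_zero {h : L} (hh : h ∈ rootSpace H (0 : H → ℂ)) : h ∈ H := by
  rw [← zeroRootSubalgebra_eq_of_is_cartan ℂ L H]
  exact hh

lemma killingForm_cartan_rootSpace (α : H.root) {h x : L} (hh : h ∈ H)
    (hx : x ∈ rootSpace H (α : LieModule.Weight ℂ H L)) : killingForm ℂ L h x = 0 := by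
  refine killingForm_apply_eq_zero_of_mem_rootSpace_of_add_ne_zero ℂ L H
    (mem_rootSpace_zero hh) hx ?_
  rw [zero_add]
  exact fun h => H.isNonZero_coe_root α h

lemma killingForm_rootSpace_cartan (α : H.root) {h x : L} (hh : h ∈ H)
    (hx : x ∈ rootSpace H (α : LieModule.Weight ℂ H L)) : killingForm ℂ L x h = 0 := by
  rw [LieModule.traceForm_comm]
  exact killingForm_cartan_rootSpace α hh hx

/-- The negative of a root. -/
def negRoot (α : H.root) : H.root :=
  ⟨-(α : LieModule.Weight ℂ H L), by
    have := H.isNonZero_coe_root α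
    simpa [LieSubalgebra.root] using this⟩

@[simp] lemma coe_negRoot (α : H.root) :
    ((negRoot α : H.root) : LieModule.Weight ℂ H L) = -(α : LieModule.Weight ℂ H L) := rfl

@[simp] lemma negRoot_negRoot (α : H.root) : negRoot (negRoot α) = α := by
  apply Subtype.ext
  simp

lemma negRoot_eq_reflectionPerm (α : H.root) :
    negRoot α = (rootSystem H).reflectionPerm α α := by
  apply (rootSystem H).root.injective
  rw [RootPairing.root_reflectionPerm, RootPairing.reflection_apply_self]
  rfl

lemma isPos_or_isPos_negRoot (b : (rootSystem H).Base) (α : H.root) :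
    b.IsPos α ∨ b.IsPos (negRoot α) := by
  rw [negRoot_eq_reflectionPerm]
  exact RootPairing.Base.IsPos.or_neg b α

lemma isPos_negRoot_iff (b : (rootSystem H).Base) (α : H.root) :
    b.IsPos (negRoot α) ↔ ¬ b.IsPos α := by
  rw [negRoot_eq_reflectionPerm]
  exact RootPairing.Base.IsPos.neg_iff_not b α

lemma mem_rootSpace_induction {p : L → Prop} (hH : ∀ x ∈ H, p x)
    (hα : ∀ α : H.root, ∀ x ∈ rootSpace H (α : LieModule.Weight ℂ H L), p x)
    (hadd : ∀ x y, p x → p y → p (x + y)) (x : L) : p x := by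
  have hx : x ∈ (⨆ χ : LieModule.Weight ℂ H L, rootSpace H χ) := by
    rw [LieModule.iSup_genWeightSpace_eq_top']
    trivial
  rw [← LieSubmodule.mem_toSubmodule, LieSubmodule.iSup_toSubmodule] at hx
  induction hx using Submodule.iSup_induction' with
  | mem χ x hx =>
    by_cases h : χ.IsZero
    · apply hH
      apply mem_of_mem_rootSpace_zero
      rw [← h.eq]
      exact hx
    · exact hα ⟨χ, by simpa [LieSubalgebra.root] using h⟩ x hx
  | zero => exact hH 0 H.zero_mem
  | add x y _ _ hx hy => exact hadd x y hx hy

/-- The families `(tᵢ, e_α)` and `(t'ᵢ, f_α)` are dual to each other with respect to the Killing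
form. -/
lemma sum_killingForm_rootVectors {ι : Type*} [Fintype ι] {t t' : ι → H} {e f : H.root → L}
    (ht : ∀ x : H, ∑ i, killingForm ℂ L x (t i) • t' i = x)
    (he : ∀ α : H.root, e α ∈ rootSpace H (α : LieModule.Weight ℂ H L))
    (hf : ∀ α : H.root, f α ∈ rootSpace H (-(α : LieModule.Weight ℂ H L) : H → ℂ))
    (hef : ∀ α, killingForm ℂ L (e α) (f α) = 1) (x : L) :
    ∑ i, killingForm ℂ L x (t i) • (t' i : L) + ∑ α, killingForm ℂ L x (e α) • f α = x := by
  classical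
  induction x using mem_rootSpace_induction (H := H) with
  | hH x hx =>
    have h1 := congrArg Subtype.val (ht ⟨x, hx⟩)
    simp only [AddSubmonoidClass.coe_finsetSum] at h1
    rw [Finset.sum_eq_zero (s := Finset.univ (α := H.root)), add_zero]
    · exact h1
    · intro α _
      rw [killingForm_cartan_rootSpace α hx (he α), zero_smul]
  | hα β x hx =>
    rw [Finset.sum_eq_zero (s := Finset.univ (α := ι)), zero_add]
    · rw [Finset.sum_eq_single (negRoot β)]
      · have hβ := eq_smul_of_mem_rootSpace (H.isNonZero_coe_root β) (e := e (negRoot β))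
          (f := f (negRoot β)) (by simpa using hf (negRoot β)) hx (hef _)
        rw [LieModule.traceForm_comm]
        exact hβ.symm
      · intro α _ hαβ
        rw [killingForm_apply_eq_zero_of_mem_rootSpace_of_add_ne_zero ℂ L H hx (he α), zero_smul]
        intro h
        apply hαβ
        apply Subtype.ext
        apply DFunLike.coe_injective
        rw [coe_negRoot, LieModule.Weight.coe_neg]
        exact eq_neg_of_add_eq_zero_right h
      · simp
    · intro i _
      rw [killingForm_rootSpace_cartan β (t i).2 hx, zero_smul]
  | hadd x y hx hy =>
    simp only [map_add, LinearMap.add_apply, add_smul, Finset.sum_add_distrib]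
    rw [add_add_add_comm, hx, hy]

/-- There is an element of the Cartan subalgebra on which each root takes its height as value. -/
lemma exists_apply_eq_height (b : (rootSystem H).Base) :
    ∃ h : H, ∀ α : H.root, (α : LieModule.Weight ℂ H L) h = (b.height α : ℂ) := by
  have hli := b.linearIndepOn_root
  -- Simple roots are linearly independent, so a functional with value 1 on each of them exists; by
  -- reflexivity it is evaluation at an element of the Cartan subalgebra.
  obtain ⟨F, hF⟩ : ∃ F : Module.Dual ℂ (Module.Dual ℂ H),
      ∀ i : b.support, F ((rootSystem H).root i) = 1 := by
    let B := Module.Basis.extend (LinearIndependent.linearIndepOn_id hli)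
    let F := B.constr ℂ (fun _ => (1 : ℂ))
    refine ⟨F, fun i => ?_⟩
    have : (rootSystem H).root i ∈
        (LinearIndependent.linearIndepOn_id hli).extend (Set.subset_univ _) :=
      Module.Basis.subset_extend _ ⟨i, rfl⟩
    have h2 : B ⟨_, this⟩ = (rootSystem H).root i := Module.Basis.extend_apply_self _ _
    rw [← h2, Module.Basis.constr_basis]
  obtain ⟨h, rfl⟩ := (Module.evalEquiv ℂ H).surjective F
  refine ⟨h, fun α => ?_⟩
  obtain ⟨c, -, -, hc⟩ := b.exists_root_eq_sum_int α
  rw [b.height_eq_sum hc]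
  have := congrArg (fun χ : Module.Dual ℂ H => χ h) hc
  simp only [rootSystem_root_apply, LieModule.Weight.toLinear_apply, LinearMap.sum_apply] at this
  rw [this]
  push_cast
  refine Finset.sum_congr rfl fun i hi => ?_
  have := hF ⟨i, hi⟩
  simp at this
  simp [this]

/-- A root space whose negative is not contained in an `H`-stable subspace `p` is orthogonal
to `p`. -/
lemma mem_or_orthogonal {p : Submodule ℂ L} (hp : ∀ h ∈ H, ∀ x ∈ p, ⁅h, x⁆ ∈ p)
    {α : H.root} {e f : L} (he : e ∈ rootSpace H (α : LieModule.Weight ℂ H L))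
    (hf : f ∈ rootSpace H (-(α : LieModule.Weight ℂ H L) : H → ℂ))
    (hef : killingForm ℂ L e f = 1) :
    f ∈ p ∨ ∀ x ∈ p, killingForm ℂ L e x = 0 := by
  by_contra! hcon
  obtain ⟨hfp, x, hx, hex⟩ := hcon
  -- As an `H`-module the subspace splits into weight spaces. Only its component of weight -α can
  -- pair with `e`, and that component lies in the line spanned by `f`.
  let q : LieSubmodule ℂ H L := { p with lie_mem := fun {h x} hx => hp h h.2 x hx }
  have htop := LieModule.iSup_genWeightSpace_eq_top' ℂ H q
  have hx' : (⟨x, hx⟩ : q) ∈ (⨆ χ : LieModule.Weight ℂ H q, LieModule.genWeightSpace q χ) := by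
    rw [htop]; trivial
  rw [← LieSubmodule.mem_toSubmodule, LieSubmodule.iSup_toSubmodule] at hx'
  apply hex
  have key : ∀ y : q, y ∈ (⨆ χ : LieModule.Weight ℂ H q,
      (LieModule.genWeightSpace q χ).toSubmodule) → killingForm ℂ L e y = 0 := by
    intro y hy
    induction hy using Submodule.iSup_induction' with
    | mem χ y hy =>
      have hy' : (y : L) ∈ rootSpace H (χ : H → ℂ) :=
        LieModule.map_genWeightSpace_le (f := q.incl) (Submodule.mem_map_of_mem hy)
      by_cases h : ((α : LieModule.Weight ℂ H L) : H → ℂ) + χ = 0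
      · have hχ : (χ : H → ℂ) = (negRoot α : LieModule.Weight ℂ H L) := by
          rw [coe_negRoot, LieModule.Weight.coe_neg]
          exact eq_neg_of_add_eq_zero_right h
        rw [hχ] at hy'
        have h2 := eq_smul_of_mem_rootSpace (H.isNonZero_coe_root (negRoot α)) (e := e)
          (f := f) (by simpa using hf) hy' hef
        by_contra h3
        apply hfp
        have : f = (killingForm ℂ L e y)⁻¹ • (y : L) := by
          rw [eq_inv_smul_iff₀ h3, ← h2]
        rw [this]
        exact p.smul_mem _ y.2
      · exact killingForm_apply_eq_zero_of_mem_rootSpace_of_add_ne_zero ℂ L H he hy' h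
    | zero => simp
    | add y z _ _ hy hz =>
      rw [LieSubmodule.coe_add, map_add, hy, hz, add_zero]
  exact key ⟨x, hx⟩ hx'

end Complex

/-! ### Contraction with the Killing form -/

lemma sum_eq_sum_of_dual {K L V : Type*} [Field K] [AddCommGroup L] [Module K L]
    [AddCommGroup V] [Module K V] {B : LinearMap.BilinForm K L} (hB : ∀ x y, B x y = B y x)
    {ι κ : Type*} [Fintype ι] [Fintype κ] {x y : ι → L} {x' y' : κ → L}
    (h : ∀ z, ∑ i, B z (y i) • x i = z) (h' : ∀ z, ∑ k, B z (x' k) • y' k = z)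
    (β : L →ₗ[K] L →ₗ[K] V) : ∑ i, β (x i) (y i) = ∑ k, β (x' k) (y' k) := by
  -- Expand y_i in the second pair of families, interchange the sums, and recognise the expansion of
  -- x'_k in the first pair.
  calc ∑ i, β (x i) (y i) = ∑ i, ∑ k, B (y i) (x' k) • β (x i) (y' k) := by
        refine Finset.sum_congr rfl fun i _ => ?_
        conv_lhs => rw [← h' (y i)]
        simp
    _ = ∑ k, ∑ i, B (y i) (x' k) • β (x i) (y' k) := Finset.sum_comm
    _ = ∑ k, β (x' k) (y' k) := by
        refine Finset.sum_congr rfl fun k _ => ?_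
        conv_rhs => rw [← h (x' k)]
        simp [hB (x' k)]

section Contraction

variable {𝔤 : Type*} [LieRing 𝔤] [LieAlgebra ℝ 𝔤] [FiniteDimensional ℝ 𝔤] [IsKilling ℝ 𝔤]

/-- The basis dual, with respect to the Killing form, to the standard basis of `𝔤`. -/
abbrev killingDualBasis (𝔤 : Type*) [LieRing 𝔤] [LieAlgebra ℝ 𝔤] [FiniteDimensional ℝ 𝔤]
    [IsKilling ℝ 𝔤] : Module.Basis (Fin (Module.finrank ℝ 𝔤)) ℝ 𝔤 :=
  (killingForm ℝ 𝔤).dualBasis (IsKilling.killingForm_nondegenerate ℝ 𝔤) (Module.finBasis ℝ 𝔤)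

/-- The contraction of a bilinear map on `𝔤` with the (inverse of the) Killing form. -/
def killingContraction {V : Type*} [AddCommGroup V] [Module ℝ V] (β : 𝔤 →ₗ[ℝ] 𝔤 →ₗ[ℝ] V) : V :=
  ∑ l, β (Module.finBasis ℝ 𝔤 l) (killingDualBasis 𝔤 l)

lemma sum_killingForm_smul_finBasis (z : 𝔤) :
    ∑ l, killingForm ℝ 𝔤 z (killingDualBasis 𝔤 l) • Module.finBasis ℝ 𝔤 l = z := by
  classical
  symm
  apply (Module.finBasis ℝ 𝔤).ext_elem
  intro j
  simp only [map_sum, map_smul, Finsupp.coe_finsetSum, Finset.sum_apply, Finsupp.smul_apply,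
    Module.Basis.repr_self, smul_eq_mul]
  rw [Finset.sum_eq_single j]
  · simp only [Finsupp.single_eq_same, mul_one]
    conv_rhs => rw [← (Module.finBasis ℝ 𝔤).sum_repr z]
    rw [LieModule.traceForm_comm]
    simp only [map_sum, map_smul, killingDualBasis]
    rw [Finset.sum_eq_single j]
    · erw [LinearMap.BilinForm.apply_dualBasis_left]
      simp
    · intro i _ hij
      erw [LinearMap.BilinForm.apply_dualBasis_left]
      simp [hij]
    · simp
  · intro i _ hij
    simp [hij]
  · simp

lemma sum_killingForm_smul_killingDualBasis (z : 𝔤) :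
    ∑ l, killingForm ℝ 𝔤 z (Module.finBasis ℝ 𝔤 l) • killingDualBasis 𝔤 l = z := by
  classical
  symm
  apply (killingDualBasis 𝔤).ext_elem
  intro j
  simp only [map_sum, map_smul, Finsupp.coe_finsetSum, Finset.sum_apply, Finsupp.smul_apply,
    Module.Basis.repr_self, smul_eq_mul]
  rw [Finset.sum_eq_single j]
  · simp only [Finsupp.single_eq_same, mul_one]
    rw [LinearMap.BilinForm.dualBasis_repr_apply]
  · intro i _ hij
    simp [hij]
  · simp

lemma killingContraction_map {V W : Type*} [AddCommGroup V] [Module ℝ V] [AddCommGroup W]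
    [Module ℝ W] (T : V →ₗ[ℝ] W) (β : 𝔤 →ₗ[ℝ] 𝔤 →ₗ[ℝ] V) :
    killingContraction (β.compr₂ T) = T (killingContraction β) := by
  simp [killingContraction, map_sum]

/-- The contraction with the Killing form is invariant under its isometries. -/
lemma killingContraction_compl₁₂ {V : Type*} [AddCommGroup V] [Module ℝ V]
    (β : 𝔤 →ₗ[ℝ] 𝔤 →ₗ[ℝ] V) (g : 𝔤 ≃ₗ[ℝ] 𝔤)
    (hg : ∀ x y, killingForm ℝ 𝔤 (g x) (g y) = killingForm ℝ 𝔤 x y) :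
    killingContraction (β.compl₁₂ g.toLinearMap g.toLinearMap) = killingContraction β := by
  refine sum_eq_sum_of_dual (x := fun l => g (Module.finBasis ℝ 𝔤 l))
    (y := fun l => g (killingDualBasis 𝔤 l)) (LieModule.traceForm_comm ℝ 𝔤 𝔤) (fun z => ?_)
    sum_killingForm_smul_killingDualBasis β
  obtain ⟨z, rfl⟩ := g.surjective z
  conv_rhs => rw [← sum_killingForm_smul_finBasis z]
  simp only [map_sum, map_smul]
  exact Finset.sum_congr rfl fun l _ => by rw [hg]

section ComplexValued

variable {V : Type*} [AddCommGroup V] [Module ℂ V] [Module ℝ V] [IsScalarTower ℝ ℂ V]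

/-- The complex bilinear extension of a real bilinear map with values in a complex space. -/
def complexifyBilin {X Y : Type*} [AddCommGroup X] [Module ℝ X] [AddCommGroup Y] [Module ℝ Y]
    (β : X →ₗ[ℝ] Y →ₗ[ℝ] V) : ℂ ⊗[ℝ] X →ₗ[ℂ] ℂ ⊗[ℝ] Y →ₗ[ℂ] V :=
  LinearMap.liftBaseChange ℂ
    (((LinearMap.liftBaseChangeEquiv (R := ℝ) (M := Y) (N := V) ℂ).toLinearMap.restrictScalars
      ℝ).comp β)

@[simp] lemma complexifyBilin_tmul {X Y : Type*} [AddCommGroup X] [Module ℝ X] [AddCommGroup Y]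
    [Module ℝ Y] (β : X →ₗ[ℝ] Y →ₗ[ℝ] V) (c d : ℂ) (x : X) (y : Y) :
    complexifyBilin β (c ⊗ₜ x) (d ⊗ₜ y) = c • d • β x y := by
  simp [complexifyBilin]

lemma killingForm_complexification (x y : ℂ ⊗[ℝ] 𝔤) :
    killingForm ℂ (ℂ ⊗[ℝ] 𝔤) x y = (killingForm ℝ 𝔤).baseChange ℂ x y := by
  rw [show killingForm ℂ (ℂ ⊗[ℝ] 𝔤) = (killingForm ℝ 𝔤).baseChange ℂ from
    LieModule.traceForm_baseChange ℝ 𝔤 𝔤 ℂ]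

/-- Real dual bases remain dual after complexification, and the contraction is independent of the
dual pair. This allows root vectors to be used although 𝔤 itself is only real. -/
lemma killingContraction_eq_sum (β : 𝔤 →ₗ[ℝ] 𝔤 →ₗ[ℝ] V) {κ : Type*} [Fintype κ]
    {x y : κ → ℂ ⊗[ℝ] 𝔤}
    (h : ∀ z, ∑ k, killingForm ℂ (ℂ ⊗[ℝ] 𝔤) z (x k) • y k = z) :
    killingContraction β = ∑ k, complexifyBilin β (x k) (y k) := by
  rw [← sum_eq_sum_of_dual (x := fun l => (1 : ℂ) ⊗ₜ[ℝ] Module.finBasis ℝ 𝔤 l)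
    (y := fun l => (1 : ℂ) ⊗ₜ[ℝ] killingDualBasis 𝔤 l)
    (LieModule.traceForm_comm ℂ (ℂ ⊗[ℝ] 𝔤) (ℂ ⊗[ℝ] 𝔤)) (fun z => ?_) h]
  · simp [killingContraction]
  · induction z using TensorProduct.induction_on with
    | zero => simp
    | add z w hz hw =>
      simp only [map_add, LinearMap.add_apply, add_smul, Finset.sum_add_distrib]
      rw [hz, hw]
    | tmul c x =>
      conv_rhs => rw [← sum_killingForm_smul_finBasis x]
      rw [TensorProduct.tmul_sum]
      refine Finset.sum_congr rfl fun l _ => ?_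
      erw [killingForm_complexification]
      simp [TensorProduct.smul_tmul']

end ComplexValued

end Contraction

/-- The subspace `p` is stable under the adjoint action of the subalgebra `H`. -/
def IsAdStable {L : Type*} [LieRing L] [LieAlgebra ℂ L] (H : LieSubalgebra ℂ L)
    (p : Submodule ℂ L) : Prop :=
  ∀ h ∈ H, ∀ x ∈ p, ⁅h, x⁆ ∈ p

/-! ### Real and imaginary parts in a complexification -/

section RealPart

variable {W : Type*} [AddCommGroup W] [Module ℝ W]

/-- The real part of an element of `ℂ ⊗ W`. -/
def realPart (W : Type*) [AddCommGroup W] [Module ℝ W] : ℂ ⊗[ℝ] W →ₗ[ℝ] W :=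
  (TensorProduct.lid ℝ W).toLinearMap ∘ₗ Complex.reLm.rTensor W

@[simp] lemma realPart_tmul (c : ℂ) (w : W) : realPart W (c ⊗ₜ w) = c.re • w := by
  simp [realPart]

lemma one_tmul_injective : Function.Injective (fun w : W => (1 : ℂ) ⊗ₜ[ℝ] w) := by
  intro x y h
  simpa using congrArg (realPart W) h

lemma exists_eq_one_tmul_add_I_tmul (z : ℂ ⊗[ℝ] W) :
    ∃ x y : W, z = 1 ⊗ₜ x + Complex.I ⊗ₜ y := by
  induction z using TensorProduct.induction_on with
  | zero => exact ⟨0, 0, by simp⟩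
  | tmul c w =>
    refine ⟨c.re • w, c.im • w, ?_⟩
    rw [← TensorProduct.smul_tmul, ← TensorProduct.smul_tmul, ← TensorProduct.add_tmul]
    congr 1
    simpa [mul_comm] using (Complex.re_add_im c).symm
  | add z z' hz hz' =>
    obtain ⟨x, y, rfl⟩ := hz
    obtain ⟨x', y', rfl⟩ := hz'
    refine ⟨x + x', y + y', ?_⟩
    simp only [TensorProduct.tmul_add]
    abel

lemma one_tmul_add_I_tmul_eq_zero {x y : W}
    (h : (1 : ℂ) ⊗ₜ[ℝ] x + Complex.I ⊗ₜ[ℝ] y = 0) : x = 0 ∧ y = 0 := by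
  have h1 : x = 0 := by simpa using congrArg (realPart W) h
  refine ⟨h1, ?_⟩
  simpa [h1, TensorProduct.smul_tmul'] using congrArg (fun z => realPart W (Complex.I • z)) h

end RealPart

/-! ### Jets of equivariant functions and their complexification -/

/-- The data `(w, φ, β)` have the algebraic properties of the values at a point of an equivariant
function `f`, of `Df` and of `D²f`: derivatives in directions of `𝔭` (the image of `j`) are given by
minus the action `a`. -/
structure IsJet {𝔤 : Type*} [LieRing 𝔤] [LieAlgebra ℝ 𝔤] {𝔮 : Type*} [AddCommGroup 𝔮] [Module ℝ 𝔮]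
    {V : Type*} [AddCommGroup V] [Module ℝ V] (j : 𝔮 →ₗ[ℝ] 𝔤) (a : 𝔮 → V → V) (w : V)
    (φ : 𝔤 →ₗ[ℝ] V) (β : 𝔤 →ₗ[ℝ] 𝔤 →ₗ[ℝ] V) : Prop where
  apply_incl : ∀ A, φ (j A) = -a A w
  incl_left : ∀ A Y, β (j A) Y = -a A (φ Y) + φ ⁅j A, Y⁆
  incl_right : ∀ Y A, β Y (j A) = -a A (φ Y)

section

variable {𝔤 : Type*} [LieRing 𝔤] [LieAlgebra ℝ 𝔤] {𝔮 : Type*} [AddCommGroup 𝔮] [Module ℝ 𝔮]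
    {V : Type*} [AddCommGroup V] [Module ℂ V] [Module ℝ V] [IsScalarTower ℝ ℂ V]
    [SMulCommClass ℂ ℝ V] {j : 𝔮 →ₗ[ℝ] 𝔤} {a : 𝔮 →ₗ[ℝ] Module.End ℂ V} {w : V}
    {φ : 𝔤 →ₗ[ℝ] V} {β : 𝔤 →ₗ[ℝ] 𝔤 →ₗ[ℝ] V}

namespace IsJet

lemma apply_incl_complexified (h : IsJet j (fun A v => a A v) w φ β) (z : ℂ ⊗[ℝ] 𝔮) :
    φ.liftBaseChange ℂ (j.baseChange ℂ z) = -a.liftBaseChange ℂ z w := by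
  induction z using TensorProduct.induction_on with
  | zero => simp
  | add z z' hz hz' => simp only [map_add, hz, hz', LinearMap.add_apply, neg_add]
  | tmul c A => simp [h.apply_incl]

lemma incl_left_complexified (h : IsJet j (fun A v => a A v) w φ β) (z : ℂ ⊗[ℝ] 𝔮)
    (Y : ℂ ⊗[ℝ] 𝔤) :
    complexifyBilin β (j.baseChange ℂ z) Y =
      -a.liftBaseChange ℂ z (φ.liftBaseChange ℂ Y) +
        φ.liftBaseChange ℂ ⁅j.baseChange ℂ z, Y⁆ := by
  induction z using TensorProduct.induction_on with
  | zero => simp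
  | add z z' hz hz' =>
    simp only [map_add, hz, hz', LinearMap.add_apply, add_lie]
    abel
  | tmul c A =>
    induction Y using TensorProduct.induction_on with
    | zero => simp
    | add z z' hz hz' =>
      simp only [map_add, hz, hz', lie_add]
      abel
    | tmul d Y =>
      simp [h.incl_left, LieAlgebra.ExtendScalars.bracket_tmul, smul_smul, mul_comm]

lemma incl_right_complexified (h : IsJet j (fun A v => a A v) w φ β) (z : ℂ ⊗[ℝ] 𝔮)
    (Y : ℂ ⊗[ℝ] 𝔤) :
    complexifyBilin β Y (j.baseChange ℂ z) =
      -a.liftBaseChange ℂ z (φ.liftBaseChange ℂ Y) := by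
  induction z using TensorProduct.induction_on with
  | zero => simp
  | add z z' hz hz' =>
    simp only [map_add, hz, hz', LinearMap.add_apply]
    abel
  | tmul c A =>
    induction Y using TensorProduct.induction_on with
    | zero => simp
    | add z z' hz hz' =>
      simp only [map_add, hz, hz', LinearMap.add_apply]
      abel
    | tmul d Y =>
      simp [h.incl_right, smul_smul, mul_comm]

end IsJet

/-! ### Contraction of jets in a basis of root vectors -/

section Contraction

variable [FiniteDimensional ℝ 𝔤] [IsKilling ℝ 𝔤] {H : LieSubalgebra ℂ (ℂ ⊗[ℝ] 𝔤)}
  [H.IsCartanSubalgebra] {b : (rootSystem H).Base}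

lemma killingContraction_eq_sum_roots {ι : Type*} [Fintype ι] {t t' : ι → H}
    {e f : H.root → ℂ ⊗[ℝ] 𝔤}
    (ht : ∀ x : H, ∑ i, killingForm ℂ (ℂ ⊗[ℝ] 𝔤) x (t i) • t' i = x)
    (he : ∀ α : H.root, e α ∈ rootSpace H (α : LieModule.Weight ℂ H (ℂ ⊗[ℝ] 𝔤)))
    (hf : ∀ α : H.root, f α ∈ rootSpace H (-(α : LieModule.Weight ℂ H (ℂ ⊗[ℝ] 𝔤)) : H → ℂ))
    (hef : ∀ α, killingForm ℂ (ℂ ⊗[ℝ] 𝔤) (e α) (f α) = 1) (β : 𝔤 →ₗ[ℝ] 𝔤 →ₗ[ℝ] V) :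
    killingContraction β = ∑ i, complexifyBilin β (t i) (t' i) +
      ∑ α, complexifyBilin β (e α) (f α) := by
  rw [killingContraction_eq_sum (κ := ι ⊕ H.root) (x := Sum.elim (fun i => (t i : ℂ ⊗[ℝ] 𝔤)) e)
    (y := Sum.elim (fun i => (t' i : ℂ ⊗[ℝ] 𝔤)) f) β]
  · simp
  · intro z
    simpa using sum_killingForm_rootVectors ht he hf hef z

namespace IsJet

variable (h : IsJet j (fun A v => a A v) w φ β)
include h

/-- Both slots are algebraic, and the bracket term disappears because the Cartan subalgebra is
abelian. -/
lemma cartan_term {z z' : ℂ ⊗[ℝ] 𝔮} (hz : j.baseChange ℂ z ∈ H) (hz' : j.baseChange ℂ z' ∈ H) :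
    complexifyBilin β (j.baseChange ℂ z) (j.baseChange ℂ z') =
      a.liftBaseChange ℂ z (a.liftBaseChange ℂ z' w) := by
  have hcomm : ⁅j.baseChange ℂ z, j.baseChange ℂ z'⁆ = 0 :=
    congrArg Subtype.val (trivial_lie_zero H H ⟨_, hz⟩ ⟨_, hz'⟩)
  rw [h.incl_left_complexified, hcomm, map_zero, add_zero, h.apply_incl_complexified, map_neg,
    neg_neg]

/-- The bracket of dual root vectors is [e,f] = B(e,f)H_α = H_α, which lies in 𝔭_ℂ and therefore
differentiates algebraically. Only the derivative along f is left undetermined. -/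
lemma pos_term {α : H.root} {z zH : ℂ ⊗[ℝ] 𝔮} {f : ℂ ⊗[ℝ] 𝔤}
    (he : j.baseChange ℂ z ∈ rootSpace H (α : LieModule.Weight ℂ H (ℂ ⊗[ℝ] 𝔤)))
    (hf : f ∈ rootSpace H (-(α : LieModule.Weight ℂ H (ℂ ⊗[ℝ] 𝔤)) : H → ℂ))
    (hef : killingForm ℂ (ℂ ⊗[ℝ] 𝔤) (j.baseChange ℂ z) f = 1)
    (hzH : j.baseChange ℂ zH =
      (cartanEquivDual H).symm (α : LieModule.Weight ℂ H (ℂ ⊗[ℝ] 𝔤)).toLinear) :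
    complexifyBilin β (j.baseChange ℂ z) f =
      -a.liftBaseChange ℂ z (φ.liftBaseChange ℂ f) - a.liftBaseChange ℂ zH w := by
  rw [h.incl_left_complexified, lie_eq_killingForm_smul_of_mem_rootSpace_of_mem_rootSpace_neg he hf,
    hef, one_smul]
  rw [sub_eq_add_neg, ← h.apply_incl_complexified, hzH]

end IsJet

/-- Elements of `𝔭_ℂ` orthogonal to `𝔭_ℂ` act trivially. -/
def ActsTriviallyOnPerp (j : 𝔮 →ₗ[ℝ] 𝔤) (a : 𝔮 →ₗ[ℝ] Module.End ℂ V) : Prop :=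
  ∀ z : ℂ ⊗[ℝ] 𝔮, (∀ x ∈ LinearMap.range (j.baseChange ℂ),
    killingForm ℂ (ℂ ⊗[ℝ] 𝔤) (j.baseChange ℂ z) x = 0) → a.liftBaseChange ℂ z = 0

lemma isAdStable_range (hb : IsStandardParabolic b (LinearMap.range (j.baseChange ℂ)))
    (hj : ∀ A B, ⁅j A, j B⁆ ∈ LinearMap.range j) :
    IsAdStable H (LinearMap.range (j.baseChange ℂ)) := by
  intro h hh x hx
  obtain ⟨z, rfl⟩ := hb.1 hh
  obtain ⟨z', rfl⟩ := hx
  clear hh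
  induction z using TensorProduct.induction_on with
  | zero => simp
  | add z z' hz hz' =>
    simp only [map_add, add_lie]
    exact Submodule.add_mem _ hz hz'
  | tmul c A =>
    induction z' using TensorProduct.induction_on with
    | zero => simp
    | add z z' hz hz' =>
      simp only [map_add, lie_add]
      exact Submodule.add_mem _ hz hz'
    | tmul d B =>
      obtain ⟨C, hC⟩ := hj A B
      refine ⟨(c * d) ⊗ₜ C, ?_⟩
      simp [LieAlgebra.ExtendScalars.bracket_tmul, hC]

/-- The contraction of the second order part of a jet depends only on the value of the jet. -/
theorem IsJet.killingContraction_congr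
    (hb : IsStandardParabolic b (LinearMap.range (j.baseChange ℂ)))
    (hj : ∀ A B, ⁅j A, j B⁆ ∈ LinearMap.range j) (ha : ActsTriviallyOnPerp j a)
    (h : IsJet j (fun A v => a A v) w φ β) {φ' : 𝔤 →ₗ[ℝ] V} {β' : 𝔤 →ₗ[ℝ] 𝔤 →ₗ[ℝ] V}
    (h' : IsJet j (fun A v => a A v) w φ' β') :
    killingContraction β = killingContraction β' := by
  classical
  obtain ⟨n, t, t', ht⟩ := exists_cartan_dualBasis H
  obtain ⟨e, f, hef⟩ := exists_rootVectors H
  have hst := isAdStable_range hb hj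
  rw [killingContraction_eq_sum_roots ht (fun α => (hef α).1) (fun α => (hef α).2.1)
    (fun α => (hef α).2.2), killingContraction_eq_sum_roots ht (fun α => (hef α).1)
    (fun α => (hef α).2.1) (fun α => (hef α).2.2)]
  congr 1
  · refine Finset.sum_congr rfl fun i _ => ?_
    obtain ⟨z, hz⟩ := hb.1 (t i).2
    obtain ⟨z', hz'⟩ := hb.1 (t' i).2
    rw [← hz, ← hz', h.cartan_term (H := H) (hz ▸ (t i).2) (hz' ▸ (t' i).2),
      h'.cartan_term (H := H) (hz ▸ (t i).2) (hz' ▸ (t' i).2)]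
  · refine Finset.sum_congr rfl fun α _ => ?_
    obtain ⟨he, hf, hef⟩ := hef α
    rcases isPos_or_isPos_negRoot b α with hα | hα
    · obtain ⟨z, hz⟩ := hb.2 α hα he
      obtain ⟨zH, hzH⟩ := hb.1
        ((cartanEquivDual H).symm (α : LieModule.Weight ℂ H (ℂ ⊗[ℝ] 𝔤)).toLinear).2
      rw [← hz] at he hef ⊢
      rw [h.pos_term he hf hef hzH, h'.pos_term he hf hef hzH]
      -- The remaining derivative along `f α` is either algebraic or multiplied by the action of an
      -- element orthogonal to 𝔭_ℂ, which is zero.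
      rcases mem_or_orthogonal hst he hf hef with ⟨y, hy⟩ | hperp
      · rw [← hy, h.apply_incl_complexified, h'.apply_incl_complexified]
      · simp [ha z hperp]
    · obtain ⟨z, hz⟩ := hb.2 (negRoot α) hα hf
      rw [← hz] at hf hef ⊢
      rw [h.incl_right_complexified, h'.incl_right_complexified]
      rw [LieModule.traceForm_comm] at hef
      rcases mem_or_orthogonal (α := negRoot α) hst hf (by simpa using he) hef with
        ⟨y, hy⟩ | hperp
      · rw [← hy, h.apply_incl_complexified, h'.apply_incl_complexified]
      · simp [ha z hperp]

/-- At a lowest weight vector the contraction of the second order part of a jet is given by the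
usual formula for the action of a Casimir element. -/
theorem IsLowestWeight.exists_killingContraction_eq
    (hb : IsStandardParabolic b (LinearMap.range (j.baseChange ℂ)))
    (hj : ∀ A B, ⁅j A, j B⁆ ∈ LinearMap.range j) (ha : ActsTriviallyOnPerp j a)
    {ν : Module.Dual ℂ H} (hν : IsLowestWeight j a b (-ν)) :
    ∃ v : V, v ≠ 0 ∧ ∀ φ β, IsJet j (fun A v => a A v) v φ β →
      killingContraction β =
        (weightInner H ν ν + 2 * weightInner H ν (halfSumPosRoots b)) • v := by
  classical
  obtain ⟨v, hv0, hvH, hvneg⟩ := hν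
  refine ⟨v, hv0, fun φ β h => ?_⟩
  obtain ⟨n, t, t', ht⟩ := exists_cartan_dualBasis H
  obtain ⟨e, f, hef⟩ := exists_rootVectors H
  have hst := isAdStable_range hb hj
  rw [killingContraction_eq_sum_roots ht (fun α => (hef α).1) (fun α => (hef α).2.1)
    (fun α => (hef α).2.2), add_smul]
  congr 1
  · rw [← sum_dualBasis_eq_weightInner ht, Finset.sum_smul]
    refine Finset.sum_congr rfl fun i _ => ?_
    obtain ⟨z, hz⟩ := hb.1 (t i).2
    obtain ⟨z', hz'⟩ := hb.1 (t' i).2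
    have hzm : j.baseChange ℂ z ∈ H := hz ▸ (t i).2
    have hzm' : j.baseChange ℂ z' ∈ H := hz' ▸ (t' i).2
    have h1 : t i = ⟨_, hzm⟩ := Subtype.ext hz.symm
    have h2 : t' i = ⟨_, hzm'⟩ := Subtype.ext hz'.symm
    rw [h1, h2, h.cartan_term hzm hzm', hvH z' hzm', map_smul, hvH z hzm]
    simp [smul_smul, mul_comm]
  -- The factor 2 cancels the one half in ρ. Writing the result as a sum over all roots, with zero
  -- at the negative ones, permits a comparison term by term.
  · have hρ : 2 * weightInner H ν (halfSumPosRoots b) =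
        ∑ α : H.root, if b.IsPos α then
          weightInner H ν (α : LieModule.Weight ℂ H (ℂ ⊗[ℝ] 𝔤)).toLinear else 0 := by
      simp only [weightInner_eq_apply, halfSumPosRoots, map_smul, map_sum, smul_eq_mul,
        Finset.sum_filter]
      rw [← mul_assoc]
      norm_num
      refine Finset.sum_congr rfl fun α _ => ?_
      split_ifs
      · rfl
      · simp
    rw [hρ, Finset.sum_smul]
    refine Finset.sum_congr rfl fun α _ => ?_
    obtain ⟨he, hf, hef⟩ := hef α
    rcases isPos_or_isPos_negRoot b α with hα | hα
    · rw [if_pos hα]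
      obtain ⟨z, hz⟩ := hb.2 α hα he
      obtain ⟨zH, hzH⟩ := hb.1
        ((cartanEquivDual H).symm (α : LieModule.Weight ℂ H (ℂ ⊗[ℝ] 𝔤)).toLinear).2
      rw [← hz] at he hef ⊢
      have hzm : j.baseChange ℂ zH ∈ H := hzH ▸
        ((cartanEquivDual H).symm (α : LieModule.Weight ℂ H (ℂ ⊗[ℝ] 𝔤)).toLinear).2
      have h1 : (cartanEquivDual H).symm (α : LieModule.Weight ℂ H (ℂ ⊗[ℝ] 𝔤)).toLinear =
        ⟨_, hzm⟩ := Subtype.ext hzH.symm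
      rw [h.pos_term he hf hef hzH, hvH zH hzm, weightInner_eq_apply, h1]
      -- If `f α` lies in 𝔭_ℂ, its derivative is minus its action on the lowest weight vector, which
      -- is zero since `f α` is a negative root vector.
      have : a.liftBaseChange ℂ z (φ.liftBaseChange ℂ (f α)) = 0 := by
        rcases mem_or_orthogonal hst he hf hef with ⟨y, hy⟩ | hperp
        · rw [← hy, h.apply_incl_complexified, hvneg α hα y (by rwa [hy])]
          simp
        · simp [ha z hperp]
      rw [this]
      simp
    -- For negative α the roles are exchanged: `f α` is in 𝔭_ℂ and stands in the second slot, so no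
    -- bracket term arises, and `e α` is the negative root vector.
    · rw [if_neg ((isPos_negRoot_iff b α).1 hα), zero_smul]
      obtain ⟨z, hz⟩ := hb.2 (negRoot α) hα hf
      rw [← hz] at hf hef ⊢
      rw [h.incl_right_complexified]
      rw [LieModule.traceForm_comm] at hef
      rcases mem_or_orthogonal (α := negRoot α) hst hf (by simpa using he) hef with
        ⟨y, hy⟩ | hperp
      · rw [← hy, h.apply_incl_complexified, hvneg (negRoot α) hα y (by rw [hy]; simpa using he)]
        simp
      · simp [ha z hperp]

lemma weightInner_add_sub (ν ρ : Module.Dual ℂ H) :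
    weightInner H (ν + ρ) (ν + ρ) - weightInner H ρ ρ =
      weightInner H ν ν + 2 * weightInner H ν ρ := by
  have h := weightInner_comm ρ ν
  simp only [weightInner_eq_apply, map_add, LinearMap.add_apply] at h ⊢
  rw [h]
  ring

/-- A bilinear form on `𝔤` of the form `φ ⊗ ψ` with `φ` and `ψ` vanishing on a parabolic subalgebra
has vanishing contraction with the Killing form. -/
lemma killingContraction_eq_zero_of_vanish
    (hb : IsStandardParabolic b (LinearMap.range (j.baseChange ℂ)))
    {W : Type*} [AddCommGroup W] [Module ℝ W]
    (β : 𝔤 →ₗ[ℝ] 𝔤 →ₗ[ℝ] W) (hl : ∀ A Y, β (j A) Y = 0) (hr : ∀ Y A, β Y (j A) = 0) :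
    killingContraction β = 0 := by
  classical
  have hinj : Function.Injective (TensorProduct.mk ℝ ℂ W 1) :=
    one_tmul_injective
  -- The root vectors exist only over ℂ, so the identity is checked after embedding W in its
  -- complexification.
  apply hinj
  rw [map_zero, ← killingContraction_map]
  have hl' : ∀ z Y, complexifyBilin (β.compr₂ (TensorProduct.mk ℝ ℂ W 1))
      (j.baseChange ℂ z) Y = 0 := by
    intro z Y
    induction z using TensorProduct.induction_on with
    | zero => simp
    | add z z' hz hz' => simp only [map_add, hz, hz', LinearMap.add_apply, add_zero]
    | tmul c A =>
      induction Y using TensorProduct.induction_on with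
      | zero => simp
      | add z z' hz hz' => simp only [map_add, hz, hz', add_zero]
      | tmul d Y => simp [hl]
  have hr' : ∀ z Y, complexifyBilin (β.compr₂ (TensorProduct.mk ℝ ℂ W 1)) Y
      (j.baseChange ℂ z) = 0 := by
    intro z Y
    induction z using TensorProduct.induction_on with
    | zero => simp
    | add z z' hz hz' => simp only [map_add, hz, hz', add_zero]
    | tmul c A =>
      induction Y using TensorProduct.induction_on with
      | zero => simp
      | add z z' hz hz' => simp only [map_add, hz, hz', LinearMap.add_apply, add_zero]
      | tmul d Y => simp [hr]
  obtain ⟨n, t, t', ht⟩ := exists_cartan_dualBasis H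
  obtain ⟨e, f, hef⟩ := exists_rootVectors H
  rw [killingContraction_eq_sum_roots ht (fun α => (hef α).1) (fun α => (hef α).2.1)
    (fun α => (hef α).2.2), Finset.sum_eq_zero, Finset.sum_eq_zero, add_zero]
  · intro α _
    rcases isPos_or_isPos_negRoot b α with hα | hα
    · obtain ⟨z, hz⟩ := hb.2 α hα (hef α).1
      rw [← hz, hl']
    · obtain ⟨z, hz⟩ := hb.2 (negRoot α) hα (hef α).2.1
      rw [← hz, hr']
  · intro i _
    obtain ⟨z, hz⟩ := hb.1 (t i).2
    rw [← hz, hl']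

end Contraction

end

/-! ### Schur's lemma over ℂ and ℝ -/

section Irreducible

variable {𝕜 P W : Type*} [Field 𝕜] [Group P] [AddCommGroup W] [Module 𝕜 W]
  {ρ : Representation 𝕜 P W}

lemma eq_top_of_isIrreducible (hρ : ρ.IsIrreducible) (U : Submodule 𝕜 W)
    (hU : ∀ h, ∀ v ∈ U, ρ h v ∈ U) {v : W} (hv : v ∈ U) (hv0 : v ≠ 0) : U = ⊤ := by
  let S : Subrepresentation ρ := ⟨U, fun h _ hv => hU h _ hv⟩
  have : IsSimpleOrder (Subrepresentation ρ) := hρ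
  rcases IsSimpleOrder.eq_bot_or_eq_top S with h | h
  · exfalso
    have h2 : v ∈ (⊥ : Subrepresentation ρ).toSubmodule := h ▸ (show v ∈ S.toSubmodule from hv)
    exact hv0 ((Submodule.mem_bot 𝕜).1 h2)
  · exact congrArg Subrepresentation.toSubmodule h

lemma nontrivial_of_isIrreducible (hρ : ρ.IsIrreducible) : Nontrivial W := by
  have : IsSimpleOrder (Subrepresentation ρ) := hρ
  obtain ⟨S, T, hST⟩ := exists_pair_ne (Subrepresentation ρ)
  by_contra h
  rw [not_nontrivial_iff_subsingleton] at h
  exact hST (Subrepresentation.toSubmodule_injective (Subsingleton.elim _ _))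

end Irreducible

lemma exists_eq_smul_one_of_isIrreducible {P W : Type*} [Group P] [AddCommGroup W] [Module ℂ W]
    [FiniteDimensional ℂ W] {ρ : Representation ℂ P W} (hρ : ρ.IsIrreducible)
    (Z : Module.End ℂ W) (hZ : ∀ h w, Z (ρ h w) = ρ h (Z w)) : ∃ c : ℂ, ∀ w, Z w = c • w := by
  have := nontrivial_of_isIrreducible hρ
  obtain ⟨c, hc⟩ := Module.End.exists_eigenvalue Z
  obtain ⟨v, hv⟩ := hc.exists_hasEigenvector
  refine ⟨c, fun w => ?_⟩
  have htop := eq_top_of_isIrreducible hρ (Z.eigenspace c) (fun h v hv => by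
    rw [Module.End.mem_eigenspace_iff] at hv ⊢
    rw [hZ, hv, map_smul]) hv.1 hv.2
  exact Module.End.mem_eigenspace_iff.1 (htop ▸ Submodule.mem_top)

/-- An eigenvalue of the complexified endomorphism is either real, giving a nonzero invariant
eigenspace and hence all of W, or it has nonzero imaginary part and produces the excluded invariant
complex structure. -/
lemma exists_eq_smul_one_of_isIrreducible_real {P W : Type*} [Group P] [AddCommGroup W]
    [Module ℝ W] [FiniteDimensional ℝ W] {ρ : Representation ℝ P W} (hρ : ρ.IsIrreducible)
    (hJ : ¬ ∃ J : W →ₗ[ℝ] W, (∀ w, J (J w) = -w) ∧ ∀ h w, J (ρ h w) = ρ h (J w))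
    (Z : Module.End ℝ W) (hZ : ∀ h w, Z (ρ h w) = ρ h (Z w)) : ∃ c : ℝ, ∀ w, Z w = c • w := by
  have := nontrivial_of_isIrreducible hρ
  have hnt : Nontrivial (ℂ ⊗[ℝ] W) := one_tmul_injective.nontrivial
  obtain ⟨c, hc⟩ := Module.End.exists_eigenvalue (Z.baseChange ℂ)
  obtain ⟨v, hv⟩ := hc.exists_hasEigenvector
  obtain ⟨x, y, rfl⟩ := exists_eq_one_tmul_add_I_tmul v
  have hev := hv.apply_eq_smul
  have h0 := hv.2
  obtain ⟨hx, hy⟩ : Z x = c.re • x - c.im • y ∧ Z y = c.re • y + c.im • x := by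
    have h1 := congrArg (realPart W) hev
    have h2 := congrArg (fun z => realPart W (Complex.I • z)) hev
    simp [TensorProduct.smul_tmul'] at h1 h2
    refine ⟨by rw [h1, sub_eq_add_neg], ?_⟩
    rw [← neg_inj, h2]
    abel
  by_cases hc0 : c.im = 0
  · refine ⟨c.re, fun w => ?_⟩
    simp only [hc0, zero_smul, sub_zero, add_zero] at hx hy
    have htop : Z.eigenspace c.re = ⊤ := by
      have hinv : ∀ h, ∀ v ∈ Z.eigenspace c.re, ρ h v ∈ Z.eigenspace c.re := fun h v hv => by
        rw [Module.End.mem_eigenspace_iff] at hv ⊢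
        rw [hZ, hv, map_smul]
      by_cases hx0 : x = 0
      · refine eq_top_of_isIrreducible hρ _ hinv (v := y) (Module.End.mem_eigenspace_iff.2 hy) ?_
        rintro rfl
        simp [hx0] at h0
      · exact eq_top_of_isIrreducible hρ _ hinv (Module.End.mem_eigenspace_iff.2 hx) hx0
    exact Module.End.mem_eigenspace_iff.1 (htop ▸ Submodule.mem_top)
  · exfalso
    -- On the span of x and y the operator T satisfies T² = -(im c)². The kernel of T² + (im c)² is
    -- invariant and nonzero, hence everything, and T / im c squares to -1.
    let T : Module.End ℝ W := Z - c.re • 1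
    have hT : ∀ h w, T (ρ h w) = ρ h (T w) := fun h w => by simp [T, hZ]
    have hTx : T x = -(c.im • y) := by simp [T, hx]
    have hTy : T y = c.im • x := by simp [T, hy]
    have htop : LinearMap.ker (T * T + (c.im * c.im) • 1) = ⊤ := by
      have hinv : ∀ h, ∀ v ∈ LinearMap.ker (T * T + (c.im * c.im) • 1),
          ρ h v ∈ LinearMap.ker (T * T + (c.im * c.im) • 1) := fun h v hv => by
        simp only [LinearMap.mem_ker, LinearMap.add_apply, Module.End.mul_apply,
          LinearMap.smul_apply, Module.End.one_apply] at hv ⊢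
        rw [hT, hT, ← map_smul, ← map_add, hv, map_zero]
      by_cases hx0 : x = 0
      · refine eq_top_of_isIrreducible hρ _ hinv (v := y) ?_ ?_
        · simp [hTx, hTy, smul_smul]
        · rintro rfl
          simp [hx0] at h0
      · refine eq_top_of_isIrreducible hρ _ hinv (v := x) ?_ hx0
        simp [hTx, hTy, smul_smul]
    refine hJ ⟨c.im⁻¹ • T, fun w => ?_, fun h w => by simp [hT]⟩
    have hw : w ∈ LinearMap.ker (T * T + (c.im * c.im) • 1) := htop ▸ Submodule.mem_top
    simp only [LinearMap.mem_ker, LinearMap.add_apply, Module.End.mul_apply,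
          LinearMap.smul_apply, Module.End.one_apply] at hw
    rw [LinearMap.smul_apply, LinearMap.smul_apply, map_smul, eq_neg_of_add_eq_zero_left hw,
      smul_smul, smul_neg, smul_smul]
    field_simp
    simp

/-! ### Infinitesimal actions and the intertwiner given by the contraction -/

/-- The algebraic properties of the infinitesimal action `a` of the Lie algebra `𝔮`, identified
with a subalgebra of `𝔤` by means of `j`, on a representation `ρ` of a group `P` which
acts on `𝔤` by automorphisms `Ad`. -/
structure IsInfinitesimalAction {𝔤 : Type*} [LieRing 𝔤] [LieAlgebra ℝ 𝔤] {𝔮 : Type*}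
    [AddCommGroup 𝔮] [Module ℝ 𝔮] {𝕜 P W : Type*} [Field 𝕜] [Group P] [AddCommGroup W] [Module 𝕜 W]
    [Module ℝ W] [SMulCommClass 𝕜 ℝ W]
    (j : 𝔮 →ₗ[ℝ] 𝔤) (Ad : P → 𝔤 ≃ₗ⁅ℝ⁆ 𝔤) (ρ : Representation 𝕜 P W)
    (a : 𝔮 →ₗ[ℝ] Module.End 𝕜 W) : Prop where
  injective : Function.Injective j
  lie : ∀ A B, ∃ C, j C = ⁅j A, j B⁆ ∧ ∀ w, a C w = a A (a B w) - a B (a A w)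
  ad_cancel : ∀ h X, Ad h⁻¹ (Ad h X) = X
  ad : ∀ h A, ∃ A', j A' = Ad h (j A) ∧ ∀ w, a A' (ρ h w) = ρ h (a A w)

section

variable {𝔤 : Type*} [LieRing 𝔤] [LieAlgebra ℝ 𝔤] {𝔮 : Type*}
    [AddCommGroup 𝔮] [Module ℝ 𝔮] {𝕜 P W : Type*} [Field 𝕜] [Group P] [AddCommGroup W] [Module 𝕜 W]
    [Module ℝ W] [SMulCommClass 𝕜 ℝ W]
    {j : 𝔮 →ₗ[ℝ] 𝔤} {Ad : P → 𝔤 ≃ₗ⁅ℝ⁆ 𝔤} {ρ : Representation 𝕜 P W}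
    {a : 𝔮 →ₗ[ℝ] Module.End 𝕜 W}

lemma IsInfinitesimalAction.lie_mem_range (hA : IsInfinitesimalAction j Ad ρ a) (A B : 𝔮) :
    ⁅j A, j B⁆ ∈ LinearMap.range j := by
  obtain ⟨C, hC, -⟩ := hA.lie A B
  exact ⟨C, hC⟩

lemma IsInfinitesimalAction.ad_inv (hA : IsInfinitesimalAction j Ad ρ a) (h : P) (A : 𝔮) :
    ∃ A', j A' = Ad h⁻¹ (j A) ∧ ∀ w, a A (ρ h w) = ρ h (a A' w) := by
  obtain ⟨A', hA', hw⟩ := hA.ad h⁻¹ A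
  refine ⟨A', hA', fun w => ?_⟩
  have := congrArg (ρ h) (hw (ρ h w))
  simpa using this.symm

variable [FiniteDimensional ℝ 𝔤] [IsKilling ℝ 𝔤]

/-- `A` is orthogonal to `𝔭` with respect to the Killing form. -/
def IsPerp (j : 𝔮 →ₗ[ℝ] 𝔤) (A : 𝔮) : Prop := ∀ A', killingForm ℝ 𝔤 (j A) (j A') = 0

/-- Ad(P) preserves both 𝔭 and the Killing form, so the vectors killed by the orthogonal of 𝔭 in 𝔭
form an invariant subspace; one nonzero such vector suffices by irreducibility. -/
lemma IsPerp.act_eq_zero (hA : IsInfinitesimalAction j Ad ρ a) (hρ : ρ.IsIrreducible)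
    {v : W} (hv0 : v ≠ 0) (hv : ∀ A, IsPerp j A → a A v = 0) {A : 𝔮} (hAp : IsPerp j A) :
    a A = 0 := by
  let U : Submodule 𝕜 W :=
    { carrier := {v | ∀ A, IsPerp j A → a A v = 0}
      zero_mem' := by simp
      add_mem' := fun {x y} hx hy A hA => by rw [map_add, hx A hA, hy A hA, add_zero]
      smul_mem' := fun c x hx A hA => by rw [map_smul, hx A hA, smul_zero] }
  have htop : U = ⊤ := by
    refine eq_top_of_isIrreducible hρ U (fun h v hv A hAp => ?_) (v := v) hv hv0
    obtain ⟨A', hA', hw⟩ := hA.ad_inv h A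
    rw [hw, hv A', map_zero]
    intro B
    obtain ⟨B', hB', -⟩ := hA.ad h B
    rw [hA', ← hA.ad_cancel h (j B), ← hB', LieAlgebra.killingForm_of_equiv_apply]
    exact hAp B'
  ext w
  exact (htop ▸ Submodule.mem_top : w ∈ U) A hAp

/-- The representation operator whose value is the contraction of a jet. -/
lemma IsInfinitesimalAction.exists_jets (hA : IsInfinitesimalAction j Ad ρ a)
    [LinearMap.CompatibleSMul W W ℝ 𝕜] :
    ∃ (φ : W → 𝔤 →ₗ[ℝ] W) (β : W → 𝔤 →ₗ[ℝ] 𝔤 →ₗ[ℝ] W) (Z : Module.End 𝕜 W),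
      ∀ w, IsJet j (fun A v => a A v) w (φ w) (β w) ∧ killingContraction (β w) = Z w := by
  obtain ⟨q, hq⟩ := LinearMap.exists_leftInverse_of_injective j
    (LinearMap.ker_eq_bot.2 hA.injective)
  have hqj : ∀ A, q (j A) = A := fun A => LinearMap.congr_fun hq A
  let ev : W → Module.End 𝕜 W →ₗ[ℝ] W := fun w =>
    { toFun := fun T => T w, map_add' := fun _ _ => rfl, map_smul' := fun _ _ => rfl }
  -- A model jet for every w, linear in w: put φ = -a(q ·)w and let the formula for D²f(A,Y) define
  -- β, with a projection q onto 𝔭 in the first slot. The remaining condition on β(Y,A) then holds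
  -- because a respects brackets.
  let β₀ : 𝔤 →ₗ[ℝ] 𝔤 →ₗ[ℝ] Module.End 𝕜 W := LinearMap.mk₂ ℝ
    (fun X Y => a (q X) ∘ₗ a (q Y) - a (q ⁅j (q X), Y⁆))
    (fun X X' Y => by
      ext w
      simp only [map_add, add_lie, LinearMap.sub_apply, LinearMap.comp_apply, LinearMap.add_apply]
      abel)
    (fun c X Y => by
      ext w
      simp only [map_smul, smul_lie, LinearMap.sub_apply, LinearMap.comp_apply,
        LinearMap.smul_apply, smul_sub])
    (fun X Y Y' => by
      ext w
      simp only [map_add, lie_add, LinearMap.sub_apply, LinearMap.comp_apply, LinearMap.add_apply]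
      abel)
    (fun c X Y => by
      ext w
      simp only [map_smul, lie_smul, LinearMap.sub_apply, LinearMap.comp_apply,
        LinearMap.smul_apply, smul_sub]
      rw [LinearMap.map_smul_of_tower])
  refine ⟨fun w => -(ev w ∘ₗ a ∘ₗ q), fun w => β₀.compr₂ (ev w), killingContraction β₀,
    fun w => ⟨⟨fun A => ?_, fun A Y => ?_, fun Y A => ?_⟩, killingContraction_map _ _⟩⟩
  · simp [ev, hqj]
  · simp [ev, hqj, β₀, sub_eq_add_neg]
  · obtain ⟨C, hC, haC⟩ := hA.lie (q Y) A
    simp [ev, hqj, β₀, ← hC, haC]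

/-- Jets are transported along the action of P. Comparing the contraction before and after transport
shows that the induced endomorphism commutes with P. -/
lemma IsInfinitesimalAction.map_jet (hA : IsInfinitesimalAction j Ad ρ a) (h : P)
    {T : W →ₗ[ℝ] W} (hT : ∀ w, T w = ρ h w) {w : W} {φ : 𝔤 →ₗ[ℝ] W} {β : 𝔤 →ₗ[ℝ] 𝔤 →ₗ[ℝ] W}
    (hw : IsJet j (fun A v => a A v) w φ β) :
    IsJet j (fun A v => a A v) (ρ h w) (T ∘ₗ φ ∘ₗ (Ad h⁻¹ : 𝔤 →ₗ[ℝ] 𝔤))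
      ((β.compl₁₂ (Ad h⁻¹ : 𝔤 →ₗ[ℝ] 𝔤) (Ad h⁻¹ : 𝔤 →ₗ[ℝ] 𝔤)).compr₂ T) := by
  refine ⟨fun A => ?_, fun A Y => ?_, fun Y A => ?_⟩
  · obtain ⟨A', hA', haA⟩ := hA.ad_inv h A
    simp [← hA', hw.apply_incl, haA, hT]
  · obtain ⟨A', hA', haA⟩ := hA.ad_inv h A
    simp [← hA', hw.incl_left, haA, hT, LieEquiv.map_lie]
  · obtain ⟨A', hA', haA⟩ := hA.ad_inv h A
    simp [← hA', hw.incl_right, haA, hT]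

/-- If the contraction of jets depends only on their values, it is given by an endomorphism of the
representation. -/
lemma IsInfinitesimalAction.exists_intertwiner (hA : IsInfinitesimalAction j Ad ρ a)
    [LinearMap.CompatibleSMul W W ℝ 𝕜]
    (hcongr : ∀ w φ β φ' β', IsJet j (fun A v => a A v) w φ β →
      IsJet j (fun A v => a A v) w φ' β' → killingContraction β = killingContraction β') :
    ∃ Z : Module.End 𝕜 W, (∀ w φ β, IsJet j (fun A v => a A v) w φ β →
      killingContraction β = Z w) ∧ ∀ h w, Z (ρ h w) = ρ h (Z w) := by
  obtain ⟨φ, β, Z, hZ⟩ := hA.exists_jets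
  have h1 : ∀ w φ β, IsJet j (fun A v => a A v) w φ β → killingContraction β = Z w :=
    fun w φ' β' h => (hcongr w _ _ _ _ h (hZ w).1).trans (hZ w).2
  refine ⟨Z, h1, fun h w => ?_⟩
  let T : W →ₗ[ℝ] W := (ρ h).restrictScalars ℝ
  have hT : ∀ w, T w = ρ h w := fun _ => rfl
  rw [← h1 _ _ _ (hA.map_jet h hT (hZ w).1), killingContraction_map,
    ← (hZ w).2, hT]
  congr 1
  exact killingContraction_compl₁₂ (β w) (Ad h⁻¹).toLinearEquiv
    fun x y => LieAlgebra.killingForm_of_equiv_apply (Ad h⁻¹) x y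

end

/-! ### Trivial action of the orthogonal of 𝔭, and the scalar for complex representations -/

section ComplexValued

variable {𝔤 : Type*} [LieRing 𝔤] [LieAlgebra ℝ 𝔤] [FiniteDimensional ℝ 𝔤] [IsKilling ℝ 𝔤]
  {𝔮 : Type*} [AddCommGroup 𝔮] [Module ℝ 𝔮]
  {V : Type*} [AddCommGroup V] [Module ℂ V] [Module ℝ V] [IsScalarTower ℝ ℂ V]
  [SMulCommClass ℂ ℝ V] {j : 𝔮 →ₗ[ℝ] 𝔤} {a : 𝔮 →ₗ[ℝ] Module.End ℂ V}

lemma baseChange_injective (hj : Function.Injective j) : Function.Injective (j.baseChange ℂ) :=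
  Module.Flat.lTensor_preserves_injective_linearMap j hj

lemma exists_lie_complexified
    (hlie : ∀ A B, ∃ C, j C = ⁅j A, j B⁆ ∧ ∀ w, a C w = a A (a B w) - a B (a A w))
    (z z' : ℂ ⊗[ℝ] 𝔮) : ∃ y : ℂ ⊗[ℝ] 𝔮, j.baseChange ℂ y = ⁅j.baseChange ℂ z, j.baseChange ℂ z'⁆ ∧
      ∀ w, a.liftBaseChange ℂ y w = a.liftBaseChange ℂ z (a.liftBaseChange ℂ z' w) -
        a.liftBaseChange ℂ z' (a.liftBaseChange ℂ z w) := by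
  induction z using TensorProduct.induction_on with
  | zero => exact ⟨0, by simp⟩
  | add z₁ z₂ h₁ h₂ =>
    obtain ⟨y₁, h₁, h₁'⟩ := h₁
    obtain ⟨y₂, h₂, h₂'⟩ := h₂
    refine ⟨y₁ + y₂, by simp [h₁, h₂], fun w => ?_⟩
    simp only [map_add, LinearMap.add_apply, h₁', h₂']
    abel
  | tmul c A =>
    induction z' using TensorProduct.induction_on with
    | zero => exact ⟨0, by simp⟩
    | add z₁ z₂ h₁ h₂ =>
      obtain ⟨y₁, h₁, h₁'⟩ := h₁
      obtain ⟨y₂, h₂, h₂'⟩ := h₂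
      refine ⟨y₁ + y₂, by simp only [map_add, lie_add, h₁, h₂], fun w => ?_⟩
      simp only [map_add, LinearMap.add_apply, h₁', h₂']
      abel
    | tmul d B =>
      obtain ⟨C, hC, hC'⟩ := hlie A B
      refine ⟨(c * d) ⊗ₜ C, ?_, fun w => ?_⟩
      · simp [LieAlgebra.ExtendScalars.bracket_tmul, hC]
      · simp [hC', smul_smul, mul_comm d c, smul_sub]

lemma IsPerp.killingForm_complexified {A : 𝔮} (hA : IsPerp j A) {x : ℂ ⊗[ℝ] 𝔤}
    (hx : x ∈ LinearMap.range (j.baseChange ℂ)) :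
    killingForm ℂ (ℂ ⊗[ℝ] 𝔤) (1 ⊗ₜ j A) x = 0 := by
  obtain ⟨z, rfl⟩ := hx
  induction z using TensorProduct.induction_on with
  | zero => simp
  | add z z' hz hz' => rw [map_add, map_add, hz, hz', add_zero]
  | tmul c B =>
    rw [killingForm_complexification]
    simp [hA B]

/-- There is a nonzero vector on which all elements of `𝔭` orthogonal to `𝔭` act trivially. -/
lemma exists_ne_zero_forall_isPerp [FiniteDimensional ℂ V] [Nontrivial V]
    (hinj : Function.Injective j)
    (hlie : ∀ A B, ∃ C, j C = ⁅j A, j B⁆ ∧ ∀ w, a C w = a A (a B w) - a B (a A w))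
    {H : LieSubalgebra ℂ (ℂ ⊗[ℝ] 𝔤)} [H.IsCartanSubalgebra] {b : (rootSystem H).Base}
    (hb : IsStandardParabolic b (LinearMap.range (j.baseChange ℂ))) :
    ∃ v : V, v ≠ 0 ∧ ∀ A, IsPerp j A → a A v = 0 := by
  classical
  obtain ⟨h₀, hh₀⟩ := exists_apply_eq_height b
  obtain ⟨z₀, hz₀⟩ := hb.1 h₀.2
  have hfin := (a.liftBaseChange ℂ z₀).finite_hasEigenvalue
  obtain ⟨c₀, hc₀⟩ := Module.End.exists_eigenvalue (a.liftBaseChange ℂ z₀)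
  -- A highest weight vector in disguise: h₀ takes the height as value on each root, so a positive
  -- root vector raises the real part of the eigenvalue by at least one. An eigenvector of maximal
  -- real part must be annihilated.
  obtain ⟨c, hc, hmax⟩ := hfin.exists_maximalFor (fun c : ℂ => c.re) _ ⟨c₀, hc₀⟩
  obtain ⟨v, hv⟩ := Module.End.HasEigenvalue.exists_hasEigenvector hc
  have hpos : ∀ α : H.root, b.IsPos α → ∀ z : ℂ ⊗[ℝ] 𝔮,
      j.baseChange ℂ z ∈ rootSpace H (α : LieModule.Weight ℂ H (ℂ ⊗[ℝ] 𝔤)) →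
      a.liftBaseChange ℂ z v = 0 := by
    intro α hα z hz
    obtain ⟨y, hy, hy'⟩ := exists_lie_complexified hlie z₀ z
    have h1 : y = (b.height α : ℂ) • z := by
      apply baseChange_injective hinj
      rw [hy, hz₀, map_smul, ← hh₀]
      exact lie_eq_smul_of_mem_rootSpace hz h₀
    by_contra hne
    have h2 : Module.End.HasEigenvalue (a.liftBaseChange ℂ z₀) (c + b.height α) := by
      refine Module.End.hasEigenvalue_of_hasEigenvector (x := a.liftBaseChange ℂ z v)
        ⟨Module.End.mem_eigenspace_iff.2 ?_, hne⟩
      have h3 := hy' v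
      rw [hv.apply_eq_smul, map_smul, h1, map_smul, LinearMap.smul_apply] at h3
      rw [add_smul, h3]
      abel
    have h4 := hmax h2
    have h5 : 0 < b.height α := hα
    simp at h4
    omega
  refine ⟨v, hv.2, fun A hA => ?_⟩
  obtain ⟨n, t, t', ht⟩ := exists_cartan_dualBasis H
  obtain ⟨e, f, hef⟩ := exists_rootVectors H
  have hz : ∀ α : H.root, ∃ z : ℂ ⊗[ℝ] 𝔮, ¬ b.IsPos α → j.baseChange ℂ z = f α := by
    intro α
    by_cases hα : b.IsPos α
    · exact ⟨0, fun h => absurd hα h⟩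
    · obtain ⟨z, hz⟩ := hb.2 _ ((isPos_negRoot_iff b α).2 hα) (hef α).2.1
      exact ⟨z, fun _ => hz⟩
  choose z hz using hz
  have h1 := sum_killingForm_rootVectors ht (fun α => (hef α).1) (fun α => (hef α).2.1)
    (fun α => (hef α).2.2) (1 ⊗ₜ j A)
  rw [Finset.sum_eq_zero, zero_add] at h1
  · have h2 : (1 : ℂ) ⊗ₜ[ℝ] A =
        ∑ α, (if b.IsPos α then 0 else killingForm ℂ (ℂ ⊗[ℝ] 𝔤) (1 ⊗ₜ j A) (e α)) • z α := by
      apply baseChange_injective hinj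
      rw [LinearMap.baseChange_tmul, ← h1, map_sum]
      refine Finset.sum_congr rfl fun α _ => ?_
      rw [h1, map_smul]
      split_ifs with hα
      · rw [hA.killingForm_complexified (hb.2 α hα (hef α).1), zero_smul, zero_smul]
      · rw [hz α hα]
    have h3 := congrArg (fun y => a.liftBaseChange ℂ y v) h2
    simp only [LinearMap.liftBaseChange_one_tmul] at h3
    rw [h3, map_sum, LinearMap.sum_apply]
    refine Finset.sum_eq_zero fun α _ => ?_
    rw [map_smul, LinearMap.smul_apply]
    split_ifs with hα
    · simp
    · rw [hpos _ ((isPos_negRoot_iff b α).2 hα) (z α) (by rw [hz α hα]; exact (hef α).2.1),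
        smul_zero]
  · intro i _
    rw [hA.killingForm_complexified (hb.1 (t i).2), zero_smul]

/-- The orthogonality condition is defined over ℝ, so the real and imaginary parts of an orthogonal
element are themselves orthogonal to 𝔭. -/
lemma actsTriviallyOnPerp_of_isPerp (h : ∀ A, IsPerp j A → a A = 0) :
    ActsTriviallyOnPerp j a := by
  intro z hz
  obtain ⟨x, y, rfl⟩ := exists_eq_one_tmul_add_I_tmul z
  have hxy : IsPerp j x ∧ IsPerp j y := by
    have h1 : ∀ B, killingForm ℝ 𝔤 (j x) (j B) = 0 ∧ killingForm ℝ 𝔤 (j y) (j B) = 0 := by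
      intro B
      have h2 := hz (1 ⊗ₜ j B) ⟨1 ⊗ₜ B, by simp⟩
      rw [killingForm_complexification] at h2
      simp at h2
      have h3 := congrArg Complex.re h2
      have h4 := congrArg Complex.im h2
      simp at h3 h4
      exact ⟨h3, h4⟩
    exact ⟨fun B => (h1 B).1, fun B => (h1 B).2⟩
  simp [h x hxy.1, h y hxy.2]

variable {P : Type*} [Group P] {Ad : P → 𝔤 ≃ₗ⁅ℝ⁆ 𝔤}

theorem IsInfinitesimalAction.exists_scalar {ρ : Representation ℂ P V} [FiniteDimensional ℂ V]
    (hA : IsInfinitesimalAction j Ad ρ a) (hρ : ρ.IsIrreducible) (hpar : IsParabolicImage j) :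
    ∃ c : ℂ, (∀ w φ β, IsJet j (fun A v => a A v) w φ β → killingContraction β = c • w) ∧
      ∀ (H : LieSubalgebra ℂ (ℂ ⊗[ℝ] 𝔤)) [H.IsCartanSubalgebra]
        (b : (IsKilling.rootSystem H).Base) (ν : Module.Dual ℂ H),
        IsStandardParabolic b (LinearMap.range (j.baseChange ℂ)) →
        IsLowestWeight j a b (-ν) →
        c = weightInner H ν ν + 2 * weightInner H ν (halfSumPosRoots b) := by
  have := nontrivial_of_isIrreducible hρ
  obtain ⟨H, hH, b, hb⟩ := hpar
  have hperp : ActsTriviallyOnPerp j a := by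
    obtain ⟨v, hv0, hv⟩ := exists_ne_zero_forall_isPerp hA.injective hA.lie hb
    exact actsTriviallyOnPerp_of_isPerp fun A hAp => hAp.act_eq_zero hA hρ hv0 hv
  obtain ⟨Z, hZ, hZρ⟩ := hA.exists_intertwiner fun w φ β φ' β' h h' =>
    h.killingContraction_congr hb hA.lie_mem_range hperp h'
  obtain ⟨c, hc⟩ := exists_eq_smul_one_of_isIrreducible hρ Z hZρ
  refine ⟨c, fun w φ β h => by rw [hZ w φ β h, hc], fun H' _ b' ν hb' hν => ?_⟩
  obtain ⟨v, hv0, hv⟩ := hν.exists_killingContraction_eq hb' hA.lie_mem_range hperp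
  obtain ⟨φ, β, Z', hj⟩ := hA.exists_jets
  have h1 := hv _ _ (hj v).1
  rw [hZ _ _ _ (hj v).1, hc] at h1
  exact smul_left_injective ℂ hv0 h1

lemma IsJet.add {w w' : V} {φ φ' : 𝔤 →ₗ[ℝ] V} {β β' : 𝔤 →ₗ[ℝ] 𝔤 →ₗ[ℝ] V}
    (h : IsJet j (fun A v => a A v) w φ β) (h' : IsJet j (fun A v => a A v) w' φ' β') :
    IsJet j (fun A v => a A v) (w + w') (φ + φ') (β + β') := by
  refine ⟨fun A => ?_, fun A Y => ?_, fun Y A => ?_⟩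
  · simp only [LinearMap.add_apply, h.apply_incl, h'.apply_incl, map_add]
    abel
  · simp only [LinearMap.add_apply, h.incl_left, h'.incl_left, map_add]
    abel
  · simp only [LinearMap.add_apply, h.incl_right, h'.incl_right, map_add]
    abel

lemma IsJet.smul {w : V} {φ : 𝔤 →ₗ[ℝ] V} {β : 𝔤 →ₗ[ℝ] 𝔤 →ₗ[ℝ] V} (c : ℂ)
    (h : IsJet j (fun A v => a A v) w φ β) :
    IsJet j (fun A v => a A v) (c • w) (c • φ) (c • β) := by
  refine ⟨fun A => ?_, fun A Y => ?_, fun Y A => ?_⟩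
  · simp only [LinearMap.smul_apply, h.apply_incl, map_smul, smul_neg]
  · simp only [LinearMap.smul_apply, h.incl_left, map_smul, smul_neg, smul_add]
  · simp only [LinearMap.smul_apply, h.incl_right, map_smul, smul_neg]

end ComplexValued

/-! ### The scalar for real representations -/

section RealValued

variable {𝔤 : Type*} [LieRing 𝔤] [LieAlgebra ℝ 𝔤] [FiniteDimensional ℝ 𝔤] [IsKilling ℝ 𝔤]
  {𝔮 : Type*} [AddCommGroup 𝔮] [Module ℝ 𝔮] {j : 𝔮 →ₗ[ℝ] 𝔤}
  {P : Type*} [Group P] {Ad : P → 𝔤 ≃ₗ⁅ℝ⁆ 𝔤}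

theorem IsInfinitesimalAction.exists_scalar_real {W : Type*} [AddCommGroup W] [Module ℝ W]
    [FiniteDimensional ℝ W] {ρ : Representation ℝ P W} {a : 𝔮 →ₗ[ℝ] Module.End ℝ W}
    (hA : IsInfinitesimalAction j Ad ρ a) (hρ : ρ.IsIrreducible)
    (hJ : ¬ ∃ J : W →ₗ[ℝ] W, (∀ w, J (J w) = -w) ∧ ∀ h w, J (ρ h w) = ρ h (J w))
    (hpar : IsParabolicImage j) {a' : 𝔮 →ₗ[ℝ] Module.End ℂ (ℂ ⊗[ℝ] W)}
    (ha' : ∀ A, a' A = (a A).baseChange ℂ) :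
    ∃ c : ℝ, (∀ w φ β, IsJet j (fun A v => a A v) w φ β → killingContraction β = c • w) ∧
      ∀ (H : LieSubalgebra ℂ (ℂ ⊗[ℝ] 𝔤)) [H.IsCartanSubalgebra]
        (b : (IsKilling.rootSystem H).Base) (ν : Module.Dual ℂ H),
        IsStandardParabolic b (LinearMap.range (j.baseChange ℂ)) →
        IsLowestWeight j a' b (-ν) →
        (c : ℂ) = weightInner H ν ν + 2 * weightInner H ν (halfSumPosRoots b) := by
  have := nontrivial_of_isIrreducible hρ
  have hnt : Nontrivial (ℂ ⊗[ℝ] W) := one_tmul_injective.nontrivial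
  obtain ⟨H, hH, b, hb⟩ := hpar
  have hlie' : ∀ A B, ∃ C, j C = ⁅j A, j B⁆ ∧
      ∀ w, a' C w = a' A (a' B w) - a' B (a' A w) := by
    intro A B
    obtain ⟨C, hC, hC'⟩ := hA.lie A B
    refine ⟨C, hC, fun w => ?_⟩
    simp only [ha']
    induction w using TensorProduct.induction_on with
    | zero => simp
    | add x y hx hy =>
      simp only [map_add, hx, hy]
      abel
    | tmul c w => simp [hC', TensorProduct.tmul_sub]
  have hperp : ActsTriviallyOnPerp j a' := by
    obtain ⟨v, hv0, hv⟩ := exists_ne_zero_forall_isPerp hA.injective hlie' hb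
    obtain ⟨x, y, rfl⟩ := exists_eq_one_tmul_add_I_tmul v
    have hxy : ∀ A, IsPerp j A → a A x = 0 ∧ a A y = 0 := fun A hAp => by
      have := hv A hAp
      simp only [ha', map_add, LinearMap.baseChange_tmul] at this
      exact one_tmul_add_I_tmul_eq_zero this
    have hzero : ∀ A, IsPerp j A → a A = 0 := by
      by_cases hx0 : x = 0
      · have hy0 : y ≠ 0 := by
          rintro rfl
          simp [hx0] at hv0
        exact fun A hAp => hAp.act_eq_zero hA hρ hy0 fun A hAp => (hxy A hAp).2
      · exact fun A hAp => hAp.act_eq_zero hA hρ hx0 fun A hAp => (hxy A hAp).1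
    exact actsTriviallyOnPerp_of_isPerp fun A hAp => by
      rw [ha', hzero A hAp, LinearMap.baseChange_zero]
  let ι : W →ₗ[ℝ] ℂ ⊗[ℝ] W := TensorProduct.mk ℝ ℂ W 1
  have hjet : ∀ w φ β, IsJet j (fun A v => a A v) w φ β →
      IsJet j (fun A v => a' A v) (ι w) (ι ∘ₗ φ) (β.compr₂ ι) := fun w φ β h =>
    ⟨fun A => by simp [ι, ha', h.apply_incl, TensorProduct.tmul_neg],
      fun A Y => by simp [ι, ha', h.incl_left, TensorProduct.tmul_add,
      TensorProduct.tmul_neg],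
      fun A Y => by simp [ι, ha', h.incl_right, TensorProduct.tmul_neg]⟩
  have hι : Function.Injective ι := one_tmul_injective
  obtain ⟨Z, hZ, hZρ⟩ := hA.exists_intertwiner fun w φ β φ' β' h h' => by
    apply hι
    rw [← killingContraction_map, ← killingContraction_map]
    exact (hjet _ _ _ h).killingContraction_congr hb hA.lie_mem_range hperp (hjet _ _ _ h')
  obtain ⟨c, hc⟩ := exists_eq_smul_one_of_isIrreducible_real hρ hJ Z hZρ
  refine ⟨c, fun w φ β h => by rw [hZ w φ β h, hc], fun H' _ b' ν hb' hν => ?_⟩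
  obtain ⟨v, hv0, hv⟩ := hν.exists_killingContraction_eq hb' hA.lie_mem_range hperp
  obtain ⟨φ, β, Z', hj⟩ := hA.exists_jets
  obtain ⟨x, y, rfl⟩ := exists_eq_one_tmul_add_I_tmul v
  have hI : (Complex.I ⊗ₜ[ℝ] y : ℂ ⊗[ℝ] W) = Complex.I • ι y := by
    simp [ι, TensorProduct.smul_tmul']
  rw [hI] at hv hv0
  -- The lowest weight vector need not be real. A jet over it is assembled from real jets over its
  -- real and imaginary parts, on each of which the contraction is multiplication by the same c.
  have h1 := hv _ _ ((hjet _ _ _ (hj x).1).add ((hjet _ _ _ (hj y).1).smul Complex.I))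
  have h2 : killingContraction ((β x).compr₂ ι + Complex.I • (β y).compr₂ ι) =
      ι (killingContraction (β x)) + Complex.I • ι (killingContraction (β y)) := by
    rw [← killingContraction_map, ← killingContraction_map]
    simp only [killingContraction, LinearMap.add_apply, LinearMap.smul_apply,
      Finset.sum_add_distrib, Finset.smul_sum]
  rw [h2, hZ _ _ _ (hj x).1, hZ _ _ _ (hj y).1, hc, hc, map_smul, map_smul,
    smul_comm Complex.I c, ← smul_add] at h1
  exact smul_left_injective ℂ hv0 ((algebraMap_smul ℂ c _).trans h1)

end RealValued

/-! ### The adjoint action in a chart, and its derivative -/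

/-- The derivative of a family of vectors `v p` given implicitly in terms of the partial derivatives
of a local multiplication `m` with neutral element `x₀`. -/
lemma hasFDerivAt_of_localMul {E : Type*} [NormedAddCommGroup E] [NormedSpace ℝ E] [CompleteSpace E]
    {m : E × E → E} {x₀ : E} (hm : ContDiffAt ℝ ∞ m (x₀, x₀))
    (h1 : (fderiv ℝ m (x₀, x₀)).comp (ContinuousLinearMap.inl ℝ E E) = .id ℝ E)
    (h2 : (fderiv ℝ m (x₀, x₀)).comp (ContinuousLinearMap.inr ℝ E E) = .id ℝ E)
    {X : E} {v : E → E}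
    (hv : ∀ᶠ p in nhds x₀, fderiv ℝ m (x₀, p) (v p, 0) = fderiv ℝ m (p, x₀) (0, X)) :
    DifferentiableAt ℝ v x₀ ∧ ∀ A, fderiv ℝ v x₀ A =
      lieBracket ℝ (fun p => fderiv ℝ m (p, x₀) (0, A)) (fun p => fderiv ℝ m (p, x₀) (0, X)) x₀ := by
  have hM : ContDiffAt ℝ ∞ (fderiv ℝ m) (x₀, x₀) := hm.fderiv_right (m := ∞) (by simp)
  have hMd : DifferentiableAt ℝ (fderiv ℝ m) (x₀, x₀) := hM.differentiableAt (by simp)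
  set S := fderiv ℝ (fderiv ℝ m) (x₀, x₀) with hS
  have hsymm : ∀ a b, S a b = S b a := hm.isSymmSndFDerivAt (by
    rw [minSmoothness_of_isRCLikeNormedField]; exact WithTop.coe_le_coe.2 (le_top : (2 : ℕ∞) ≤ ⊤))
  let L : E → E →L[ℝ] E := fun p => (fderiv ℝ m (x₀, p)).comp (ContinuousLinearMap.inl ℝ E E)
  have hpairr : ∀ p : E, HasFDerivAt (fun p : E => (x₀, p)) (ContinuousLinearMap.inr ℝ E E) p :=
    fun p => hasFDerivAt_prodMk_right x₀ p
  have hpairl : ∀ p : E, HasFDerivAt (fun p : E => (p, x₀)) (ContinuousLinearMap.inl ℝ E E) p :=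
    fun p => hasFDerivAt_prodMk_left p x₀
  have hMr : HasFDerivAt (fun p => fderiv ℝ m (x₀, p)) (S.comp (ContinuousLinearMap.inr ℝ E E)) x₀ :=
    HasFDerivAt.comp (f := fun p : E => (x₀, p)) x₀ hMd.hasFDerivAt (hpairr x₀)
  have hMl : HasFDerivAt (fun p => fderiv ℝ m (p, x₀)) (S.comp (ContinuousLinearMap.inl ℝ E E)) x₀ :=
    HasFDerivAt.comp (f := fun p : E => (p, x₀)) x₀ hMd.hasFDerivAt (hpairl x₀)
  have hL2 : ∀ Y, HasFDerivAt (fun p => fderiv ℝ m (p, x₀) (0, Y))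
      ((S.comp (ContinuousLinearMap.inl ℝ E E)).flip (0, Y)) x₀ := fun Y => by
    simpa using hMl.clm_apply (hasFDerivAt_const (0, Y) x₀)
  have hLc : ContDiffAt ℝ ∞ L x₀ := by
    have : ContDiffAt ℝ ∞ (fun p => fderiv ℝ m (x₀, p)) x₀ :=
      ContDiffAt.comp (f := fun p : E => (x₀, p)) x₀ hM (contDiffAt_const.prodMk contDiffAt_id)
    exact this.clm_comp contDiffAt_const
  have hinv : DifferentiableAt ℝ (fun p => (L p).inverse) x₀ := by
    have h3 : ContDiffAt ℝ ∞ ContinuousLinearMap.inverse (L x₀) := by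
      have : L x₀ = ((ContinuousLinearEquiv.refl ℝ E : E ≃L[ℝ] E) : E →L[ℝ] E) := h1
      rw [this]
      exact contDiffAt_map_inverse _
    exact (h3.comp x₀ hLc).differentiableAt (by simp)
  have hunit : ∀ᶠ p in nhds x₀, ∃ e : E ≃L[ℝ] E, (e : E →L[ℝ] E) = L p := by
    have hopen := ContinuousLinearEquiv.nhds (ContinuousLinearEquiv.refl ℝ E)
    have : L x₀ = ((ContinuousLinearEquiv.refl ℝ E : E ≃L[ℝ] E) : E →L[ℝ] E) := h1
    rw [← this] at hopen
    exact hLc.continuousAt.eventually_mem hopen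
  -- Near x₀ the partial derivative L(p) is invertible, so v is an explicit differentiable
  -- expression; differentiability is thereby a consequence and not an assumption.
  have hveq : v =ᶠ[nhds x₀] fun p => (L p).inverse (fderiv ℝ m (p, x₀) (0, X)) := by
    filter_upwards [hv, hunit] with p hp ⟨e, he⟩
    have : L p (v p) = fderiv ℝ m (p, x₀) (0, X) := hp
    rw [← this, ← he, ContinuousLinearMap.inverse_equiv]
    simp
  have hvd : DifferentiableAt ℝ v x₀ :=
    (hinv.clm_apply (hL2 X).differentiableAt).congr_of_eventuallyEq hveq
  have hvx : v x₀ = X := by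
    have h3 := hv.self_of_nhds
    have h4 := DFunLike.congr_fun h1 (v x₀)
    have h5 := DFunLike.congr_fun h2 X
    simp at h4 h5
    rw [h4, h5] at h3
    exact h3
  refine ⟨hvd, fun A => ?_⟩
  have hprod : HasFDerivAt (fun p => fderiv ℝ m (x₀, p) (v p, 0))
      ((fderiv ℝ m (x₀, x₀)).comp ((ContinuousLinearMap.inl ℝ E E).comp (fderiv ℝ v x₀)) +
        (S.comp (ContinuousLinearMap.inr ℝ E E)).flip (v x₀, 0)) x₀ :=
    hMr.clm_apply ((ContinuousLinearMap.inl ℝ E E).hasFDerivAt.comp x₀ hvd.hasFDerivAt)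
  -- Differentiating the implicit relation gives Dv(A) + S((0,A),(X,0)) = S((A,0),(0,X)), with S the
  -- second derivative of m. Symmetry of S turns this into the bracket of the two vector fields.
  have heq := (hprod.congr_of_eventuallyEq (hv.mono fun p hp => hp.symm)).unique (hL2 X)
  have h3 := DFunLike.congr_fun heq A
  have h4 := DFunLike.congr_fun h1 (fderiv ℝ v x₀ A)
  simp at h3 h4
  have h5 := DFunLike.congr_fun h2 X
  have h6 := DFunLike.congr_fun h2 A
  simp at h5 h6
  change fderiv ℝ v x₀ A =
    fderiv ℝ (fun p => fderiv ℝ m (p, x₀) (0, X)) x₀ (fderiv ℝ m (x₀, x₀) (0, A)) -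
      fderiv ℝ (fun p => fderiv ℝ m (p, x₀) (0, A)) x₀ (fderiv ℝ m (x₀, x₀) (0, X))
  rw [(hL2 X).fderiv, (hL2 A).fderiv, h5, h6]
  simp only [ContinuousLinearMap.flip_apply, ContinuousLinearMap.comp_apply,
    ContinuousLinearMap.inl_apply]
  rw [h4, hvx] at h3
  rw [hsymm (X, 0) (0, A)]
  exact eq_sub_of_add_eq h3

section Chart

variable {E : Type*} [NormedAddCommGroup E] [NormedSpace ℝ E]
  {G : Type*} [TopologicalSpace G] [ChartedSpace E G]

lemma hasFDerivAt_chart {V : Type*} [NormedAddCommGroup V] [NormedSpace ℝ V] {F : G → V}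
    {x : G} {L : E →L[ℝ] V} (hF : HasMFDerivAt 𝓘(ℝ, E) 𝓘(ℝ, V) F x L) :
    HasFDerivAt (F ∘ (extChartAt 𝓘(ℝ, E) x).symm) L (extChartAt 𝓘(ℝ, E) x x) := by
  have h : HasFDerivWithinAt (F ∘ (extChartAt 𝓘(ℝ, E) x).symm) L (Set.range 𝓘(ℝ, E))
    (extChartAt 𝓘(ℝ, E) x x) := hF.2
  rwa [modelWithCornersSelf_coe, Set.range_id, hasFDerivWithinAt_univ] at h

lemma mfderiv_eq_fderiv_chart {V : Type*} [NormedAddCommGroup V] [NormedSpace ℝ V] {F : G → V}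
    {x : G} (hF : MDifferentiableAt 𝓘(ℝ, E) 𝓘(ℝ, V) F x) :
    (mfderiv 𝓘(ℝ, E) 𝓘(ℝ, V) F x : E →L[ℝ] V) =
      fderiv ℝ (F ∘ (extChartAt 𝓘(ℝ, E) x).symm) (extChartAt 𝓘(ℝ, E) x x) :=
  (hasFDerivAt_chart hF.hasMFDerivAt).fderiv.symm

lemma mfderiv_comp_eq {E' E'' : Type*} [NormedAddCommGroup E'] [NormedSpace ℝ E']
    [NormedAddCommGroup E''] [NormedSpace ℝ E''] {M' M'' : Type*} [TopologicalSpace M']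
    [ChartedSpace E' M'] [TopologicalSpace M''] [ChartedSpace E'' M''] {g : M' → M''} {f : G → M'}
    {x : G} {y : M'} (hg : MDifferentiableAt 𝓘(ℝ, E') 𝓘(ℝ, E'') g y)
    (hf : MDifferentiableAt 𝓘(ℝ, E) 𝓘(ℝ, E') f x) (hy : f x = y) :
    (mfderiv 𝓘(ℝ, E) 𝓘(ℝ, E'') (g ∘ f) x : E →L[ℝ] E'') =
      ContinuousLinearMap.comp (mfderiv 𝓘(ℝ, E') 𝓘(ℝ, E'') g y : E' →L[ℝ] E'')
        (mfderiv 𝓘(ℝ, E) 𝓘(ℝ, E') f x : E →L[ℝ] E') := by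
  subst hy
  exact mfderiv_comp x hg hf

end Chart

section Group

variable {E : Type*} [NormedAddCommGroup E] [NormedSpace ℝ E]
  {G : Type*} [TopologicalSpace G] [ChartedSpace E G] [Group G] [LieGroup 𝓘(ℝ, E) ∞ G]

/-- The multiplication in the chart around the neutral element. -/
def chartMul (E G : Type*) [NormedAddCommGroup E] [NormedSpace ℝ E]
    [TopologicalSpace G] [ChartedSpace E G] [Group G] (q : E × E) : E :=
  extChartAt 𝓘(ℝ, E) (1 : G)
    ((extChartAt 𝓘(ℝ, E) (1 : G)).symm q.1 * (extChartAt 𝓘(ℝ, E) (1 : G)).symm q.2)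

variable (E G) in
/-- The neutral element in the chart around it. -/
abbrev chartOne : E := extChartAt 𝓘(ℝ, E) (1 : G) 1

lemma extChartAt_symm_chartOne : (extChartAt 𝓘(ℝ, E) (1 : G)).symm (chartOne E G) = 1 :=
  (extChartAt 𝓘(ℝ, E) (1 : G)).left_inv (mem_extChartAt_source 1)

lemma contDiffAt_chartMul {p q : E} (hp : p ∈ (extChartAt 𝓘(ℝ, E) (1 : G)).target)
    (hq : q ∈ (extChartAt 𝓘(ℝ, E) (1 : G)).target)
    (hpq : (extChartAt 𝓘(ℝ, E) (1 : G)).symm p * (extChartAt 𝓘(ℝ, E) (1 : G)).symm q ∈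
      (chartAt E (1 : G)).source) : ContDiffAt ℝ ∞ (chartMul E G) (p, q) := by
  have h1 : ContMDiffAt (𝓘(ℝ, E).prod 𝓘(ℝ, E)) 𝓘(ℝ, E) ∞
      (fun q : E × E => (extChartAt 𝓘(ℝ, E) (1 : G)).symm q.1) (p, q) :=
    ((contMDiffOn_extChartAt_symm (1 : G)).contMDiffAt
      ((isOpen_extChartAt_target (1 : G)).mem_nhds hp)).comp (p, q) contMDiffAt_fst
  have h2 : ContMDiffAt (𝓘(ℝ, E).prod 𝓘(ℝ, E)) 𝓘(ℝ, E) ∞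
      (fun q : E × E => (extChartAt 𝓘(ℝ, E) (1 : G)).symm q.2) (p, q) :=
    ((contMDiffOn_extChartAt_symm (1 : G)).contMDiffAt
      ((isOpen_extChartAt_target (1 : G)).mem_nhds hq)).comp (p, q) contMDiffAt_snd
  have h3 : ContMDiffAt (𝓘(ℝ, E).prod 𝓘(ℝ, E)) 𝓘(ℝ, E) ∞ (chartMul E G) (p, q) :=
    ContMDiffAt.comp (p, q) (contMDiffAt_extChartAt' hpq) (h1.mul h2)
  rw [← modelWithCornersSelf_prod, chartedSpaceSelf_prod] at h3
  exact h3.contDiffAt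

lemma mdifferentiable_mul_left (g : G) :
    MDifferentiable 𝓘(ℝ, E) 𝓘(ℝ, E) (fun x : G => g * x) :=
  (contMDiff_mul_left (n := ∞)).mdifferentiable (by simp)

lemma mdifferentiable_mul_right (g : G) :
    MDifferentiable 𝓘(ℝ, E) 𝓘(ℝ, E) (fun x : G => x * g) :=
  (contMDiff_mul_right (n := ∞)).mdifferentiable (by simp)

lemma mdifferentiable_conj (g : G) :
    MDifferentiable 𝓘(ℝ, E) 𝓘(ℝ, E) (fun x : G => g * x * g⁻¹) :=
  (mdifferentiable_mul_right g⁻¹).comp (mdifferentiable_mul_left g)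

lemma mfderiv_chart_mul_left {p : E} (hp : p ∈ (extChartAt 𝓘(ℝ, E) (1 : G)).target) (X : E) :
    (mfderiv 𝓘(ℝ, E) 𝓘(ℝ, E) (extChartAt 𝓘(ℝ, E) (1 : G) ∘
      fun x => (extChartAt 𝓘(ℝ, E) (1 : G)).symm p * x) (1 : G) : E →L[ℝ] E) X =
      fderiv ℝ (chartMul E G) (p, chartOne E G) (0, X) := by
  have hps : (extChartAt 𝓘(ℝ, E) (1 : G)).symm p ∈ (chartAt E (1 : G)).source := by
    rw [← extChartAt_source 𝓘(ℝ, E)]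
    exact (extChartAt 𝓘(ℝ, E) (1 : G)).map_target hp
  have hc := contDiffAt_chartMul (G := G) hp (mem_extChartAt_target (1 : G)) (by
    rw [extChartAt_symm_chartOne, mul_one]; exact hps)
  rw [mfderiv_eq_fderiv_chart]
  · have h1 : HasFDerivAt (fun y : E => (p, y)) (ContinuousLinearMap.inr ℝ E E) (chartOne E G) :=
      hasFDerivAt_prodMk_right p _
    have h2 := (hc.differentiableAt (by simp)).hasFDerivAt.comp (chartOne E G) h1
    have h3 := h2.fderiv
    rw [show (extChartAt 𝓘(ℝ, E) (1 : G) ∘ fun x => (extChartAt 𝓘(ℝ, E) (1 : G)).symm p * x) ∘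
      (extChartAt 𝓘(ℝ, E) (1 : G)).symm = chartMul E G ∘ fun y => (p, y) from rfl, h3]
    rfl
  · refine MDifferentiableAt.comp (1 : G) (mdifferentiableAt_extChartAt ?_)
      (mdifferentiable_mul_left _ _)
    rwa [mul_one]

lemma mfderiv_chart_mul_right {p : E} (hp : p ∈ (extChartAt 𝓘(ℝ, E) (1 : G)).target) (X : E) :
    (mfderiv 𝓘(ℝ, E) 𝓘(ℝ, E) (extChartAt 𝓘(ℝ, E) (1 : G) ∘
      fun x => x * (extChartAt 𝓘(ℝ, E) (1 : G)).symm p) (1 : G) : E →L[ℝ] E) X =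
      fderiv ℝ (chartMul E G) (chartOne E G, p) (X, 0) := by
  have hps : (extChartAt 𝓘(ℝ, E) (1 : G)).symm p ∈ (chartAt E (1 : G)).source := by
    rw [← extChartAt_source 𝓘(ℝ, E)]
    exact (extChartAt 𝓘(ℝ, E) (1 : G)).map_target hp
  have hc := contDiffAt_chartMul (G := G) (mem_extChartAt_target (1 : G)) hp (by
    rw [extChartAt_symm_chartOne, one_mul]; exact hps)
  rw [mfderiv_eq_fderiv_chart]
  · have h1 : HasFDerivAt (fun y : E => (y, p)) (ContinuousLinearMap.inl ℝ E E) (chartOne E G) :=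
      hasFDerivAt_prodMk_left _ p
    have h2 := (hc.differentiableAt (by simp)).hasFDerivAt.comp (chartOne E G) h1
    have h3 := h2.fderiv
    rw [show (extChartAt 𝓘(ℝ, E) (1 : G) ∘ fun x => x * (extChartAt 𝓘(ℝ, E) (1 : G)).symm p) ∘
      (extChartAt 𝓘(ℝ, E) (1 : G)).symm = chartMul E G ∘ fun y => (y, p) from rfl, h3]
    rfl
  · refine MDifferentiableAt.comp (1 : G) (mdifferentiableAt_extChartAt ?_)
      (mdifferentiable_mul_right _ _)
    rwa [one_mul]

lemma fderiv_chartMul_inl : (fderiv ℝ (chartMul E G) (chartOne E G, chartOne E G)).comp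
    (ContinuousLinearMap.inl ℝ E E) = .id ℝ E := by
  ext X
  have h := mfderiv_chart_mul_right (mem_extChartAt_target (I := 𝓘(ℝ, E)) (1 : G)) X
  rw [extChartAt_symm_chartOne] at h
  rw [show (extChartAt 𝓘(ℝ, E) (1 : G) ∘ fun x => x * 1) = extChartAt 𝓘(ℝ, E) (1 : G) by
    ext; simp] at h
  rw [ContinuousLinearMap.comp_apply, ContinuousLinearMap.inl_apply, ← h]
  exact DFunLike.congr_fun (mfderiv_extChartAt_self (I := 𝓘(ℝ, E)) (x := (1 : G))) X

lemma fderiv_chartMul_inr : (fderiv ℝ (chartMul E G) (chartOne E G, chartOne E G)).comp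
    (ContinuousLinearMap.inr ℝ E E) = .id ℝ E := by
  ext X
  have h := mfderiv_chart_mul_left (mem_extChartAt_target (I := 𝓘(ℝ, E)) (1 : G)) X
  rw [extChartAt_symm_chartOne] at h
  rw [show (extChartAt 𝓘(ℝ, E) (1 : G) ∘ fun x => 1 * x) = extChartAt 𝓘(ℝ, E) (1 : G) by
    ext; simp] at h
  rw [ContinuousLinearMap.comp_apply, ContinuousLinearMap.inr_apply, ← h]
  exact DFunLike.congr_fun (mfderiv_extChartAt_self (I := 𝓘(ℝ, E)) (x := (1 : G))) X

/-- This is the derivative at x = 1 of g x = (g x g⁻¹) g. It supplies the implicit relation from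
which Ad is differentiated. -/
lemma fderiv_chartMul_Ad {p : E} (hp : p ∈ (extChartAt 𝓘(ℝ, E) (1 : G)).target)
    (X : GroupLieAlgebra 𝓘(ℝ, E) G) :
    fderiv ℝ (chartMul E G) (chartOne E G, p)
      ((modelEquiv E G).symm (Ad ((extChartAt 𝓘(ℝ, E) (1 : G)).symm p) X), 0) =
    fderiv ℝ (chartMul E G) (p, chartOne E G) (0, (modelEquiv E G).symm X) := by
  have hps : (extChartAt 𝓘(ℝ, E) (1 : G)).symm p ∈ (chartAt E (1 : G)).source := by
    rw [← extChartAt_source 𝓘(ℝ, E)]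
    exact (extChartAt 𝓘(ℝ, E) (1 : G)).map_target hp
  rw [← mfderiv_chart_mul_left hp, ← mfderiv_chart_mul_right hp]
  set g := (extChartAt 𝓘(ℝ, E) (1 : G)).symm p
  have h1 : (extChartAt 𝓘(ℝ, E) (1 : G) ∘ fun x => g * x) =
      (extChartAt 𝓘(ℝ, E) (1 : G) ∘ fun x => x * g) ∘ fun x => g * x * g⁻¹ := by
    ext x
    simp
  rw [h1, mfderiv_comp_eq (y := 1) _ (mdifferentiable_conj g 1) (by simp)]
  · rfl
  · refine MDifferentiableAt.comp (1 : G) (mdifferentiableAt_extChartAt ?_)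
      (mdifferentiable_mul_right _ _)
    rwa [one_mul]

lemma mpullbackWithin_mulInvariantVectorField {p : E}
    (hp : p ∈ (extChartAt 𝓘(ℝ, E) (1 : G)).target) (X : GroupLieAlgebra 𝓘(ℝ, E) G) :
    (mpullbackWithin 𝓘(ℝ, E) 𝓘(ℝ, E) (extChartAt 𝓘(ℝ, E) (1 : G)).symm
      (mulInvariantVectorField X) (Set.range 𝓘(ℝ, E)) p : E) =
    fderiv ℝ (chartMul E G) (p, chartOne E G) (0, (modelEquiv E G).symm X) := by
  have hps : (extChartAt 𝓘(ℝ, E) (1 : G)).symm p ∈ (chartAt E (1 : G)).source := by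
    rw [← extChartAt_source 𝓘(ℝ, E)]
    exact (extChartAt 𝓘(ℝ, E) (1 : G)).map_target hp
  rw [← mfderiv_chart_mul_left hp, mpullbackWithin_apply]
  rw [mfderiv_comp_eq (y := (extChartAt 𝓘(ℝ, E) (1 : G)).symm p)
    (mdifferentiableAt_extChartAt hps) (mdifferentiable_mul_left _ _) (mul_one _)]
  rw [ContinuousLinearMap.inverse_eq
    (mfderivWithin_extChartAt_symm_comp_mfderiv_extChartAt hp)
    (mfderiv_extChartAt_comp_mfderivWithin_extChartAt_symm hp)]
  rfl

variable [CompleteSpace E]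

lemma lie_eq_lieBracket_chart (A X : GroupLieAlgebra 𝓘(ℝ, E) G) :
    (modelEquiv E G).symm ⁅A, X⁆ = lieBracket ℝ
      (fun p => fderiv ℝ (chartMul E G) (p, chartOne E G) (0, (modelEquiv E G).symm A))
      (fun p => fderiv ℝ (chartMul E G) (p, chartOne E G) (0, (modelEquiv E G).symm X))
      (chartOne E G) := by
  have hev : ∀ Y : GroupLieAlgebra 𝓘(ℝ, E) G,
      (mpullbackWithin 𝓘(ℝ, E) 𝓘(ℝ, E) (extChartAt 𝓘(ℝ, E) (1 : G)).symm
        (mulInvariantVectorField Y) (Set.range 𝓘(ℝ, E)) : E → E) =ᶠ[nhds (chartOne E G)]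
      fun p => fderiv ℝ (chartMul E G) (p, chartOne E G) (0, (modelEquiv E G).symm Y) := by
    intro Y
    filter_upwards [extChartAt_target_mem_nhds (I := 𝓘(ℝ, E)) (1 : G)] with p hp
    exact mpullbackWithin_mulInvariantVectorField hp Y
  -- The Lie bracket on 𝔤 unfolds to the bracket, in the chart at 1, of left-invariant fields; the
  -- differential of the chart at its own centre is the identity.
  have h1 : ⁅A, X⁆ = (mfderiv 𝓘(ℝ, E) 𝓘(ℝ, E) (extChartAt 𝓘(ℝ, E) (1 : G)) 1).inverse
      ((lieBracketWithin ℝ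
        (mpullbackWithin 𝓘(ℝ, E) 𝓘(ℝ, E) (extChartAt 𝓘(ℝ, E) (1 : G)).symm
          (mulInvariantVectorField A) (Set.range 𝓘(ℝ, E)))
        (mpullbackWithin 𝓘(ℝ, E) 𝓘(ℝ, E) (extChartAt 𝓘(ℝ, E) (1 : G)).symm
          (mulInvariantVectorField X) (Set.range 𝓘(ℝ, E)))
        ((extChartAt 𝓘(ℝ, E) (1 : G)).symm ⁻¹' Set.univ ∩ Set.range 𝓘(ℝ, E))) (chartOne E G)) := rfl
  have h2 : (mfderiv 𝓘(ℝ, E) 𝓘(ℝ, E) (extChartAt 𝓘(ℝ, E) (1 : G)) 1).inverse =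
      ContinuousLinearMap.id ℝ E := by
    rw [mfderiv_extChartAt_self]
    exact ContinuousLinearMap.inverse_id
  have h3 : ((extChartAt 𝓘(ℝ, E) (1 : G)).symm ⁻¹' Set.univ ∩ Set.range 𝓘(ℝ, E)) =
      Set.univ := by simp
  have h4 : ∀ V₁ V₂ : E → E, lieBracketWithin ℝ V₁ V₂
      ((extChartAt 𝓘(ℝ, E) (1 : G)).symm ⁻¹' Set.univ ∩ Set.range 𝓘(ℝ, E)) (chartOne E G) =
      lieBracket ℝ V₁ V₂ (chartOne E G) := fun V₁ V₂ => by
    rw [h3, lieBracketWithin_univ]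
  refine Eq.trans (congrArg (modelEquiv E G).symm h1) ?_
  refine Eq.trans (DFunLike.congr_fun h2 _) ?_
  exact (h4 _ _).trans ((hev A).lieBracket_vectorField_eq (hev X))

/-- The derivative of the adjoint action at the neutral element is given by the Lie bracket. -/
theorem mfderiv_Ad_one (X : GroupLieAlgebra 𝓘(ℝ, E) G) :
    MDifferentiableAt 𝓘(ℝ, E) 𝓘(ℝ, E) (fun g : G => (modelEquiv E G).symm (Ad g X)) 1 ∧
    ∀ A : GroupLieAlgebra 𝓘(ℝ, E) G,
      (mfderiv 𝓘(ℝ, E) 𝓘(ℝ, E) (fun g : G => (modelEquiv E G).symm (Ad g X)) 1 : E →L[ℝ] E)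
        ((modelEquiv E G).symm A) = (modelEquiv E G).symm ⁅A, X⁆ := by
  let v : E → E := fun p => (modelEquiv E G).symm (Ad ((extChartAt 𝓘(ℝ, E) (1 : G)).symm p) X)
  have hm : ContDiffAt ℝ ∞ (chartMul E G) (chartOne E G, chartOne E G) :=
    contDiffAt_chartMul (mem_extChartAt_target (1 : G)) (mem_extChartAt_target (1 : G)) (by
      rw [extChartAt_symm_chartOne, mul_one]
      exact mem_chart_source E (1 : G))
  obtain ⟨hd, hv⟩ := hasFDerivAt_of_localMul (v := v) (X := (modelEquiv E G).symm X) hm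
    fderiv_chartMul_inl fderiv_chartMul_inr (by
      filter_upwards [extChartAt_target_mem_nhds (I := 𝓘(ℝ, E)) (1 : G)] with p hp
      exact fderiv_chartMul_Ad hp X)
  have hmd : MDifferentiableAt 𝓘(ℝ, E) 𝓘(ℝ, E) (fun g : G => (modelEquiv E G).symm (Ad g X)) 1 := by
    have h1 : MDifferentiableAt 𝓘(ℝ, E) 𝓘(ℝ, E) (v ∘ extChartAt 𝓘(ℝ, E) (1 : G)) 1 :=
      hd.mdifferentiableAt.comp (1 : G) (mdifferentiableAt_extChartAt (mem_chart_source E (1 : G)))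
    refine h1.congr_of_eventuallyEq ?_
    filter_upwards [extChartAt_source_mem_nhds (I := 𝓘(ℝ, E)) (1 : G)] with g hg
    simp only [v, Function.comp_apply, (extChartAt 𝓘(ℝ, E) (1 : G)).left_inv hg]
  refine ⟨hmd, fun A => ?_⟩
  rw [mfderiv_eq_fderiv_chart hmd, lie_eq_lieBracket_chart, ← hv]
  rfl

end Group

/-! ### Derivatives along straight lines in a chart -/

section Curve

variable {E : Type*} [NormedAddCommGroup E] [NormedSpace ℝ E]
  {M : Type*} [TopologicalSpace M] [ChartedSpace E M]

/-- The curve through `x` which is a straight line with velocity `A` in the preferred chart. -/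
def chartCurve (x : M) (A : E) (t : ℝ) : M :=
  (extChartAt 𝓘(ℝ, E) x).symm (extChartAt 𝓘(ℝ, E) x x + t • A)

@[simp] lemma chartCurve_zero (x : M) (A : E) : chartCurve x A 0 = x := by
  simp [chartCurve]

lemma hasDerivAt_comp_chartCurve {V : Type*} [NormedAddCommGroup V] [NormedSpace ℝ V] {F : M → V}
    {x : M} (hF : MDifferentiableAt 𝓘(ℝ, E) 𝓘(ℝ, V) F x) (A : E) :
    HasDerivAt (fun t => F (chartCurve x A t))
      ((mfderiv 𝓘(ℝ, E) 𝓘(ℝ, V) F x : E →L[ℝ] V) A) 0 := by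
  have h3 : HasDerivAt (fun t : ℝ => extChartAt 𝓘(ℝ, E) x x + t • A) A 0 := by
    simpa using ((hasDerivAt_id (0 : ℝ)).smul_const A).const_add (extChartAt 𝓘(ℝ, E) x x)
  exact HasFDerivAt.comp_hasDerivAt_of_eq (0 : ℝ) (hasFDerivAt_chart hF.hasMFDerivAt) h3 (by simp)

lemma mfderiv_apply_eq_of_hasDerivAt {V : Type*} [NormedAddCommGroup V] [NormedSpace ℝ V]
    {F : M → V} {x : M} (hF : MDifferentiableAt 𝓘(ℝ, E) 𝓘(ℝ, V) F x) {A : E} {v : V}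
    (h : HasDerivAt (fun t => F (chartCurve x A t)) v 0) :
    (mfderiv 𝓘(ℝ, E) 𝓘(ℝ, V) F x : E →L[ℝ] V) A = v :=
  (hasDerivAt_comp_chartCurve hF A).unique h

lemma mfderiv_clm_comp {V V' : Type*} [NormedAddCommGroup V] [NormedSpace ℝ V]
    [NormedAddCommGroup V'] [NormedSpace ℝ V'] {F : M → V} {x : M}
    (hF : MDifferentiableAt 𝓘(ℝ, E) 𝓘(ℝ, V) F x) (T : V →L[ℝ] V') (A : E) :
    (mfderiv 𝓘(ℝ, E) 𝓘(ℝ, V') (fun y => T (F y)) x : E →L[ℝ] V') A =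
      T ((mfderiv 𝓘(ℝ, E) 𝓘(ℝ, V) F x : E →L[ℝ] V) A) := by
  refine mfderiv_apply_eq_of_hasDerivAt
    (T.differentiableAt.mdifferentiableAt.comp x hF) ?_
  exact T.hasFDerivAt.comp_hasDerivAt (0 : ℝ) (hasDerivAt_comp_chartCurve hF A)

end Curve

/-! ### Ad, subgroups and representations: compatibility with brackets -/

section Group

variable {E : Type*} [NormedAddCommGroup E] [NormedSpace ℝ E]
  {G : Type*} [TopologicalSpace G] [ChartedSpace E G] [Group G] [LieGroup 𝓘(ℝ, E) ∞ G]

lemma Ad_one : Ad (E := E) (1 : G) = .id ℝ _ := by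
  have : (fun x : G => 1 * x * 1⁻¹) = id := by ext; simp
  rw [Ad, this]
  exact mfderiv_id

lemma Ad_mul (g h : G) (X : GroupLieAlgebra 𝓘(ℝ, E) G) : Ad (g * h) X = Ad g (Ad h X) := by
  have h1 : (fun x : G => g * h * x * (g * h)⁻¹) =
      (fun x : G => g * x * g⁻¹) ∘ fun x : G => h * x * h⁻¹ := by
    ext x
    simp [mul_assoc]
  have h2 := mfderiv_comp_eq (E := E) (y := (1 : G)) (mdifferentiable_conj g 1)
    (mdifferentiable_conj h 1) (by simp)
  rw [← h1] at h2
  exact DFunLike.congr_fun h2 X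

lemma Ad_inv_Ad (g : G) (X : GroupLieAlgebra 𝓘(ℝ, E) G) : Ad g⁻¹ (Ad g X) = X := by
  rw [← Ad_mul, inv_mul_cancel, Ad_one]
  rfl

lemma Ad_Ad_inv (g : G) (X : GroupLieAlgebra 𝓘(ℝ, E) G) : Ad g (Ad g⁻¹ X) = X := by
  rw [← Ad_mul, mul_inv_cancel, Ad_one]
  rfl

section Bracket

variable [CompleteSpace E]

/-- Differentiate Ad(hkh⁻¹)Ad(h)X = Ad(h)Ad(k)X with respect to k at 1 in direction A. -/
lemma Ad_lie (h : G) (A X : GroupLieAlgebra 𝓘(ℝ, E) G) : Ad h ⁅A, X⁆ = ⁅Ad h A, Ad h X⁆ := by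
  let T : E →L[ℝ] E := Ad h
  have h1 : ((fun k : G => (modelEquiv E G).symm (Ad k (Ad h X))) ∘ fun k => h * k * h⁻¹) =
      fun k => T ((modelEquiv E G).symm (Ad k X)) := by
    ext k
    simp only [Function.comp_apply, ← Ad_mul]
    rw [inv_mul_cancel_right, Ad_mul]
    rfl
  have h2 := mfderiv_comp_eq (E := E) (y := (1 : G)) (mfderiv_Ad_one (Ad h X)).1
    (mdifferentiable_conj h 1) (by simp)
  rw [h1] at h2
  have h3 := mfderiv_clm_comp (mfderiv_Ad_one X).1 T ((modelEquiv E G).symm A)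
  have h4 := (mfderiv_Ad_one (Ad h X)).2 (Ad h A)
  rw [h2, (mfderiv_Ad_one X).2] at h3
  exact h3.symm.trans h4

variable (E) in
/-- The adjoint action by automorphisms of the Lie algebra. -/
def AdEquiv (g : G) : GroupLieAlgebra 𝓘(ℝ, E) G ≃ₗ⁅ℝ⁆ GroupLieAlgebra 𝓘(ℝ, E) G where
  toFun := Ad g
  map_add' := map_add _
  map_smul' := map_smul _
  map_lie' := Ad_lie g _ _
  invFun := Ad g⁻¹
  left_inv := Ad_inv_Ad g
  right_inv := Ad_Ad_inv g

@[simp] lemma AdEquiv_apply (g : G) (X : GroupLieAlgebra 𝓘(ℝ, E) G) : AdEquiv E g X = Ad g X :=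
  rfl

end Bracket

section Subgroup

variable {P : Subgroup G} {EP : Type*} [NormedAddCommGroup EP] [NormedSpace ℝ EP]
  [ChartedSpace EP P] [LieGroup 𝓘(ℝ, EP) ∞ P]

lemma lieIncl_Ad (hval : MDifferentiable 𝓘(ℝ, EP) 𝓘(ℝ, E) (Subtype.val : P → G)) (h : P)
    (A : GroupLieAlgebra 𝓘(ℝ, EP) P) :
    lieIncl (E := E) P (Ad h A) = Ad (E := E) (h : G) (lieIncl P A) := by
  have h1 : (Subtype.val : P → G) ∘ (fun k : P => h * k * h⁻¹) =
      (fun x : G => (h : G) * x * (h : G)⁻¹) ∘ (Subtype.val : P → G) := by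
    ext k
    simp
  have h2 := mfderiv_comp_eq (E := EP) (y := (1 : P)) (hval 1) (mdifferentiable_conj h 1) (by simp)
  have h3 := mfderiv_comp_eq (E := EP) (y := (1 : G)) (mdifferentiable_conj (E := E) (h : G) 1)
    (hval 1) (by simp)
  rw [h1, h3] at h2
  exact (DFunLike.congr_fun h2 A).symm

/-- The inclusion intertwines the adjoint actions of P and G; differentiating this relation in the
group variable yields the brackets. -/
lemma lieIncl_lie [CompleteSpace E] [CompleteSpace EP]
    (hval : MDifferentiable 𝓘(ℝ, EP) 𝓘(ℝ, E) (Subtype.val : P → G))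
    (A B : GroupLieAlgebra 𝓘(ℝ, EP) P) :
    lieIncl (E := E) P ⁅A, B⁆ = ⁅lieIncl (E := E) P A, lieIncl (E := E) P B⁆ := by
  let T : EP →L[ℝ] E := lieIncl (E := E) P
  have h1 : (fun k : P => T ((modelEquiv EP P).symm (Ad k B))) =
      (fun g : G => (modelEquiv E G).symm (Ad g (lieIncl P B))) ∘ (Subtype.val : P → G) := by
    ext k
    exact lieIncl_Ad hval k B
  have h2 := mfderiv_comp_eq (E := EP) (y := (1 : G)) (mfderiv_Ad_one (lieIncl (E := E) P B)).1
    (hval 1) (by simp)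
  have h3 := mfderiv_clm_comp (mfderiv_Ad_one B).1 T
    ((modelEquiv EP P).symm A)
  rw [(mfderiv_Ad_one B).2, h1, h2] at h3
  exact h3.symm.trans ((mfderiv_Ad_one (lieIncl (E := E) P B)).2 (lieIncl P A))

end Subgroup

section Representation

variable {𝒜 : Type*} [NormedRing 𝒜] [NormedAlgebra ℝ 𝒜]

/-- The derivative at `1` of a homomorphism into the units of a normed algebra. -/
def infHom (π : G →* 𝒜) : GroupLieAlgebra 𝓘(ℝ, E) G →L[ℝ] 𝒜 :=
  (NormedSpace.fromTangentSpace (𝕜 := ℝ) (π 1) : TangentSpace 𝓘(ℝ, 𝒜) (π 1) →L[ℝ] 𝒜).comp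
    (mfderiv 𝓘(ℝ, E) 𝓘(ℝ, 𝒜) π 1)

lemma infHom_Ad {π : G →* 𝒜} (hπ : MDifferentiable 𝓘(ℝ, E) 𝓘(ℝ, 𝒜) π) (h : G)
    (A : GroupLieAlgebra 𝓘(ℝ, E) G) : infHom π (Ad h A) * π h = π h * infHom π A := by
  let T : 𝒜 →L[ℝ] 𝒜 := ContinuousLinearMap.mulLeftRight ℝ 𝒜 (π h) (π h⁻¹)
  have h1 : π ∘ (fun k : G => h * k * h⁻¹) = fun k => T (π k) := by
    ext k
    simp [T]
  have h2 := mfderiv_comp_eq (E := E) (y := (1 : G)) (hπ 1) (mdifferentiable_conj h 1) (by simp)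
  have h3 := mfderiv_clm_comp (hπ 1) T ((modelEquiv E G).symm A)
  rw [← h1, h2] at h3
  have h4 : infHom π (Ad h A) = π h * infHom π A * π h⁻¹ := h3
  rw [h4, mul_assoc, ← map_mul, inv_mul_cancel, map_one, mul_one]

/-- Differentiate π'(Ad(k)B) π(k) = π(k) π'(B) at k = 1 along a curve with velocity A. -/
lemma infHom_lie [CompleteSpace E] {π : G →* 𝒜} (hπ : MDifferentiable 𝓘(ℝ, E) 𝓘(ℝ, 𝒜) π)
    (A B : GroupLieAlgebra 𝓘(ℝ, E) G) :
    infHom π ⁅A, B⁆ = infHom π A * infHom π B - infHom π B * infHom π A := by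
  have h1 := hasDerivAt_comp_chartCurve (mfderiv_Ad_one B).1 ((modelEquiv E G).symm A)
  rw [(mfderiv_Ad_one B).2] at h1
  let T : E →L[ℝ] 𝒜 := infHom π
  have h2 : HasDerivAt (fun t => infHom π (Ad (chartCurve (1 : G) ((modelEquiv E G).symm A) t) B))
      (infHom π ⁅A, B⁆) 0 :=
    T.hasFDerivAt.comp_hasDerivAt (0 : ℝ) h1
  have h3 : HasDerivAt (fun t => π (chartCurve (1 : G) ((modelEquiv E G).symm A) t))
      (infHom π A) 0 := hasDerivAt_comp_chartCurve (hπ 1) ((modelEquiv E G).symm A)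
  have h4 := h2.mul h3
  have h5 := h3.mul_const (infHom π B)
  have h6 := h4.unique (h5.congr_of_eventuallyEq (.of_forall fun t => infHom_Ad hπ _ B))
  simp only [chartCurve_zero, map_one, mul_one, Ad_one] at h6
  exact eq_sub_of_add_eq h6

end Representation

end Group

/-! ### Infinitesimal actions of the parabolic subgroup -/

section Action

variable {E : Type*} [NormedAddCommGroup E] [NormedSpace ℝ E] [FiniteDimensional ℝ E]
  {G : Type*} [TopologicalSpace G] [ChartedSpace E G] [Group G] [LieGroup 𝓘(ℝ, E) ∞ G]
  {P : Subgroup G} {EP : Type*} [NormedAddCommGroup EP] [NormedSpace ℝ EP] [FiniteDimensional ℝ EP]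
  [ChartedSpace EP P] [LieGroup 𝓘(ℝ, EP) ∞ P]

/-- The infinitesimal action of the Lie algebra of `P` on a real representation. -/
def infActionReal {W : Type*} [NormedAddCommGroup W] [NormedSpace ℝ W] (π : P →* (W →L[ℝ] W)) :
    GroupLieAlgebra 𝓘(ℝ, EP) P →ₗ[ℝ] Module.End ℝ W where
  toFun A := (infHom π A).toLinearMap
  map_add' A B := by rw [map_add]; rfl
  map_smul' c A := by rw [map_smul]; rfl

lemma infActionComplexified_apply {W : Type*} [NormedAddCommGroup W] [NormedSpace ℝ W]
    (π : P →* (W →L[ℝ] W)) (A : GroupLieAlgebra 𝓘(ℝ, EP) P) :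
    infActionComplexified π A = (infActionReal π A).baseChange ℂ :=
  rfl

lemma isInfinitesimalAction_infActionReal
    (hval : ContMDiff 𝓘(ℝ, EP) 𝓘(ℝ, E) ∞ (Subtype.val : P → G))
    (hinj : Function.Injective (lieIncl (E := E) (EP := EP) P))
    {W : Type*} [NormedAddCommGroup W] [NormedSpace ℝ W]
    {π : P →* (W →L[ℝ] W)} (hπ : ContMDiff 𝓘(ℝ, EP) 𝓘(ℝ, W →L[ℝ] W) ∞ π) :
    IsInfinitesimalAction (lieIncl (E := E) (EP := EP) P).toLinearMap
      (fun h : P => AdEquiv E (h : G)) (toRepresentation π) (infActionReal π) where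
  injective := hinj
  lie A B := ⟨⁅A, B⁆, lieIncl_lie (hval.mdifferentiable (by simp)) A B, fun w =>
    DFunLike.congr_fun (infHom_lie (hπ.mdifferentiable (by simp)) A B) w⟩
  ad_cancel h X := Ad_inv_Ad (h : G) X
  ad h A := ⟨Ad h A, lieIncl_Ad (hval.mdifferentiable (by simp)) h A, fun w =>
    DFunLike.congr_fun (infHom_Ad (hπ.mdifferentiable (by simp)) h A) w⟩

lemma isInfinitesimalAction_infAction
    (hval : ContMDiff 𝓘(ℝ, EP) 𝓘(ℝ, E) ∞ (Subtype.val : P → G))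
    (hinj : Function.Injective (lieIncl (E := E) (EP := EP) P))
    {W : Type*} [NormedAddCommGroup W] [NormedSpace ℂ W]
    {π : P →* (W →L[ℂ] W)} (hπ : ContMDiff 𝓘(ℝ, EP) 𝓘(ℝ, W →L[ℂ] W) ∞ π) :
    IsInfinitesimalAction (lieIncl (E := E) (EP := EP) P).toLinearMap
      (fun h : P => AdEquiv E (h : G)) (toRepresentation π) (infAction π) where
  injective := hinj
  lie A B := ⟨⁅A, B⁆, lieIncl_lie (hval.mdifferentiable (by simp)) A B, fun w =>
    DFunLike.congr_fun (infHom_lie (hπ.mdifferentiable (by simp)) A B) w⟩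
  ad_cancel h X := Ad_inv_Ad (h : G) X
  ad h A := ⟨Ad h A, lieIncl_Ad (hval.mdifferentiable (by simp)) h A, fun w =>
    DFunLike.congr_fun (infHom_Ad (hπ.mdifferentiable (by simp)) h A) w⟩

/-- Restricting scalars, as a real linear map. -/
def restrictScalarsRealL (W : Type*) [NormedAddCommGroup W] [NormedSpace ℂ W] :
    (W →L[ℂ] W) →L[ℝ] (W →L[ℝ] W) :=
  ContinuousLinearMap.restrictScalarsL ℂ W W ℝ ℝ

/-- Forgetting complex linearity is a continuous real linear map and commutes with differentiation.
It links the jets, which use the real form, to the complex action in which weights are taken. -/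
lemma infHom_realForm {W : Type*} [NormedAddCommGroup W] [NormedSpace ℂ W]
    {π : P →* (W →L[ℂ] W)} (hπ : ContMDiff 𝓘(ℝ, EP) 𝓘(ℝ, W →L[ℂ] W) ∞ π)
    (A : GroupLieAlgebra 𝓘(ℝ, EP) P) (w : W) :
    infHom (realForm π) A w = infAction π A w :=
  congrArg (fun T : W →L[ℝ] W => T w) (mfderiv_clm_comp (hπ.mdifferentiable (by simp) 1)
    (restrictScalarsRealL W) ((modelEquiv EP P).symm A))

lemma contMDiff_realForm {W : Type*} [NormedAddCommGroup W] [NormedSpace ℂ W]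
    {π : P →* (W →L[ℂ] W)} (hπ : ContMDiff 𝓘(ℝ, EP) 𝓘(ℝ, W →L[ℂ] W) ∞ π) :
    ContMDiff 𝓘(ℝ, EP) 𝓘(ℝ, W →L[ℝ] W) ∞ (realForm π) :=
  (restrictScalarsRealL W).contDiff.contMDiff.comp hπ

end Action

/-! ### First properties of the fundamental derivative -/

namespace CartanGeometry

variable {E : Type*} [NormedAddCommGroup E] [NormedSpace ℝ E]
  {G : Type*} [TopologicalSpace G] [ChartedSpace E G] [Group G]
  {P : Subgroup G} {EP : Type*} [NormedAddCommGroup EP] [NormedSpace ℝ EP] [ChartedSpace EP P]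
  {EM : Type*} [NormedAddCommGroup EM] [NormedSpace ℝ EM]
  {M : Type*} [TopologicalSpace M] [ChartedSpace EM M]
  {EB : Type*} [NormedAddCommGroup EB] [NormedSpace ℝ EB]
  {B : Type*} [TopologicalSpace B] [ChartedSpace EB B] [IsManifold 𝓘(ℝ, EB) ∞ B]
  (𝒢 : CartanGeometry (E := E) (EP := EP) (EM := EM) (EB := EB) P M B)

lemma contMDiff_act_left (u : B) :
    ContMDiff 𝓘(ℝ, EP) 𝓘(ℝ, EB) ∞ (fun h : P => 𝒢.act u h) :=
  𝒢.contMDiff_act.comp (contMDiff_const.prodMk contMDiff_id)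

lemma contMDiff_act_right (h : P) :
    ContMDiff 𝓘(ℝ, EB) 𝓘(ℝ, EB) ∞ (fun u : B => 𝒢.act u h) :=
  𝒢.contMDiff_act.comp (contMDiff_id.prodMk contMDiff_const)

lemma proj_act (u : B) (h : P) : 𝒢.proj (𝒢.act u h) = 𝒢.proj u := by
  obtain ⟨e, he, -, -, hact⟩ := 𝒢.locallyTrivial (𝒢.proj u)
  have hu : u ∈ e.source := e.mem_source.2 he
  obtain ⟨h1, h2⟩ := hact u hu h
  rw [← e.coe_fst h1, ← e.coe_fst hu, h2]

lemma contMDiff_proj : ContMDiff 𝓘(ℝ, EB) 𝓘(ℝ, EM) ∞ 𝒢.proj := by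
  intro u
  obtain ⟨e, he, hsm, -, -⟩ := 𝒢.locallyTrivial (𝒢.proj u)
  have hu : e.source ∈ nhds u := e.open_source.mem_nhds (e.mem_source.2 he)
  have h1 : ContMDiffAt 𝓘(ℝ, EB) 𝓘(ℝ, EM) ∞ (fun v => (e v).1) u :=
    contMDiffAt_fst.comp u (hsm.contMDiffAt hu)
  refine h1.congr_of_eventuallyEq ?_
  filter_upwards [hu] with v hv
  exact (e.coe_fst hv).symm

lemma conn_congr {u v : B} (h : u = v) (Z : EB) :
    (𝒢.conn u (Z : TangentSpace 𝓘(ℝ, EB) u) : GroupLieAlgebra 𝓘(ℝ, E) G) =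
      𝒢.conn v (Z : TangentSpace 𝓘(ℝ, EB) v) := by
  subst h
  rfl

/-- The inverse of the Cartan connection, with values in the model space. -/
def invConn (u : B) (X : GroupLieAlgebra 𝓘(ℝ, E) G) : EB := (𝒢.conn u).symm X

section Derivative

variable {V : Type*} [NormedAddCommGroup V] [NormedSpace ℝ V]

lemma fundamentalDerivative_eq (f : B → V) (u : B) {X : GroupLieAlgebra 𝓘(ℝ, E) G} {Z : EB}
    (hZ : 𝒢.conn u (Z : TangentSpace 𝓘(ℝ, EB) u) = X) :
    𝒢.fundamentalDerivative f u ((modelEquiv E G).symm X) =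
      (mfderiv 𝓘(ℝ, EB) 𝓘(ℝ, V) f u : EB →L[ℝ] V) Z := by
  have h : (𝒢.conn u).symm X = (Z : TangentSpace 𝓘(ℝ, EB) u) := by
    rw [← hZ]
    exact (𝒢.conn u).symm_apply_apply _
  exact congrArg (mfderiv 𝓘(ℝ, EB) 𝓘(ℝ, V) f u : EB →L[ℝ] V) h

/-- The fundamental derivative computed along a curve. -/
lemma hasDerivAt_fundamentalDerivative {f : B → V} {u : B}
    (hf : MDifferentiableAt 𝓘(ℝ, EB) 𝓘(ℝ, V) f u) (X : GroupLieAlgebra 𝓘(ℝ, E) G) :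
    HasDerivAt (fun t => f (chartCurve u (𝒢.invConn u X) t))
      (𝒢.fundamentalDerivative f u ((modelEquiv E G).symm X)) 0 :=
  hasDerivAt_comp_chartCurve hf _

lemma fundamentalDerivative_unique {f : B → V} {u : B}
    (hf : MDifferentiableAt 𝓘(ℝ, EB) 𝓘(ℝ, V) f u) {X : GroupLieAlgebra 𝓘(ℝ, E) G} {v : V}
    (h : HasDerivAt (fun t => f (chartCurve u (𝒢.invConn u X) t)) v 0) :
    𝒢.fundamentalDerivative f u ((modelEquiv E G).symm X) = v :=
  (𝒢.hasDerivAt_fundamentalDerivative hf X).unique h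

/-- The derivative of the orbit map h ↦ u·h along A is mapped by ω to the image of A in 𝔤, so the
chain rule reduces vertical derivatives to derivatives along P. -/
lemma fundamentalDerivative_vertical {f : B → V} {u : B}
    (hf : MDifferentiableAt 𝓘(ℝ, EB) 𝓘(ℝ, V) f u) (A : GroupLieAlgebra 𝓘(ℝ, EP) P) :
    MDifferentiableAt 𝓘(ℝ, EP) 𝓘(ℝ, V) (fun h : P => f (𝒢.act u h)) 1 ∧
    𝒢.fundamentalDerivative f u ((modelEquiv E G).symm (lieIncl P A)) =
      (mfderiv 𝓘(ℝ, EP) 𝓘(ℝ, V) (fun h : P => f (𝒢.act u h)) 1 : EP →L[ℝ] V)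
        ((modelEquiv EP P).symm A) := by
  have hact := ((𝒢.contMDiff_act_left u).mdifferentiable (by simp)) 1
  have h1 := (𝒢.conn_congr (𝒢.act_one u) _).symm.trans (𝒢.reproduces u A)
  rw [𝒢.fundamentalDerivative_eq f u h1]
  have h2 := mfderiv_comp_eq (E := EP) hf hact (𝒢.act_one u)
  have hf' : MDifferentiableAt 𝓘(ℝ, EB) 𝓘(ℝ, V) f (𝒢.act u 1) := by rwa [𝒢.act_one]
  exact ⟨hf'.comp (1 : P) hact, (DFunLike.congr_fun h2 _).symm⟩

lemma hasDerivAt_vertical {f : B → V} {u : B}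
    (hf : MDifferentiableAt 𝓘(ℝ, EB) 𝓘(ℝ, V) f u) (A : GroupLieAlgebra 𝓘(ℝ, EP) P) :
    HasDerivAt (fun t => f (𝒢.act u (chartCurve (1 : P) ((modelEquiv EP P).symm A) t)))
      (𝒢.fundamentalDerivative f u ((modelEquiv E G).symm (lieIncl P A))) 0 := by
  obtain ⟨h1, h2⟩ := 𝒢.fundamentalDerivative_vertical hf A
  rw [h2]
  exact hasDerivAt_comp_chartCurve (F := fun h : P => f (𝒢.act u h)) h1 _

lemma fundamentalDerivative_vertical_eq_zero {f : B → V}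
    (hf : MDifferentiable 𝓘(ℝ, EB) 𝓘(ℝ, V) f) (hinv : ∀ u h, f (𝒢.act u h) = f u) (u : B)
    (A : GroupLieAlgebra 𝓘(ℝ, EP) P) :
    𝒢.fundamentalDerivative f u ((modelEquiv E G).symm (lieIncl P A)) = 0 := by
  have h := 𝒢.hasDerivAt_vertical (hf u) A
  simp only [hinv] at h
  exact h.unique (hasDerivAt_const 0 _)

/-- By equivariance of ω, right translation by h carries ω_u⁻¹(Ad(h)X) to the vector at u·h on which
ω takes the value X. -/
lemma fundamentalDerivative_act [LieGroup 𝓘(ℝ, E) ∞ G] {f : B → V}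
    (hf : MDifferentiable 𝓘(ℝ, EB) 𝓘(ℝ, V) f)
    {h : P} {T : V →L[ℝ] V} (hT : ∀ u, f (𝒢.act u h) = T (f u)) (u : B)
    (X : GroupLieAlgebra 𝓘(ℝ, E) G) :
    𝒢.fundamentalDerivative f (𝒢.act u h) ((modelEquiv E G).symm X) =
      T (𝒢.fundamentalDerivative f u ((modelEquiv E G).symm (Ad (h : G) X))) := by
  have hact := ((𝒢.contMDiff_act_right h).mdifferentiable (by simp)) u
  have h1 := 𝒢.equivariant u h ((𝒢.conn u).symm (Ad (h : G) X))
  rw [ContinuousLinearEquiv.apply_symm_apply, Ad_inv_Ad] at h1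
  have h2 := mfderiv_clm_comp (hf u) T (𝒢.invConn u (Ad (h : G) X))
  rw [show (fun v => T (f v)) = f ∘ fun v => 𝒢.act v h from funext fun v => (hT v).symm] at h2
  have h3 := DFunLike.congr_fun (mfderiv_comp_eq (E := EB) (hf _) hact rfl)
    (𝒢.invConn u (Ad (h : G) X))
  exact (𝒢.fundamentalDerivative_eq f _ h1).trans (h3.symm.trans h2)

lemma fundamentalDerivative_add {f g : B → V} (hf : MDifferentiable 𝓘(ℝ, EB) 𝓘(ℝ, V) f)
    (hg : MDifferentiable 𝓘(ℝ, EB) 𝓘(ℝ, V) g) :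
    𝒢.fundamentalDerivative (f + g) = 𝒢.fundamentalDerivative f + 𝒢.fundamentalDerivative g := by
  ext u X
  exact 𝒢.fundamentalDerivative_unique (X := modelEquiv E G X) ((hf u).add (hg u))
    ((𝒢.hasDerivAt_fundamentalDerivative (hf u) _).add
      (𝒢.hasDerivAt_fundamentalDerivative (hg u) _))

/-- The product rule. -/
lemma fundamentalDerivative_smul {g : B → ℝ} {f : B → V}
    (hg : MDifferentiable 𝓘(ℝ, EB) 𝓘(ℝ, ℝ) g) (hf : MDifferentiable 𝓘(ℝ, EB) 𝓘(ℝ, V) f)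
    (u : B) (X : E) :
    𝒢.fundamentalDerivative (fun v => g v • f v) u X =
      g u • 𝒢.fundamentalDerivative f u X + 𝒢.fundamentalDerivative g u X • f u := by
  have h := (𝒢.hasDerivAt_fundamentalDerivative (hg u) (modelEquiv E G X)).smul
    (𝒢.hasDerivAt_fundamentalDerivative (hf u) (modelEquiv E G X))
  simp only [chartCurve_zero] at h
  exact 𝒢.fundamentalDerivative_unique (X := modelEquiv E G X) ((hg u).smul (hf u)) h

lemma fundamentalDerivative_clm {V' : Type*} [NormedAddCommGroup V'] [NormedSpace ℝ V'] {f : B → V}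
    (hf : MDifferentiable 𝓘(ℝ, EB) 𝓘(ℝ, V) f) (T : V →L[ℝ] V') (u : B) (X : E) :
    𝒢.fundamentalDerivative (fun v => T (f v)) u X = T (𝒢.fundamentalDerivative f u X) :=
  mfderiv_clm_comp (hf u) T _

end Derivative

end CartanGeometry

/-! ### Smoothness of the fundamental derivative -/

section TangentBundle

variable {EB : Type*} [NormedAddCommGroup EB] [NormedSpace ℝ EB]
  {B : Type*} [TopologicalSpace B] [ChartedSpace EB B]

lemma contMDiffAt_clm_of_apply {V V' : Type*} [NormedAddCommGroup V]
    [NormedSpace ℝ V] [FiniteDimensional ℝ V] [NormedAddCommGroup V'] [NormedSpace ℝ V']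
    {F : B → V →L[ℝ] V'} {u : B}
    (h : ∀ Z, ContMDiffAt 𝓘(ℝ, EB) 𝓘(ℝ, V') ∞ (fun v => F v Z) u) :
    ContMDiffAt 𝓘(ℝ, EB) 𝓘(ℝ, V →L[ℝ] V') ∞ F u := by
  let b := Module.finBasis ℝ V
  have hF : F = fun v => ∑ i, ContinuousLinearMap.smulRightL ℝ V V'
      (LinearMap.toContinuousLinearMap (b.coord i)) (F v (b i)) := by
    ext v Z
    conv_lhs => rw [← b.sum_repr Z, map_sum]
    simp
  rw [hF]
  refine ContMDiffAt.sum fun i _ => ?_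
  exact (ContinuousLinearMap.contDiff _).contMDiff.contMDiffAt.comp u (h (b i))

variable [IsManifold 𝓘(ℝ, EB) ∞ B]

/-- The vector field near `u₀` which is constant in the preferred trivialization at `u₀`. -/
lemma contMDiffAt_trivializationAt_symm (u₀ : B) (Z : EB) :
    ContMDiffAt 𝓘(ℝ, EB) 𝓘(ℝ, EB).tangent ∞ (fun u : B => (⟨u,
      (trivializationAt EB (TangentSpace 𝓘(ℝ, EB) : B → Type _) u₀).symmL ℝ u Z⟩ :
        TangentBundle 𝓘(ℝ, EB) B)) u₀ := by
  set e := trivializationAt EB (TangentSpace 𝓘(ℝ, EB) : B → Type _) u₀ with he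
  have hb : e.baseSet ∈ nhds u₀ :=
    e.open_baseSet.mem_nhds (FiberBundle.mem_baseSet_trivializationAt' u₀)
  have h1 : ContMDiffAt 𝓘(ℝ, EB) (𝓘(ℝ, EB).prod 𝓘(ℝ, EB)) ∞ (fun u : B => (u, Z)) u₀ :=
    contMDiffAt_id.prodMk contMDiffAt_const
  have h2 : e.target ∈ nhds (u₀, Z) :=
    e.open_target.mem_nhds (e.mem_target.2 (mem_of_mem_nhds hb))
  have h3 : ContMDiffAt (𝓘(ℝ, EB).prod 𝓘(ℝ, EB)) 𝓘(ℝ, EB).tangent ∞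
      e.toOpenPartialHomeomorph.symm (u₀, Z) :=
    (e.contMDiffOn_symm (IB := 𝓘(ℝ, EB)) (n := ∞)).contMDiffAt h2
  refine (h3.comp u₀ h1).congr_of_eventuallyEq ?_
  filter_upwards [hb] with u hu
  exact (congrArg (Bundle.TotalSpace.mk u) (e.symmL_apply hu Z)).trans (e.mk_symm hu Z)

lemma contMDiffAt_mfderiv_trivializationAt_symm {V : Type*} [NormedAddCommGroup V]
    [NormedSpace ℝ V] {f : B → V} (hf : ContMDiff 𝓘(ℝ, EB) 𝓘(ℝ, V) ∞ f) (u₀ : B) (Z : EB) :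
    ContMDiffAt 𝓘(ℝ, EB) 𝓘(ℝ, V) ∞ (fun u : B => (mfderiv 𝓘(ℝ, EB) 𝓘(ℝ, V) f u : EB →L[ℝ] V)
      ((trivializationAt EB (TangentSpace 𝓘(ℝ, EB) : B → Type _) u₀).symmL ℝ u Z)) u₀ :=
  ((contMDiff_snd_tangentBundle_modelSpace V 𝓘(ℝ, V)).comp
    (hf.contMDiff_tangentMap (m := ∞) (by simp))).contMDiffAt.comp u₀
      (contMDiffAt_trivializationAt_symm u₀ Z)

end TangentBundle

namespace CartanGeometry

variable {E : Type*} [NormedAddCommGroup E] [NormedSpace ℝ E]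
  {G : Type*} [TopologicalSpace G] [ChartedSpace E G] [Group G]
  {P : Subgroup G} {EP : Type*} [NormedAddCommGroup EP] [NormedSpace ℝ EP] [ChartedSpace EP P]
  {EM : Type*} [NormedAddCommGroup EM] [NormedSpace ℝ EM]
  {M : Type*} [TopologicalSpace M] [ChartedSpace EM M]
  {EB : Type*} [NormedAddCommGroup EB] [NormedSpace ℝ EB] [FiniteDimensional ℝ EB]
  {B : Type*} [TopologicalSpace B] [ChartedSpace EB B] [IsManifold 𝓘(ℝ, EB) ∞ B]
  (𝒢 : CartanGeometry (E := E) (EP := EP) (EM := EM) (EB := EB) P M B)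

/-- The fundamental derivative of a smooth function is smooth. -/
theorem contMDiff_fundamentalDerivative {V : Type*} [NormedAddCommGroup V] [NormedSpace ℝ V]
    {f : B → V} (hf : ContMDiff 𝓘(ℝ, EB) 𝓘(ℝ, V) ∞ f) :
    ContMDiff 𝓘(ℝ, EB) 𝓘(ℝ, E →L[ℝ] V) ∞ (𝒢.fundamentalDerivative f) := by
  intro u₀
  set e := trivializationAt EB (TangentSpace 𝓘(ℝ, EB) : B → Type _) u₀ with he
  have hb : e.baseSet ∈ nhds u₀ :=
    e.open_baseSet.mem_nhds (FiberBundle.mem_baseSet_trivializationAt' u₀)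
  -- In the local frame s of the tangent bundle put Φ = df∘s and Ω = ω∘s. Then Df = Φ∘Ω⁻¹, both
  -- factors are smooth, and inversion of continuous linear isomorphisms is smooth.
  let Φ : B → EB →L[ℝ] V := fun u =>
    ContinuousLinearMap.comp (mfderiv 𝓘(ℝ, EB) 𝓘(ℝ, V) f u : EB →L[ℝ] V) (e.symmL ℝ u : EB →L[ℝ] EB)
  have hΦ : ContMDiffAt 𝓘(ℝ, EB) 𝓘(ℝ, EB →L[ℝ] V) ∞ Φ u₀ :=
    contMDiffAt_clm_of_apply fun Z => contMDiffAt_mfderiv_trivializationAt_symm hf u₀ Z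
  let κ : B → EB ≃L[ℝ] E := fun u => 𝒢.conn u
  let Ω : B → EB →L[ℝ] E := fun u =>
    ContinuousLinearMap.comp (κ u : EB →L[ℝ] E) (e.symmL ℝ u : EB →L[ℝ] EB)
  have hΩ : ContMDiffAt 𝓘(ℝ, EB) 𝓘(ℝ, EB →L[ℝ] E) ∞ Ω u₀ :=
    contMDiffAt_clm_of_apply fun Z =>
      𝒢.contMDiff_conn.contMDiffAt.comp u₀ (contMDiffAt_trivializationAt_symm u₀ Z)
  have hequiv : ∀ u ∈ e.baseSet, ∃ s : EB ≃L[ℝ] EB, (s : EB →L[ℝ] EB) = e.symmL ℝ u :=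
    fun u hu => ⟨(e.continuousLinearEquivAt ℝ u hu).symm, e.symm_continuousLinearEquivAt_eq' hu⟩
  have hinv : ContMDiffAt 𝓘(ℝ, EB) 𝓘(ℝ, E →L[ℝ] EB) ∞ (fun u => (Ω u).inverse) u₀ := by
    obtain ⟨s, hs⟩ := hequiv u₀ (mem_of_mem_nhds hb)
    have h1 : Ω u₀ = ((s.trans (κ u₀) : EB ≃L[ℝ] E) : EB →L[ℝ] E) :=
      congrArg (ContinuousLinearMap.comp (κ u₀ : EB →L[ℝ] E)) hs.symm
    have h2 : ContDiffAt ℝ ∞ ContinuousLinearMap.inverse (Ω u₀) := by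
      rw [h1]
      exact contDiffAt_map_inverse _
    exact h2.contMDiffAt.comp u₀ hΩ
  refine (hΦ.clm_comp hinv).congr_of_eventuallyEq ?_
  filter_upwards [hb] with u hu
  obtain ⟨s, hs⟩ := hequiv u hu
  have h1 : Ω u = ((s.trans (κ u) : EB ≃L[ℝ] E) : EB →L[ℝ] E) :=
    congrArg (ContinuousLinearMap.comp (κ u : EB →L[ℝ] E)) hs.symm
  let T : EB →L[ℝ] V := mfderiv 𝓘(ℝ, EB) 𝓘(ℝ, V) f u
  have h2 : Φ u = T.comp (s : EB →L[ℝ] EB) :=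
    congrArg (fun S : EB →L[ℝ] EB => T.comp S) hs.symm
  rw [h1, h2, ContinuousLinearMap.inverse_equiv]
  ext X
  change _ = T (s (s.symm ((κ u).symm X)))
  rw [s.apply_symm_apply]
  rfl

end CartanGeometry

/-! ### The second fundamental derivative and the curved Casimir operator -/

namespace CartanGeometry

variable {E : Type*} [NormedAddCommGroup E] [NormedSpace ℝ E]
  {G : Type*} [TopologicalSpace G] [ChartedSpace E G] [Group G]
  {P : Subgroup G} {EP : Type*} [NormedAddCommGroup EP] [NormedSpace ℝ EP] [ChartedSpace EP P]
  {EM : Type*} [NormedAddCommGroup EM] [NormedSpace ℝ EM]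
  {M : Type*} [TopologicalSpace M] [ChartedSpace EM M]
  {EB : Type*} [NormedAddCommGroup EB] [NormedSpace ℝ EB] [FiniteDimensional ℝ EB]
  {B : Type*} [TopologicalSpace B] [ChartedSpace EB B] [IsManifold 𝓘(ℝ, EB) ∞ B]
  (𝒢 : CartanGeometry (E := E) (EP := EP) (EM := EM) (EB := EB) P M B)

section

variable {V : Type*} [NormedAddCommGroup V] [NormedSpace ℝ V]

/-- The value of `Df` at a point, as a linear map on the Lie algebra. -/
def derivAt (f : B → V) (u : B) : GroupLieAlgebra 𝓘(ℝ, E) G →ₗ[ℝ] V :=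
  (𝒢.fundamentalDerivative f u).toLinearMap ∘ₗ (modelEquiv E G).symm.toLinearEquiv.toLinearMap

/-- The value of `D²f` at a point, as a bilinear map on the Lie algebra. -/
def hessAt (f : B → V) (u : B) :
    GroupLieAlgebra 𝓘(ℝ, E) G →ₗ[ℝ] GroupLieAlgebra 𝓘(ℝ, E) G →ₗ[ℝ] V :=
  LinearMap.mk₂ ℝ (fun X Y => 𝒢.fundamentalDerivative (𝒢.fundamentalDerivative f) u
    ((modelEquiv E G).symm X) ((modelEquiv E G).symm Y)) (by simp) (by simp) (by simp) (by simp)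

lemma derivAt_apply (f : B → V) (u : B) (X : GroupLieAlgebra 𝓘(ℝ, E) G) :
    𝒢.derivAt f u X = 𝒢.fundamentalDerivative f u ((modelEquiv E G).symm X) :=
  rfl

lemma hessAt_apply (f : B → V) (u : B) (X Y : GroupLieAlgebra 𝓘(ℝ, E) G) :
    𝒢.hessAt f u X Y = 𝒢.fundamentalDerivative (𝒢.fundamentalDerivative f) u
      ((modelEquiv E G).symm X) ((modelEquiv E G).symm Y) :=
  rfl

lemma curvedCasimir_eq [FiniteDimensional ℝ E] [LieGroup 𝓘(ℝ, E) ∞ G]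
    [IsKilling ℝ (GroupLieAlgebra 𝓘(ℝ, E) G)] (f : B → V) (u : B) :
    𝒢.curvedCasimir f u = killingContraction (𝒢.hessAt f u) :=
  rfl

lemma mdifferentiable_fundamentalDerivative {f : B → V} (hf : ContMDiff 𝓘(ℝ, EB) 𝓘(ℝ, V) ∞ f) :
    MDifferentiable 𝓘(ℝ, EB) 𝓘(ℝ, E →L[ℝ] V) (𝒢.fundamentalDerivative f) :=
  (𝒢.contMDiff_fundamentalDerivative hf).mdifferentiable (by simp)

lemma fundamentalDerivative_apply_const {f : B → V} (hf : ContMDiff 𝓘(ℝ, EB) 𝓘(ℝ, V) ∞ f)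
    (Y : E) (u : B) (X : E) :
    𝒢.fundamentalDerivative (fun v => 𝒢.fundamentalDerivative f v Y) u X =
      𝒢.fundamentalDerivative (𝒢.fundamentalDerivative f) u X Y :=
  𝒢.fundamentalDerivative_clm (𝒢.mdifferentiable_fundamentalDerivative hf)
    (ContinuousLinearMap.apply ℝ V Y) u X

lemma contMDiff_fundamentalDerivative_apply {f : B → V} (hf : ContMDiff 𝓘(ℝ, EB) 𝓘(ℝ, V) ∞ f)
    (Y : E) : ContMDiff 𝓘(ℝ, EB) 𝓘(ℝ, V) ∞ (fun v => 𝒢.fundamentalDerivative f v Y) :=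
  (ContinuousLinearMap.apply ℝ V Y).contDiff.contMDiff.comp (𝒢.contMDiff_fundamentalDerivative hf)

lemma hessAt_add {f g : B → V} (hf : ContMDiff 𝓘(ℝ, EB) 𝓘(ℝ, V) ∞ f)
    (hg : ContMDiff 𝓘(ℝ, EB) 𝓘(ℝ, V) ∞ g) (u : B) :
    𝒢.hessAt (f + g) u = 𝒢.hessAt f u + 𝒢.hessAt g u := by
  ext X Y
  rw [hessAt_apply, 𝒢.fundamentalDerivative_add (hf.mdifferentiable (by simp))
    (hg.mdifferentiable (by simp)), 𝒢.fundamentalDerivative_add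
    (𝒢.mdifferentiable_fundamentalDerivative hf) (𝒢.mdifferentiable_fundamentalDerivative hg)]
  rfl

lemma hessAt_const_smul {f : B → V} (hf : ContMDiff 𝓘(ℝ, EB) 𝓘(ℝ, V) ∞ f) (c : ℝ) (u : B) :
    𝒢.hessAt (c • f) u = c • 𝒢.hessAt f u := by
  have h1 : 𝒢.fundamentalDerivative (c • f) = fun v => (c • ContinuousLinearMap.id ℝ (E →L[ℝ] V))
      (𝒢.fundamentalDerivative f v) := by
    ext v X
    exact 𝒢.fundamentalDerivative_clm (hf.mdifferentiable (by simp))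
      (c • ContinuousLinearMap.id ℝ V) v X
  ext X Y
  rw [hessAt_apply, h1,
    𝒢.fundamentalDerivative_clm (𝒢.mdifferentiable_fundamentalDerivative hf)]
  rfl

/-- The product rule for the second fundamental derivative. -/
lemma hessAt_smul {g : B → ℝ} {f : B → V} (hg : ContMDiff 𝓘(ℝ, EB) 𝓘(ℝ, ℝ) ∞ g)
    (hf : ContMDiff 𝓘(ℝ, EB) 𝓘(ℝ, V) ∞ f) (u : B) (X Y : GroupLieAlgebra 𝓘(ℝ, E) G) :
    𝒢.hessAt (fun v => g v • f v) u X Y =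
      g u • 𝒢.hessAt f u X Y + 𝒢.derivAt g u X • 𝒢.derivAt f u Y +
        (𝒢.derivAt g u Y • 𝒢.derivAt f u X + 𝒢.hessAt g u X Y • f u) := by
  have hg' := hg.mdifferentiable (by simp)
  have hf' := hf.mdifferentiable (by simp)
  have hgY := (𝒢.contMDiff_fundamentalDerivative_apply hg ((modelEquiv E G).symm Y)).mdifferentiable
    (by simp)
  have hfY := (𝒢.contMDiff_fundamentalDerivative_apply hf ((modelEquiv E G).symm Y)).mdifferentiable
    (by simp)
  have hgf : ContMDiff 𝓘(ℝ, EB) 𝓘(ℝ, V) ∞ (fun v => g v • f v) := hg.smul hf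
  have h1 : (fun v => 𝒢.fundamentalDerivative (fun v => g v • f v) v ((modelEquiv E G).symm Y)) =
      (fun v => g v • 𝒢.fundamentalDerivative f v ((modelEquiv E G).symm Y)) +
        fun v => 𝒢.fundamentalDerivative g v ((modelEquiv E G).symm Y) • f v :=
    funext fun v => 𝒢.fundamentalDerivative_smul hg' hf' v _
  have h2 := 𝒢.fundamentalDerivative_add (hg'.smul hfY) (hgY.smul hf')
  rw [hessAt_apply, ← 𝒢.fundamentalDerivative_apply_const hgf, h1]
  refine (congrArg (fun D : B → E →L[ℝ] V => D u ((modelEquiv E G).symm X)) h2).trans ?_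
  refine (congrArg₂ (· + ·) (𝒢.fundamentalDerivative_smul hg' hfY u _)
    (𝒢.fundamentalDerivative_smul hgY hf' u _)).trans ?_
  rw [𝒢.fundamentalDerivative_apply_const hf,
    𝒢.fundamentalDerivative_apply_const hg]
  rfl

lemma hessAt_act [LieGroup 𝓘(ℝ, E) ∞ G] {f : B → V} (hf : ContMDiff 𝓘(ℝ, EB) 𝓘(ℝ, V) ∞ f)
    {h : P} {T : V →L[ℝ] V} (hT : ∀ u, f (𝒢.act u h) = T (f u)) (u : B)
    (X Y : GroupLieAlgebra 𝓘(ℝ, E) G) :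
    𝒢.hessAt f (𝒢.act u h) X Y = T (𝒢.hessAt f u (Ad (h : G) X) (Ad (h : G) Y)) := by
  -- Df is again equivariant, for the operator S: φ ↦ T ∘ φ ∘ Ad(h), so the first order rule can be
  -- applied a second time.
  let S : (E →L[ℝ] V) →L[ℝ] (E →L[ℝ] V) :=
    (ContinuousLinearMap.compL ℝ E V V T).comp
      ((ContinuousLinearMap.compL ℝ E E V).flip (Ad (h : G) : E →L[ℝ] E))
  have hS : ∀ u, 𝒢.fundamentalDerivative f (𝒢.act u h) = S (𝒢.fundamentalDerivative f u) := by
    intro u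
    ext X
    exact 𝒢.fundamentalDerivative_act (hf.mdifferentiable (by simp)) hT u (modelEquiv E G X)
  exact DFunLike.congr_fun (𝒢.fundamentalDerivative_act
    (𝒢.mdifferentiable_fundamentalDerivative hf) hS u X) ((modelEquiv E G).symm Y)

section Casimir

variable [FiniteDimensional ℝ E] [LieGroup 𝓘(ℝ, E) ∞ G]
  [IsKilling ℝ (GroupLieAlgebra 𝓘(ℝ, E) G)]

lemma contMDiff_curvedCasimir {f : B → V} (hf : ContMDiff 𝓘(ℝ, EB) 𝓘(ℝ, V) ∞ f) :
    ContMDiff 𝓘(ℝ, EB) 𝓘(ℝ, V) ∞ (𝒢.curvedCasimir f) := by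
  refine contMDiff_finsetSum fun l _ => ?_
  exact (ContinuousLinearMap.apply ℝ V _).contDiff.contMDiff.comp
    (𝒢.contMDiff_fundamentalDerivative_apply (𝒢.contMDiff_fundamentalDerivative hf) _)

/-- Translation by h changes both arguments of D²f by Ad(h), an isometry of the Killing form, and
therefore leaves only T after contraction. -/
lemma curvedCasimir_act {f : B → V} (hf : ContMDiff 𝓘(ℝ, EB) 𝓘(ℝ, V) ∞ f)
    {h : P} {T : V →L[ℝ] V} (hT : ∀ u, f (𝒢.act u h) = T (f u)) (u : B) :
    𝒢.curvedCasimir f (𝒢.act u h) = T (𝒢.curvedCasimir f u) := by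
  have h1 : 𝒢.hessAt f (𝒢.act u h) = ((𝒢.hessAt f u).compl₁₂
      (AdEquiv E (h : G)).toLinearEquiv.toLinearMap
      (AdEquiv E (h : G)).toLinearEquiv.toLinearMap).compr₂ T.toLinearMap := by
    ext X Y
    exact 𝒢.hessAt_act hf hT u X Y
  rw [curvedCasimir_eq, h1, killingContraction_map, killingContraction_compl₁₂]
  · rfl
  · exact fun x y => LieAlgebra.killingForm_of_equiv_apply (AdEquiv E (h : G)) x y

lemma curvedCasimir_mem_sections {π : P →* (V →L[ℝ] V)} {f : B → V} (hf : f ∈ 𝒢.sections π) :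
    𝒢.curvedCasimir f ∈ 𝒢.sections π :=
  ⟨𝒢.contMDiff_curvedCasimir hf.1, fun u h => 𝒢.curvedCasimir_act hf.1 (fun v => hf.2 v h) u⟩

lemma contMDiff_comp_proj {g : M → ℝ} (hg : ContMDiff 𝓘(ℝ, EM) 𝓘(ℝ, ℝ) ∞ g) :
    ContMDiff 𝓘(ℝ, EB) 𝓘(ℝ, ℝ) ∞ (fun u => g (𝒢.proj u)) :=
  hg.comp 𝒢.contMDiff_proj

lemma derivAt_comp_proj {g : M → ℝ} (hg : ContMDiff 𝓘(ℝ, EM) 𝓘(ℝ, ℝ) ∞ g) (u : B)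
    (A : GroupLieAlgebra 𝓘(ℝ, EP) P) :
    𝒢.derivAt (fun u => g (𝒢.proj u)) u (lieIncl P A) = 0 :=
  𝒢.fundamentalDerivative_vertical_eq_zero
    ((𝒢.contMDiff_comp_proj hg).mdifferentiable (by simp)) (fun u h => by rw [𝒢.proj_act]) u A

lemma killingContraction_linear {V' : Type*} [AddCommGroup V'] [Module ℝ V'] :
    ∃ K : (GroupLieAlgebra 𝓘(ℝ, E) G →ₗ[ℝ] GroupLieAlgebra 𝓘(ℝ, E) G →ₗ[ℝ] V') →ₗ[ℝ] V',
      ∀ β, K β = killingContraction β :=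
  ⟨{ toFun := killingContraction
     map_add' := fun β γ => by simp [killingContraction, Finset.sum_add_distrib]
     map_smul' := fun c β => by simp [killingContraction, Finset.smul_sum] }, fun _ => rfl⟩

/-- The iterated commutators of the curved Casimir operator with smooth functions on the base
vanish. -/
lemma curvedCasimir_commutator
    (hpar : IsParabolicImage (lieIncl (E := E) (EP := EP) P).toLinearMap)
    {g₁ g₂ : M → ℝ} (hg₁ : ContMDiff 𝓘(ℝ, EM) 𝓘(ℝ, ℝ) ∞ g₁)
    (hg₂ : ContMDiff 𝓘(ℝ, EM) 𝓘(ℝ, ℝ) ∞ g₂) {f : B → V} (hf : ContMDiff 𝓘(ℝ, EB) 𝓘(ℝ, V) ∞ f) :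
    𝒢.curvedCasimir (𝒢.baseMul g₁ (𝒢.baseMul g₂ f)) -
        𝒢.baseMul g₁ (𝒢.curvedCasimir (𝒢.baseMul g₂ f)) =
      𝒢.baseMul g₂ (𝒢.curvedCasimir (𝒢.baseMul g₁ f) - 𝒢.baseMul g₁ (𝒢.curvedCasimir f)) := by
  obtain ⟨H, hH, b, hb⟩ := hpar
  obtain ⟨K, hK⟩ := killingContraction_linear (E := E) (G := G) (V' := V)
  have h₁ := 𝒢.contMDiff_comp_proj hg₁
  have h₂ := 𝒢.contMDiff_comp_proj hg₂
  have h₂f : ContMDiff 𝓘(ℝ, EB) 𝓘(ℝ, V) ∞ (fun v => g₂ (𝒢.proj v) • f v) := h₂.smul hf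
  ext u
  set G₁ : B → ℝ := fun u => g₁ (𝒢.proj u) with hG₁
  set G₂ : B → ℝ := fun u => g₂ (𝒢.proj u) with hG₂
  -- All terms containing second derivatives of g₁ or derivatives of f cancel in the iterated
  -- commutator; only the symmetrized product of the two differentials survives.
  have hβ : ∀ X Y, (𝒢.hessAt (fun v => G₁ v • G₂ v • f v) u
      - G₁ u • 𝒢.hessAt (fun v => G₂ v • f v) u
      - G₂ u • (𝒢.hessAt (fun v => G₁ v • f v) u - G₁ u • 𝒢.hessAt f u)) X Y =
      𝒢.derivAt G₁ u Y • 𝒢.derivAt G₂ u X • f u + 𝒢.derivAt G₁ u X • 𝒢.derivAt G₂ u Y • f u := by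
    intro X Y
    have e₁ := 𝒢.fundamentalDerivative_smul (h₂.mdifferentiable (by simp))
      (hf.mdifferentiable (by simp)) u ((modelEquiv E G).symm X)
    have e₂ := 𝒢.fundamentalDerivative_smul (h₂.mdifferentiable (by simp))
      (hf.mdifferentiable (by simp)) u ((modelEquiv E G).symm Y)
    simp only [← derivAt_apply] at e₁ e₂
    simp only [LinearMap.sub_apply, LinearMap.smul_apply]
    rw [𝒢.hessAt_smul h₁ h₂f, 𝒢.hessAt_smul h₁ hf, e₁, e₂]
    module
  have hzero := killingContraction_eq_zero_of_vanish hb _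
    (fun A Y => by
      rw [hβ, ContinuousLinearMap.coe_coe, hG₁, hG₂, 𝒢.derivAt_comp_proj hg₁,
        𝒢.derivAt_comp_proj hg₂]
      simp)
    (fun Y A => by
      rw [hβ, ContinuousLinearMap.coe_coe, hG₁, hG₂, 𝒢.derivAt_comp_proj hg₁,
        𝒢.derivAt_comp_proj hg₂]
      simp)
  rw [← hK] at hzero
  simp only [map_sub, map_smul] at hzero
  simp only [hK] at hzero
  exact sub_eq_zero.1 hzero

/-- The curved Casimir operator is a differential operator of order at most one. -/
theorem isDifferentialOperator_curvedCasimir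
    (hpar : IsParabolicImage (lieIncl (E := E) (EP := EP) P).toLinearMap)
    (π : P →* (V →L[ℝ] V)) : 𝒢.IsDifferentialOperator π 1 𝒢.curvedCasimir where
  maps_sections _ hf := 𝒢.curvedCasimir_mem_sections hf
  map_add f hf g hg := by
    obtain ⟨K, hK⟩ := killingContraction_linear (E := E) (G := G) (V' := V)
    ext u
    simp only [Pi.add_apply, curvedCasimir_eq, 𝒢.hessAt_add hf.1 hg.1, ← hK, map_add]
  map_smul c f hf := by
    obtain ⟨K, hK⟩ := killingContraction_linear (E := E) (G := G) (V' := V)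
    ext u
    simp only [Pi.smul_apply, curvedCasimir_eq, 𝒢.hessAt_const_smul hf.1, ← hK, map_smul]
  order_le _ hg₁ _ hg₂ _ hf := 𝒢.curvedCasimir_commutator hpar hg₁ hg₂ hf.1

end Casimir

variable [FiniteDimensional ℝ E] [LieGroup 𝓘(ℝ, E) ∞ G] [FiniteDimensional ℝ EP]
  [LieGroup 𝓘(ℝ, EP) ∞ P]

/-- The two-jet of an equivariant function in vertical directions is determined by the
infinitesimal action. -/
theorem isJet (hval : ContMDiff 𝓘(ℝ, EP) 𝓘(ℝ, E) ∞ (Subtype.val : P → G))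
    {π : P →* (V →L[ℝ] V)} (hπ : ContMDiff 𝓘(ℝ, EP) 𝓘(ℝ, V →L[ℝ] V) ∞ π)
    {f : B → V} (hf : f ∈ 𝒢.sections π) (u : B) :
    IsJet (lieIncl (E := E) (EP := EP) P).toLinearMap (fun A v => infHom π A v) (f u)
      (𝒢.derivAt f u) (𝒢.hessAt f u) := by
  have hπd := hπ.mdifferentiable (by simp) 1
  have hfd := hf.1.mdifferentiable (by simp)
  have hπA : ∀ A : GroupLieAlgebra 𝓘(ℝ, EP) P,
      HasDerivAt (fun t => π (chartCurve (1 : P) ((modelEquiv EP P).symm A) t)) (infHom π A) 0 :=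
    fun A => hasDerivAt_comp_chartCurve hπd _
  have hcancel : ∀ (h : P) (w : V), π h (π h⁻¹ w) = w := fun h w => by
    rw [← mul_apply_eq_comp, ← map_mul, mul_inv_cancel, map_one]
    rfl
  have hincl : ∀ (u : B) (A : GroupLieAlgebra 𝓘(ℝ, EP) P),
      𝒢.derivAt f u (lieIncl P A) = -infHom π A (f u) := by
    intro u A
    -- The product rule for π(h) f(u·h), which is constantly f(u), gives A·f + Df(A) = 0.
    have h1 := (hπA A).clm_apply (𝒢.hasDerivAt_vertical (hfd u) A)
    simp only [hf.2, hcancel, chartCurve_zero, inv_one, map_one] at h1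
    exact (neg_eq_of_add_eq_zero_right (h1.unique (hasDerivAt_const 0 _))).symm
  refine ⟨hincl u, fun A Y => ?_, fun Y A => ?_⟩
  -- Here π(h) Df(u·h)(Y) = Df(u)(Ad(h)Y) is differentiated at h = 1, the right side contributing
  -- Df([A,Y]).
  · have h1 := (hπA A).clm_apply (𝒢.hasDerivAt_vertical ((𝒢.contMDiff_fundamentalDerivative_apply
      hf.1 ((modelEquiv E G).symm Y)).mdifferentiable (by simp) u) A)
    simp only [𝒢.fundamentalDerivative_act hfd (fun v => hf.2 v _), hcancel, chartCurve_zero,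
      𝒢.act_one, map_one, 𝒢.fundamentalDerivative_apply_const hf.1] at h1
    let F : G → E := fun g => (modelEquiv E G).symm (Ad g Y)
    have hF : MDifferentiableAt 𝓘(ℝ, E) 𝓘(ℝ, E) F ((1 : P) : G) := (mfderiv_Ad_one Y).1
    have hv := hval.mdifferentiable (by simp) (1 : P)
    have h2 := hasDerivAt_comp_chartCurve (F := F ∘ (Subtype.val : P → G)) (hF.comp (1 : P) hv)
      ((modelEquiv EP P).symm A)
    have h3 : (mfderiv 𝓘(ℝ, EP) 𝓘(ℝ, E) (F ∘ (Subtype.val : P → G)) 1 : EP →L[ℝ] E)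
        ((modelEquiv EP P).symm A) = (modelEquiv E G).symm ⁅lieIncl P A, Y⁆ :=
      (DFunLike.congr_fun (mfderiv_comp_eq (E := EP) hF hv rfl) ((modelEquiv EP P).symm A)).trans
        ((mfderiv_Ad_one Y).2 (lieIncl P A))
    rw [h3] at h2
    have h4 := h1.unique ((𝒢.fundamentalDerivative f u).hasFDerivAt.comp_hasDerivAt (0 : ℝ) h2)
    rw [add_comm] at h4
    exact (eq_sub_of_add_eq h4).trans (by rw [sub_eq_neg_add]; rfl)
  -- Since Df(A) = -A·f holds at every point of B, it can be differentiated in an arbitrary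
  -- direction Y.
  · rw [hessAt_apply, ← 𝒢.fundamentalDerivative_apply_const hf.1]
    rw [show (fun v => 𝒢.fundamentalDerivative f v ((modelEquiv E G).symm
      ((lieIncl P).toLinearMap A))) = fun v => (-infHom π A) (f v) from funext fun v => hincl v A]
    rw [𝒢.fundamentalDerivative_clm hfd]
    rfl

end

end CartanGeometry

end CurvedCasimir

end

/-! ### The main theorem -/

open CurvedCasimir LieAlgebra in
theorem theorem3p4
    {E : Type*} [NormedAddCommGroup E] [NormedSpace ℝ E] [FiniteDimensional ℝ E]
    {G : Type*} [TopologicalSpace G] [ChartedSpace E G] [Group G] [LieGroup 𝓘(ℝ, E) ∞ G]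
    [IsSemisimple ℝ (GroupLieAlgebra 𝓘(ℝ, E) G)]
    {EP : Type*} [NormedAddCommGroup EP] [NormedSpace ℝ EP] [FiniteDimensional ℝ EP]
    (P : Subgroup G) [ChartedSpace EP P] [LieGroup 𝓘(ℝ, EP) ∞ P]
    (hP : IsParabolicSubgroup (E := E) (EP := EP) P) :
    -- every natural bundle
    (∀ {W : Type*} [NormedAddCommGroup W] [NormedSpace ℝ W] [FiniteDimensional ℝ W]
      (π : P →* (W →L[ℝ] W)), ContMDiff 𝓘(ℝ, EP) 𝓘(ℝ, W →L[ℝ] W) ∞ π →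
      ∀ {EM : Type*} [NormedAddCommGroup EM] [NormedSpace ℝ EM] [FiniteDimensional ℝ EM]
        {M : Type*} [TopologicalSpace M] [T2Space M] [ChartedSpace EM M] [IsManifold 𝓘(ℝ, EM) ∞ M]
        {EB : Type*} [NormedAddCommGroup EB] [NormedSpace ℝ EB] [FiniteDimensional ℝ EB]
        {B : Type*} [TopologicalSpace B] [ChartedSpace EB B] [IsManifold 𝓘(ℝ, EB) ∞ B]
        (𝒢 : CartanGeometry (E := E) (EP := EP) (EM := EM) (EB := EB) P M B),
        𝒢.IsDifferentialOperator π 1 𝒢.curvedCasimir) ∧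
    -- irreducible complex representations
    (∀ {W : Type*} [NormedAddCommGroup W] [NormedSpace ℂ W] [FiniteDimensional ℂ W]
      (π : P →* (W →L[ℂ] W)), ContMDiff 𝓘(ℝ, EP) 𝓘(ℝ, W →L[ℂ] W) ∞ π →
      (toRepresentation π).IsIrreducible →
      ∃ c : ℂ,
        (∀ {EM : Type*} [NormedAddCommGroup EM] [NormedSpace ℝ EM] [FiniteDimensional ℝ EM]
          {M : Type*} [TopologicalSpace M] [T2Space M] [ChartedSpace EM M]
          [IsManifold 𝓘(ℝ, EM) ∞ M]
          {EB : Type*} [NormedAddCommGroup EB] [NormedSpace ℝ EB] [FiniteDimensional ℝ EB]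
          {B : Type*} [TopologicalSpace B] [ChartedSpace EB B] [IsManifold 𝓘(ℝ, EB) ∞ B]
          (𝒢 : CartanGeometry (E := E) (EP := EP) (EM := EM) (EB := EB) P M B),
          ∀ f ∈ 𝒢.sections (realForm π), 𝒢.curvedCasimir f = c • f) ∧
        ∀ (H : LieSubalgebra ℂ (ℂ ⊗[ℝ] GroupLieAlgebra 𝓘(ℝ, E) G)) [H.IsCartanSubalgebra]
          (b : (IsKilling.rootSystem H).Base) (ν : Module.Dual ℂ H),
          IsStandardParabolic b
            (LinearMap.range ((lieIncl (E := E) (EP := EP) P).toLinearMap.baseChange ℂ)) →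
          IsLowestWeight (lieIncl (E := E) (EP := EP) P).toLinearMap (infAction π) b (-ν) →
          c = weightInner H (ν + halfSumPosRoots b) (ν + halfSumPosRoots b) -
                weightInner H (halfSumPosRoots b) (halfSumPosRoots b) ∧
          c = weightInner H ν ν + 2 * weightInner H ν (halfSumPosRoots b)) ∧
    -- irreducible real representations without invariant complex structure
    (∀ {W : Type*} [NormedAddCommGroup W] [NormedSpace ℝ W] [FiniteDimensional ℝ W]
      (π : P →* (W →L[ℝ] W)), ContMDiff 𝓘(ℝ, EP) 𝓘(ℝ, W →L[ℝ] W) ∞ π →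
      (toRepresentation π).IsIrreducible → ¬ HasInvariantComplexStructure π →
      ∃ c : ℝ,
        (∀ {EM : Type*} [NormedAddCommGroup EM] [NormedSpace ℝ EM] [FiniteDimensional ℝ EM]
          {M : Type*} [TopologicalSpace M] [T2Space M] [ChartedSpace EM M]
          [IsManifold 𝓘(ℝ, EM) ∞ M]
          {EB : Type*} [NormedAddCommGroup EB] [NormedSpace ℝ EB] [FiniteDimensional ℝ EB]
          {B : Type*} [TopologicalSpace B] [ChartedSpace EB B] [IsManifold 𝓘(ℝ, EB) ∞ B]
          (𝒢 : CartanGeometry (E := E) (EP := EP) (EM := EM) (EB := EB) P M B),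
          ∀ f ∈ 𝒢.sections π, 𝒢.curvedCasimir f = c • f) ∧
        ∀ (H : LieSubalgebra ℂ (ℂ ⊗[ℝ] GroupLieAlgebra 𝓘(ℝ, E) G)) [H.IsCartanSubalgebra]
          (b : (IsKilling.rootSystem H).Base) (ν : Module.Dual ℂ H),
          IsStandardParabolic b
            (LinearMap.range ((lieIncl (E := E) (EP := EP) P).toLinearMap.baseChange ℂ)) →
          IsLowestWeight (lieIncl (E := E) (EP := EP) P).toLinearMap
            (infActionComplexified π) b (-ν) →
          (c : ℂ) = weightInner H (ν + halfSumPosRoots b) (ν + halfSumPosRoots b) -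
                weightInner H (halfSumPosRoots b) (halfSumPosRoots b) ∧
          (c : ℂ) = weightInner H ν ν + 2 * weightInner H ν (halfSumPosRoots b)) := by
  have hpar := hP.parabolic
  have hval := hP.contMDiff_val
  have hinj := hP.injective_lieIncl
  refine ⟨fun π _ => ?_, fun {W} _ _ _ π hπ hirr => ?_, fun {W} _ _ _ π hπ hirr hJ => ?_⟩
  · intro EM _ _ _ M _ _ _ _ EB _ _ _ B _ _ _ 𝒢
    exact 𝒢.isDifferentialOperator_curvedCasimir hpar π
  · obtain ⟨c, hc, hν⟩ :=
      (isInfinitesimalAction_infAction hval hinj hπ).exists_scalar hirr hpar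
    refine ⟨c, ?_, fun H _ b ν hb hlow => ?_⟩
    · intro EM _ _ _ M _ _ _ _ EB _ _ _ B _ _ _ 𝒢 f hf
      ext u
      have hj := 𝒢.isJet hval (contMDiff_realForm hπ) hf u
      simp only [infHom_realForm hπ] at hj
      exact hc _ _ _ hj
    · rw [weightInner_add_sub]
      exact ⟨hν H b ν hb hlow, hν H b ν hb hlow⟩
  · obtain ⟨c, hc, hν⟩ :=
      (isInfinitesimalAction_infActionReal hval hinj hπ).exists_scalar_real hirr hJ hpar
        (infActionComplexified_apply π)
    refine ⟨c, ?_, fun H _ b ν hb hlow => ?_⟩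
    · intro EM _ _ _ M _ _ _ _ EB _ _ _ B _ _ _ 𝒢 f hf
      ext u
      exact hc _ _ _ (𝒢.isJet hval hπ hf u)
    · rw [weightInner_add_sub]
      exact ⟨hν H b ν hb hlow, hν H b ν hb hlow⟩
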